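/- Let $d\in\{3,5\}$, $\omega=e^{2\pi i/d}$, $X|j\rangle=|j+1 \bmod d\rangle$, $Z|j\rangle=\omega^j|j\rangle$, and $P_{(x_1,x_2|z_1,z_2)}=(X^{x_1}\otimes X^{x_2})(Z^{z_1}\otimes Z^{z_2})$ with $x_i,z_i\in\mathbb Z_d$. Let $\Pi_{(x_1,x_2|z_1,z_2)[k]}=\frac1d\sum_{m=0}^{d-1}\omega^{-mk}(P_{(x_1,x_2|z_1,z_2)})^m$. The single-qudit Clifford gates are the unitaries $C$ such that, for every $a,b$, $C X^aZ^bC^\dagger$ is a power of $\omega$ times some $X^{a'}Z^{b'}$. The Clifford polytope is the convex hull of the finitely many states $|J_C\rangle\langle J_C|$, where $|J_C\rangle=(\mathbb I\otimes C)\frac1{\sqrt d}\sum_j|jj\rangle$ and $C$ runs over the Clifford gates; these states (its *Clifford vertices*, in which the global phase of $C$ drops out) are identified with their vectors of $(d^2-1)^2$ coefficients $\mathrm{Tr}(P^\dagger_{(x_1,x_2|z_1,z_2)}\tau)$, $(x_1,z_1)\ne(0,0)\ne(x_2,z_2)$. For a Hermitian operator $W$ and $g\in\mathbb R$ such that $\mathrm{Tr}(W\tau)\ge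 g$ for all Clifford vertices $\tau$, with equality for some but not all of them, the pair $(W,g)$ is a *true facet* if the vertices with $\mathrm{Tr}(W\tau)=g$ have rank $(d^2-1)^2$ (as coefficient vectors), and a *peak* if their rank is smaller. The *orbit* of $W$ is the set of all $(C\otimes C')W(C\otimes C')^\dagger$ with $C,C'$ Clifford gates. **($d=3$, $g=0$.)** Write $\Sigma_0=\Pi_{(0,0|1,1)[0]}+\Pi_{(0,0|1,2)[0]}$ and define $W_A^{(1)}=\frac13\big(\Sigma_0+\Pi_{(1,0|0,1)[0]}+\Pi_{(1,0|0,2)[0]}+\Pi_{(1,0|1,1)[0]}+\Pi_{(1,0|1,2)[0]}+\Pi_{(1,0|2,1)[0]}+\Pi_{(1,0|2,2)[0]}-\frac73\mathbb I\big)$, $W_A^{(2)}=\frac13\big(\Sigma_0+\Pi_{(1,0|0,1)[0]}+\Pi_{(1,0|0,2)[0]}+\Pi_{(1,0|1,1)[1]}+\Pi_{(1,0|1,2)[1]}+\Pi_{(1,0|2,1)[2]}+\Pi_{(1,0|2,2)[2]}-\frac73\mathbb I\big)$, $W_{A^T}^{(1)}=\frac13\big(\Sigma_0+\Pi_{(0,1|1,0)[0]}+\Pi_{(0,1|1,1)[0]}+\Pi_{(0,1|1,2)[0]}+\Pi_{(0,1|2,0)[0]}+\Pi_{(0,1|2,1)[0]}+\Pi_{(0,1|2,2)[0]}-\frac73\mathbb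 I\big)$, $W_{A^T}^{(2)}=\frac13\big(\Sigma_0+\Pi_{(0,1|1,0)[0]}+\Pi_{(0,1|1,1)[1]}+\Pi_{(0,1|1,2)[2]}+\Pi_{(0,1|2,0)[0]}+\Pi_{(0,1|2,1)[1]}+\Pi_{(0,1|2,2)[2]}-\frac73\mathbb I\big)$, $W_B^{(i)}=\frac13\big(\Sigma_0+\sum_{a,b\in\mathbb Z_3}\Pi_{(1,2|a,b)[k^{(i)}_{ab}]}-\frac{10}3\mathbb I\big)$ for $i=1,2,3$, where $(k_{00},k_{01},k_{02},k_{10},k_{11},k_{12},k_{20},k_{21},k_{22})$ is $(0,0,0,0,0,0,0,0,0)$ for $i=1$, $(0,2,1,1,0,2,2,1,0)$ for $i=2$, and $(2,0,2,2,2,0,0,2,2)$ for $i=3$. Then $W_A^{(1)},W_{A^T}^{(1)},W_B^{(1)},W_B^{(3)}$ are true facets (rank $64$), on which lie $144,144,150,150$ Clifford vertices respectively, while $W_A^{(2)},W_{A^T}^{(2)},W_B^{(2)}$ are only peaks, with $144,144,150$ Clifford vertices of rank $62$. The orbits of $W_A^{(1)},W_A^{(2)},W_{A^T}^{(1)},W_{A^T}^{(2)},W_B^{(1)},W_B^{(2)},W_B^{(3)}$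 have $864,108,864,108,1728,864,5184$ elements. The union of the orbits of the four true facets has exactly $8640$ elements; all of them are true facets, and no two of them contain the same set of Clifford vertices. The union of the orbits of the three peaks has exactly $1080$ elements, and all of them are peaks. **($d=5$, $g=\frac{56}5$.)** Let $W_B$ be the sum of the $58$ projectors $\Pi_{(x_1,x_2|z_1,z_2)[k]}$ with the following $(z_1,z_2;k)$. For $(x_1,x_2)=(0,0)$: $(1,1;0),\ (1,2;0),\ (1,3;0),\ (1,4;0),\ (2,1;0)$, $(2,2;0),\ (2,3;0),\ (2,4;0)$. For $(x_1,x_2)=(1,4)$: $(0,0;0),\ (0,1;1),\ (0,2;3),\ (0,3;1),\ (0,4;0)$, $(1,0;0),\ (1,1;0),\ (1,2;1),\ (1,3;3),\ (1,4;1)$, $(2,0;1),\ (2,1;0),\ (2,2;0),\ (2,3;1),\ (2,4;3)$, $(3,0;3),\ (3,1;1),\ (3,2;0),\ (3,3;0),\ (3,4;1)$, $(4,0;1),\ (4,1;3),\ (4,2;1),\ (4,3;0),\ (4,4;0)$. For $(x_1,x_2)=(2,3)$: $(0,0;0),\ (0,1;0),\ (0,2;3),\ (0,3;4),\ (0,4;3)$,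 $(1,0;3),\ (1,1;0),\ (1,2;0),\ (1,3;3),\ (1,4;4)$, $(2,0;4),\ (2,1;3),\ (2,2;0),\ (2,3;0),\ (2,4;3)$, $(3,0;3),\ (3,1;4),\ (3,2;3),\ (3,3;0),\ (3,4;0)$, $(4,0;0),\ (4,1;3),\ (4,2;4),\ (4,3;3),\ (4,4;0)$. Then $(W_B,\frac{56}5)$ is a true facet of the Clifford polytope for $d=5$ (equivalently, $W_B-\frac{56}5\mathbb I$ is one with right-hand side $0$): $\mathrm{Tr}(W_B\tau)\ge\frac{56}5$ for every Clifford vertex $\tau$, exactly $2420$ Clifford vertices attain equality, and their rank is $576=(5^2-1)^2$. -/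

import Mathlib

namespace QuditClifford

open scoped Matrix Kronecker

noncomputable section

/-- Operators on one `d`-level system; the computational basis is indexed by `ZMod d`. -/
abbrev QuditOp (d : ℕ) := Matrix (ZMod d) (ZMod d) ℂ

/-- Operators on a pair of `d`-level systems. -/
abbrev TwoQuditOp (d : ℕ) := Matrix (ZMod d × ZMod d) (ZMod d × ZMod d) ℂ

/-- The primitive root of unity `exp (2 π i / d)`. -/
def omega (d : ℕ) : ℂ := Complex.exp (2 * Real.pi * Complex.I / d)

variable (d : ℕ) [NeZero d]

/-- The shift operator, `X |j⟩ = |j + 1⟩`. -/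
def shiftX : QuditOp d := Matrix.of fun i j => if i = j + 1 then 1 else 0

/-- The clock operator, `Z |j⟩ = ω ^ j |j⟩`. -/
def clockZ : QuditOp d := Matrix.diagonal fun j => omega d ^ j.val

/-- The single-qudit Pauli operator `P_(a|b) = X ^ a Z ^ b` (the convention for odd `d`). -/
def pauli (a b : ZMod d) : QuditOp d := shiftX d ^ a.val * clockZ d ^ b.val

/-- The two-qudit Pauli operator
`P_(x₁,x₂|z₁,z₂) = (X ^ x₁ ⊗ X ^ x₂) (Z ^ z₁ ⊗ Z ^ z₂)`. -/
def pauli2 (x₁ x₂ z₁ z₂ : ZMod d) : TwoQuditOp d :=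
  ((shiftX d ^ x₁.val) ⊗ₖ (shiftX d ^ x₂.val)) * ((clockZ d ^ z₁.val) ⊗ₖ (clockZ d ^ z₂.val))

/-- The projector `Π_(x₁,x₂|z₁,z₂)[k] = (1/d) ∑_{m < d} ω ^ (-m k) P_(x₁,x₂|z₁,z₂) ^ m`
onto the `ω ^ k` eigenspace of `P_(x₁,x₂|z₁,z₂)`. -/
def proj2 (x₁ x₂ z₁ z₂ k : ZMod d) : TwoQuditOp d :=
  (1 / d : ℂ) • ∑ m ∈ Finset.range d,
    ((omega d)⁻¹ ^ (m * k.val)) • (pauli2 d x₁ x₂ z₁ z₂) ^ m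

/-- The sum of the projectors `Π_(x₁,x₂|z₁,z₂)[k]` over a list of tuples
`(x₁, x₂, z₁, z₂, k)`. -/
def projSum (l : List (ZMod d × ZMod d × ZMod d × ZMod d × ZMod d)) : TwoQuditOp d :=
  (l.map fun t => proj2 d t.1 t.2.1 t.2.2.1 t.2.2.2.1 t.2.2.2.2).sum

/-- The single-qudit Clifford gates: the unitaries that conjugate every Pauli operator to a
Pauli operator times a power of `ω`. Global phases are not divided out here; they drop out of
everything below. -/
def cliffordGates : Set (QuditOp d) :=
  {U | U ∈ Matrix.unitaryGroup (ZMod d) ℂ ∧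
    ∀ a b : ZMod d, ∃ c a' b' : ZMod d,
      U * pauli d a b * Uᴴ = omega d ^ c.val • pauli d a' b'}

/-- The Choi-Jamiołkowski vector `|J_U⟩ = (I ⊗ U) ∑_j |jj⟩ / √d`. -/
def choiKet (U : QuditOp d) : ZMod d × ZMod d → ℂ :=
  ((1 : QuditOp d) ⊗ₖ U) *ᵥ fun p => if p.1 = p.2 then 1 / (Real.sqrt d : ℂ) else 0

/-- The Choi-Jamiołkowski state `|J_U⟩⟨J_U|`. -/
def choiState (U : QuditOp d) : TwoQuditOp d :=
  Matrix.vecMulVec (choiKet d U) (star (choiKet d U))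

/-- The vertices of the Clifford polytope: the Choi-Jamiołkowski states of the Clifford gates.
Gates that differ by a global phase give the same vertex. -/
def cliffordVertices : Set (TwoQuditOp d) := choiState d '' cliffordGates d

/-- Labels `(x₁, x₂, z₁, z₂)` of the `(d² - 1)²` two-qudit Pauli operators of weight two,
that is, those acting nontrivially on both systems. -/
abbrev WeightTwo :=
  {v : ZMod d × ZMod d × ZMod d × ZMod d //
    ¬ (v.1 = 0 ∧ v.2.2.1 = 0) ∧ ¬ (v.2.1 = 0 ∧ v.2.2.2 = 0)}

/-- The vector of the `(d² - 1)²` weight-two Pauli coefficients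
`c_(x₁,x₂|z₁,z₂) = Tr (P_(x₁,x₂|z₁,z₂)† τ)` of a two-qudit operator `τ`. -/
def coeffVec (τ : TwoQuditOp d) : WeightTwo d → ℂ := fun v =>
  Matrix.trace ((pauli2 d v.1.1 v.1.2.1 v.1.2.2.1 v.1.2.2.2)ᴴ * τ)

/-- The vertices on the hyperplane `Tr (W τ) = g`. -/
def contactVertices (W : TwoQuditOp d) (g : ℝ) : Set (TwoQuditOp d) :=
  {τ | τ ∈ cliffordVertices d ∧ (Matrix.trace (W * τ)).re = g}

/-- The rank of the vertices on the hyperplane `Tr (W τ) = g`, as vectors of weight-two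
coefficients. These vectors lie in a real form of `ℂ ^ ((d² - 1)²)` (the coefficients of
Hermitian operators), so that their real and complex ranks agree. -/
def contactRank (W : TwoQuditOp d) (g : ℝ) : ℕ :=
  Module.finrank ℂ (Submodule.span ℂ (coeffVec d '' contactVertices d W g))

/-- `Tr (W τ) ≥ g`, for a Hermitian `W`, is a valid inequality for the Clifford polytope, and
not all vertices satisfy it with equality. -/
def IsSupporting (W : TwoQuditOp d) (g : ℝ) : Prop :=
  W.IsHermitian ∧
  (∀ τ ∈ cliffordVertices d, g ≤ (Matrix.trace (W * τ)).re) ∧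
  ∃ τ ∈ cliffordVertices d, (Matrix.trace (W * τ)).re ≠ g

/-- `Tr (W τ) ≥ g` is a true facet of the Clifford polytope: it is a valid inequality, and
`(d² - 1)²` linearly independent vertices satisfy it with equality. -/
def IsTrueFacet (W : TwoQuditOp d) (g : ℝ) : Prop :=
  IsSupporting d W g ∧ contactRank d W g = (d ^ 2 - 1) ^ 2

/-- `Tr (W τ) ≥ g` is a peak: it is a valid inequality that some vertices satisfy with equality,
but these have less than full rank, so that it is not a facet. -/
def IsPeak (W : TwoQuditOp d) (g : ℝ) : Prop :=
  IsSupporting d W g ∧ (contactVertices d W g).Nonempty ∧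
    contactRank d W g < (d ^ 2 - 1) ^ 2

/-- The orbit of `W` under conjugation by local Clifford gates. -/
def localOrbit (W : TwoQuditOp d) : Set (TwoQuditOp d) :=
  {W' | ∃ C₁ ∈ cliffordGates d, ∃ C₂ ∈ cliffordGates d, W' = (C₁ ⊗ₖ C₂) * W * (C₁ ⊗ₖ C₂)ᴴ}

/-- The qutrit witness `W_A^{(1)}`. -/
def WA1 : TwoQuditOp 3 :=
  (1 / 3 : ℂ) • (projSum 3
    [(0, 0, 1, 1, 0), (0, 0, 1, 2, 0), (1, 0, 0, 1, 0), (1, 0, 0, 2, 0),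
      (1, 0, 1, 1, 0), (1, 0, 1, 2, 0), (1, 0, 2, 1, 0), (1, 0, 2, 2, 0)]
    - (7 / 3 : ℂ) • (1 : TwoQuditOp 3))

/-- The qutrit witness `W_A^{(2)}`. -/
def WA2 : TwoQuditOp 3 :=
  (1 / 3 : ℂ) • (projSum 3
    [(0, 0, 1, 1, 0), (0, 0, 1, 2, 0), (1, 0, 0, 1, 0), (1, 0, 0, 2, 0),
      (1, 0, 1, 1, 1), (1, 0, 1, 2, 1), (1, 0, 2, 1, 2), (1, 0, 2, 2, 2)]
    - (7 / 3 : ℂ) • (1 : TwoQuditOp 3))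

/-- The qutrit witness `W_{A^T}^{(1)}`. -/
def WAT1 : TwoQuditOp 3 :=
  (1 / 3 : ℂ) • (projSum 3
    [(0, 0, 1, 1, 0), (0, 0, 1, 2, 0), (0, 1, 1, 0, 0), (0, 1, 1, 1, 0),
      (0, 1, 1, 2, 0), (0, 1, 2, 0, 0), (0, 1, 2, 1, 0), (0, 1, 2, 2, 0)]
    - (7 / 3 : ℂ) • (1 : TwoQuditOp 3))

/-- The qutrit witness `W_{A^T}^{(2)}`. -/
def WAT2 : TwoQuditOp 3 :=
  (1 / 3 : ℂ) • (projSum 3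
    [(0, 0, 1, 1, 0), (0, 0, 1, 2, 0), (0, 1, 1, 0, 0), (0, 1, 1, 1, 1),
      (0, 1, 1, 2, 2), (0, 1, 2, 0, 0), (0, 1, 2, 1, 1), (0, 1, 2, 2, 2)]
    - (7 / 3 : ℂ) • (1 : TwoQuditOp 3))

/-- The qutrit witness `W_B^{(1)}`. -/
def WB1 : TwoQuditOp 3 :=
  (1 / 3 : ℂ) • (projSum 3
    [(0, 0, 1, 1, 0), (0, 0, 1, 2, 0), (1, 2, 0, 0, 0), (1, 2, 0, 1, 0),
      (1, 2, 0, 2, 0), (1, 2, 1, 0, 0), (1, 2, 1, 1, 0), (1, 2, 1, 2, 0),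
      (1, 2, 2, 0, 0), (1, 2, 2, 1, 0), (1, 2, 2, 2, 0)]
    - (10 / 3 : ℂ) • (1 : TwoQuditOp 3))

/-- The qutrit witness `W_B^{(2)}`. -/
def WB2 : TwoQuditOp 3 :=
  (1 / 3 : ℂ) • (projSum 3
    [(0, 0, 1, 1, 0), (0, 0, 1, 2, 0), (1, 2, 0, 0, 0), (1, 2, 0, 1, 2),
      (1, 2, 0, 2, 1), (1, 2, 1, 0, 1), (1, 2, 1, 1, 0), (1, 2, 1, 2, 2),
      (1, 2, 2, 0, 2), (1, 2, 2, 1, 1), (1, 2, 2, 2, 0)]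
    - (10 / 3 : ℂ) • (1 : TwoQuditOp 3))

/-- The qutrit witness `W_B^{(3)}`. -/
def WB3 : TwoQuditOp 3 :=
  (1 / 3 : ℂ) • (projSum 3
    [(0, 0, 1, 1, 0), (0, 0, 1, 2, 0), (1, 2, 0, 0, 2), (1, 2, 0, 1, 0),
      (1, 2, 0, 2, 2), (1, 2, 1, 0, 2), (1, 2, 1, 1, 2), (1, 2, 1, 2, 0),
      (1, 2, 2, 0, 0), (1, 2, 2, 1, 2), (1, 2, 2, 2, 2)]
    - (10 / 3 : ℂ) • (1 : TwoQuditOp 3))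

/-- The 58 tuples `(x₁, x₂, z₁, z₂, k)` that define the ququint witness. -/
def listB5 : List (ZMod 5 × ZMod 5 × ZMod 5 × ZMod 5 × ZMod 5) :=
  [(0, 0, 1, 1, 0), (0, 0, 1, 2, 0), (0, 0, 1, 3, 0), (0, 0, 1, 4, 0), (0, 0, 2, 1, 0),
   (0, 0, 2, 2, 0), (0, 0, 2, 3, 0), (0, 0, 2, 4, 0), (1, 4, 0, 0, 0), (1, 4, 0, 1, 1),
   (1, 4, 0, 2, 3), (1, 4, 0, 3, 1), (1, 4, 0, 4, 0), (1, 4, 1, 0, 0), (1, 4, 1, 1, 0),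
   (1, 4, 1, 2, 1), (1, 4, 1, 3, 3), (1, 4, 1, 4, 1), (1, 4, 2, 0, 1), (1, 4, 2, 1, 0),
   (1, 4, 2, 2, 0), (1, 4, 2, 3, 1), (1, 4, 2, 4, 3), (1, 4, 3, 0, 3), (1, 4, 3, 1, 1),
   (1, 4, 3, 2, 0), (1, 4, 3, 3, 0), (1, 4, 3, 4, 1), (1, 4, 4, 0, 1), (1, 4, 4, 1, 3),
   (1, 4, 4, 2, 1), (1, 4, 4, 3, 0), (1, 4, 4, 4, 0), (2, 3, 0, 0, 0), (2, 3, 0, 1, 0),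
   (2, 3, 0, 2, 3), (2, 3, 0, 3, 4), (2, 3, 0, 4, 3), (2, 3, 1, 0, 3), (2, 3, 1, 1, 0),
   (2, 3, 1, 2, 0), (2, 3, 1, 3, 3), (2, 3, 1, 4, 4), (2, 3, 2, 0, 4), (2, 3, 2, 1, 3),
   (2, 3, 2, 2, 0), (2, 3, 2, 3, 0), (2, 3, 2, 4, 3), (2, 3, 3, 0, 3), (2, 3, 3, 1, 4),
   (2, 3, 3, 2, 3), (2, 3, 3, 3, 0), (2, 3, 3, 4, 0), (2, 3, 4, 0, 0), (2, 3, 4, 1, 3),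
   (2, 3, 4, 2, 4), (2, 3, 4, 3, 3), (2, 3, 4, 4, 0)]

/-- The ququint witness `W_B`, the sum of the 58 listed projectors (no multiple of the identity
is subtracted). -/
def WB5 : TwoQuditOp 5 := projSum 5 listB5

end

end QuditClifford

set_option linter.unusedSectionVars false

namespace QuditClifford

open scoped Matrix Kronecker

section Weyl

variable {d : ℕ} [NeZero d]

/-- Phase-space points of one `d`-level system. -/
abbrev Vec (d : ℕ) := ZMod d × ZMod d

/-- The standard additive character `x ↦ ω ^ x`. -/
noncomputable abbrev chi : AddChar (ZMod d) ℂ := ZMod.stdAddChar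

/-- The dot product on phase space. -/
def dotv (u v : Vec d) : ZMod d := u.1 * v.1 + u.2 * v.2

/-- The symplectic form on phase space. -/
def detv (u v : Vec d) : ZMod d := u.1 * v.2 - u.2 * v.1

/-- The reflection of phase space induced by transposition. -/
def flipv (u : Vec d) : Vec d := (u.1, -u.2)

lemma omega_pow_eq_chi (n : ℕ) : omega d ^ n = chi (n : ZMod d) := by
  have := ZMod.stdAddChar_coe (N := d) (n : ℤ)
  simp only [Int.cast_natCast] at this
  rw [chi, this, omega, ← Complex.exp_nat_mul]
  congr 1
  ring

lemma omega_pow_val (x : ZMod d) : omega d ^ x.val = chi x := by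
  rw [omega_pow_eq_chi, ZMod.natCast_zmod_val]

lemma star_chi (x : ZMod d) : star (chi x) = chi (-x) :=
  (AddChar.map_neg_eq_conj _ x).symm

lemma chi_ne_zero (x : ZMod d) : chi x ≠ 0 := by
  intro hx
  have := AddChar.map_zero_eq_one (chi (d := d))
  rw [← add_neg_cancel x, AddChar.map_add_eq_mul, hx, zero_mul] at this
  exact zero_ne_one this

lemma chi_inj {x y : ZMod d} : chi x = chi y ↔ x = y :=
  ZMod.injective_stdAddChar.eq_iff

lemma chi_eq_one_iff {x : ZMod d} : chi x = 1 ↔ x = 0 := by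
  rw [← AddChar.map_zero_eq_one (chi (d := d)), chi_inj]

lemma sum_chi_mul (b : ZMod d) : ∑ x : ZMod d, chi (x * b) = if b = 0 then (d : ℂ) else 0 := by
  rw [AddChar.sum_mulShift b (ZMod.isPrimitive_stdAddChar d), ZMod.card]
  split_ifs <;> simp

lemma sum_chi_dotv (b : Vec d) :
    ∑ l : Vec d, chi (dotv l b) = if b = 0 then (d : ℂ) ^ 2 else 0 := by
  simp only [Fintype.sum_prod_type, dotv, AddChar.map_add_eq_mul, ← Finset.mul_sum,
    ← Finset.sum_mul, sum_chi_mul, Prod.ext_iff, Prod.fst_zero, Prod.snd_zero]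
  by_cases h1 : b.1 = 0 <;> by_cases h2 : b.2 = 0 <;> simp [h1, h2, sq]

/-- A function on phase space is determined by its Fourier coefficients. -/
lemma eq_zero_of_fourier {f : Vec d → ℂ} (hf : ∀ l : Vec d, ∑ u, f u * chi (dotv l u) = 0) :
    f = 0 := by
  funext w
  have h0 : ∑ l : Vec d, chi (-dotv l w) * ∑ u, f u * chi (dotv l u) = 0 := by simp [hf]
  have h1 : ∀ u, ∑ l : Vec d, chi (-dotv l w) * (f u * chi (dotv l u)) =
      if u = w then (d : ℂ) ^ 2 * f u else 0 := by
    intro u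
    have : ∀ l : Vec d, chi (-dotv l w) * (f u * chi (dotv l u)) = f u * chi (dotv l (u - w)) := by
      intro l
      rw [mul_left_comm, ← AddChar.map_add_eq_mul]
      congr 2
      simp only [dotv, Prod.fst_sub, Prod.snd_sub]
      ring
    simp only [this, ← Finset.mul_sum, sum_chi_dotv, sub_eq_zero]
    split_ifs <;> ring
  simp only [Finset.mul_sum] at h0
  rw [Finset.sum_comm] at h0
  simp only [h1, Finset.sum_ite_eq', Finset.mem_univ, if_true] at h0
  have hd : (d : ℂ) ≠ 0 := Nat.cast_ne_zero.2 (NeZero.ne d)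
  simpa [hd] using h0

lemma shiftX_pow_apply (n : ℕ) (i j : ZMod d) :
    (shiftX d ^ n) i j = if i = j + n then 1 else 0 := by
  induction n generalizing i j with
  | zero => simp [Matrix.one_apply]
  | succ n ih =>
    rw [pow_succ, Matrix.mul_apply]
    simp only [ih, ite_mul, one_mul, zero_mul]
    simp only [shiftX, Matrix.of_apply]
    rw [Finset.sum_eq_single (j + 1)]
    · simp [add_assoc, add_comm (1 : ZMod d)]
    · intro k _ hk
      simp [hk]
    · simp

lemma clockZ_pow (n : ℕ) : clockZ d ^ n = Matrix.diagonal fun j => chi (n * j : ZMod d) := by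
  rw [clockZ, Matrix.diagonal_pow]
  congr 1
  funext j
  simp only [Pi.pow_apply, omega_pow_val, ← AddChar.map_nsmul_eq_pow, nsmul_eq_mul]

lemma pauli_apply (a b i j : ZMod d) :
    pauli d a b i j = if i = j + a then chi (b * j) else 0 := by
  rw [pauli, clockZ_pow, Matrix.mul_diagonal, shiftX_pow_apply]
  simp

/-- The Weyl operators: the Pauli operators with the phases that make them symmetric. Here
`h` is the inverse of two. -/
noncomputable def weyl (h : ZMod d) (u : Vec d) : QuditOp d :=
  chi (h * (u.1 * u.2)) • pauli d u.1 u.2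

lemma weyl_apply (h : ZMod d) (u : Vec d) (i j : ZMod d) :
    weyl h u i j = if i = j + u.1 then chi (h * (u.1 * u.2) + u.2 * j) else 0 := by
  simp [weyl, pauli_apply, AddChar.map_add_eq_mul]

lemma pauli_eq_weyl (h a b : ZMod d) : pauli d a b = chi (-(h * (a * b))) • weyl h (a, b) := by
  rw [weyl, smul_smul, ← AddChar.map_add_eq_mul, neg_add_cancel, AddChar.map_zero_eq_one, one_smul]

lemma weyl_mul {h : ZMod d} (hh : 2 * h = 1) (u v : Vec d) :
    weyl h u * weyl h v = chi (-(h * detv u v)) • weyl h (u + v) := by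
  ext i j
  rw [Matrix.mul_apply, Finset.sum_eq_single (j + v.1)]
  · simp only [weyl_apply, Matrix.smul_apply, if_true, smul_eq_mul, Prod.fst_add, Prod.snd_add,
      add_assoc, add_comm v.1 u.1]
    split_ifs
    · rw [← AddChar.map_add_eq_mul, ← AddChar.map_add_eq_mul]
      congr 1
      simp only [detv]
      linear_combination (-(v.1 * u.2)) * hh
    · simp
  · intro k _ hk
    simp [weyl_apply, hk]
  · simp

@[simp] lemma weyl_zero (h : ZMod d) : weyl h 0 = 1 := by
  ext i j
  simp [weyl_apply, Matrix.one_apply]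

lemma weyl_conjTranspose {h : ZMod d} (hh : 2 * h = 1) (u : Vec d) :
    (weyl h u)ᴴ = weyl h (-u) := by
  ext i j
  simp only [Matrix.conjTranspose_apply, weyl_apply, Prod.fst_neg, Prod.snd_neg, apply_ite star,
    star_chi, star_zero]
  have : j = i + u.1 ↔ i = j + -u.1 := by
    constructor <;> intro h <;> rw [h] <;> ring
  by_cases hj : j = i + u.1
  · rw [if_pos hj, if_pos (this.1 hj), hj]
    congr 1
    linear_combination (-u.1 * u.2) * hh
  · rw [if_neg hj, if_neg fun hi => hj (this.2 hi)]

lemma weyl_transpose {h : ZMod d} (hh : 2 * h = 1) (u : Vec d) :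
    (weyl h u)ᵀ = weyl h (-flipv u) := by
  ext i j
  simp only [Matrix.transpose_apply, weyl_apply, Prod.fst_neg, Prod.snd_neg, flipv]
  have : j = i + u.1 ↔ i = j + -u.1 := by
    constructor <;> intro h <;> rw [h] <;> ring
  by_cases hj : j = i + u.1
  · rw [if_pos hj, if_pos (this.1 hj), hj]
    congr 1
    linear_combination (u.1 * u.2) * hh
  · rw [if_neg hj, if_neg fun hi => hj (this.2 hi)]

lemma weyl_pow {h : ZMod d} (hh : 2 * h = 1) (u : Vec d) (n : ℕ) :
    weyl h u ^ n = weyl h ((n : ZMod d) * u.1, (n : ZMod d) * u.2) := by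
  induction n with
  | zero =>
    rw [pow_zero, Nat.cast_zero, zero_mul, zero_mul]
    exact (weyl_zero h).symm
  | succ n ih =>
    rw [pow_succ, ih, weyl_mul hh]
    have : detv ((n : ZMod d) * u.1, (n : ZMod d) * u.2) u = 0 := by simp only [detv]; ring
    rw [this, mul_zero, neg_zero, AddChar.map_zero_eq_one, one_smul]
    congr 1
    ext <;> simp <;> ring

lemma weyl_trace (h : ZMod d) (u : Vec d) :
    (weyl h u).trace = if u = 0 then (d : ℂ) else 0 := by
  simp only [Matrix.trace, Matrix.diag_apply, weyl_apply, left_eq_add]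
  by_cases h1 : u.1 = 0
  · simp only [h1, if_true, zero_mul, mul_zero, zero_add, mul_comm u.2, sum_chi_mul]
    simp [Prod.ext_iff, h1]
  · simp [Prod.ext_iff, h1]

/-- Proportional Weyl operators are equal. -/
lemma weyl_smul_inj {h : ZMod d} {u v : Vec d} {x y : ZMod d}
    (huv : chi x • weyl h u = chi y • weyl h v) : u = v ∧ x = y := by
  have e : ∀ j, chi x * chi (h * (u.1 * u.2) + u.2 * j) =
      chi y * if j + u.1 = j + v.1 then chi (h * (v.1 * v.2) + v.2 * j) else 0 := by
    intro j
    have := congrFun (congrFun huv (j + u.1)) j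
    simpa only [Matrix.smul_apply, weyl_apply, if_true, smul_eq_mul] using this
  have h1 : u.1 = v.1 := by
    by_contra hne
    have := e 0
    simp only [add_right_inj, hne, if_false, mul_zero, ← AddChar.map_add_eq_mul] at this
    exact chi_ne_zero _ this
  simp only [h1, if_true, ← AddChar.map_add_eq_mul, chi_inj] at e
  have h2 : u.2 = v.2 := by linear_combination e 1 - e 0
  refine ⟨Prod.ext h1 h2, ?_⟩
  have := e 0
  rw [h2] at this
  linear_combination this

/-- Two-qudit Weyl operators. -/
noncomputable def weyl2 (h : ZMod d) (u v : Vec d) : TwoQuditOp d := weyl h u ⊗ₖ weyl h v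

lemma pauli2_eq_weyl2 (h x₁ x₂ z₁ z₂ : ZMod d) :
    pauli2 d x₁ x₂ z₁ z₂ = chi (-(h * (x₁ * z₁ + x₂ * z₂))) • weyl2 h (x₁, z₁) (x₂, z₂) := by
  rw [pauli2, ← Matrix.mul_kronecker_mul, weyl2]
  change pauli d x₁ z₁ ⊗ₖ pauli d x₂ z₂ = _
  rw [pauli_eq_weyl h, pauli_eq_weyl h, Matrix.smul_kronecker, Matrix.kronecker_smul, smul_smul,
    ← AddChar.map_add_eq_mul]
  congr 2
  ring

@[simp] lemma weyl2_zero (h : ZMod d) : weyl2 h 0 0 = 1 := by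
  simp [weyl2]

lemma weyl2_conjTranspose {h : ZMod d} (hh : 2 * h = 1) (u v : Vec d) :
    (weyl2 h u v)ᴴ = weyl2 h (-u) (-v) := by
  rw [weyl2, Matrix.conjTranspose_kronecker, weyl_conjTranspose hh, weyl_conjTranspose hh, weyl2]

lemma kronecker_pow {n : Type*} [Fintype n] [DecidableEq n] (A B : Matrix n n ℂ) (k : ℕ) :
    (A ⊗ₖ B) ^ k = (A ^ k) ⊗ₖ (B ^ k) := by
  induction k with
  | zero => simp
  | succ k ih => rw [pow_succ, ih, ← Matrix.mul_kronecker_mul, pow_succ, pow_succ]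

/-- Scalar multiplication of phase-space points. -/
def smulv (m : ZMod d) (u : Vec d) : Vec d := (m * u.1, m * u.2)

lemma weyl2_pow {h : ZMod d} (hh : 2 * h = 1) (u v : Vec d) (n : ℕ) :
    weyl2 h u v ^ n = weyl2 h (smulv n u) (smulv n v) := by
  rw [weyl2, kronecker_pow, weyl_pow hh, weyl_pow hh]
  rfl

lemma weyl2_trace_mul {h : ZMod d} (hh : 2 * h = 1) (u v u' v' : Vec d) :
    (weyl2 h u v * weyl2 h u' v').trace = if u + u' = 0 ∧ v + v' = 0 then (d : ℂ) ^ 2 else 0 := by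
  rw [weyl2, weyl2, ← Matrix.mul_kronecker_mul, Matrix.trace_kronecker, weyl_mul hh, weyl_mul hh,
    Matrix.trace_smul, Matrix.trace_smul, weyl_trace, weyl_trace]
  by_cases h1 : u + u' = 0
  · by_cases h2 : v + v' = 0
    · rw [eq_neg_of_add_eq_zero_right h1, eq_neg_of_add_eq_zero_right h2]
      have : ∀ w : Vec d, detv w (-w) = 0 := by
        intro w; simp only [detv, Prod.fst_neg, Prod.snd_neg]; ring
      simp [this, sq]
    · simp [h2]
  · simp [h1]

/-- The Weyl operators span. -/
lemma eq_zero_of_trace_weyl2 {h : ZMod d} {A : TwoQuditOp d}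
    (hA : ∀ u v, (weyl2 h u v * A).trace = 0) : A = 0 := by
  ext ⟨i, i'⟩ ⟨j, j'⟩
  have key := eq_zero_of_fourier
    (f := fun w : Vec d => A (w.1, w.2) (w.1 + (j - i), w.2 + (j' - i'))) (fun l => by
      have := hA (j - i, l.1) (j' - i', l.2)
      simp only [Matrix.trace, Matrix.diag_apply, Matrix.mul_apply, weyl2,
        Matrix.kroneckerMap_apply, weyl_apply] at this
      rw [Finset.sum_comm] at this
      have e : ∀ w : Vec d, ∑ k : Vec d,
          ((if k.1 = w.1 + (j - i) then chi (h * ((j - i) * l.1) + l.1 * w.1) else 0) *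
            if k.2 = w.2 + (j' - i') then chi (h * ((j' - i') * l.2) + l.2 * w.2) else 0) * A w k =
          (chi (h * ((j - i) * l.1)) * chi (h * ((j' - i') * l.2))) *
            (A (w.1, w.2) (w.1 + (j - i), w.2 + (j' - i')) * chi (dotv l w)) := by
        intro w
        rw [Finset.sum_eq_single (w.1 + (j - i), w.2 + (j' - i'))]
        · simp only [if_true, dotv, AddChar.map_add_eq_mul, Prod.mk.eta]
          ring
        · intro k _ hk
          rw [ne_eq, Prod.ext_iff, not_and_or] at hk
          rcases hk with hk | hk <;> simp only [if_neg hk, mul_zero, zero_mul]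
        · simp
      rw [Finset.sum_congr rfl fun w _ => e w, ← Finset.mul_sum] at this
      exact (mul_eq_zero.1 this).resolve_left (mul_ne_zero (chi_ne_zero _) (chi_ne_zero _)))
  have := congrFun key (i, i')
  simpa using this

end Weyl

section Gates

variable {d : ℕ} [NeZero d]

/-- Linear maps of phase space, given by the rows of their matrices. -/
abbrev Lin (d : ℕ) := Vec d × Vec d

/-- The action of a linear map on phase space. -/
def mulS (S : Lin d) (u : Vec d) : Vec d := (dotv S.1 u, dotv S.2 u)

/-- Labels of Clifford gates: a linear map of phase space and a linear phase. -/
abbrev Label (d : ℕ) := Lin d × Vec d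

/-- The gate `U` acts on the Weyl operators by the linear map and the phase given by `r`. -/
def Realizes (h : ZMod d) (U : QuditOp d) (r : Label d) : Prop :=
  U ∈ Matrix.unitaryGroup (ZMod d) ℂ ∧
    ∀ v, U * weyl h v * Uᴴ = chi (dotv r.2 v) • weyl h (mulS r.1 v)

lemma unitary_mul_conj {n : Type*} [Fintype n] [DecidableEq n] {U : Matrix n n ℂ}
    (hU : U ∈ Matrix.unitaryGroup n ℂ) : U * Uᴴ = 1 :=
  Matrix.mem_unitaryGroup_iff.1 hU

lemma unitary_conj_mul {n : Type*} [Fintype n] [DecidableEq n] {U : Matrix n n ℂ}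
    (hU : U ∈ Matrix.unitaryGroup n ℂ) : Uᴴ * U = 1 :=
  Matrix.mem_unitaryGroup_iff'.1 hU

lemma dotv_add (l u v : Vec d) : dotv l (u + v) = dotv l u + dotv l v := by
  simp only [dotv, Prod.fst_add, Prod.snd_add]; ring

lemma dotv_neg (l u : Vec d) : dotv l (-u) = -dotv l u := by
  simp only [dotv, Prod.fst_neg, Prod.snd_neg]; ring

lemma dotv_smulv (l : Vec d) (m : ZMod d) (u : Vec d) : dotv l (smulv m u) = m * dotv l u := by
  simp only [dotv, smulv]; ring

lemma mulS_add (S : Lin d) (u v : Vec d) : mulS S (u + v) = mulS S u + mulS S v := by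
  simp only [mulS, dotv_add, Prod.mk_add_mk]

lemma mulS_neg (S : Lin d) (u : Vec d) : mulS S (-u) = -mulS S u := by
  simp only [mulS, dotv_neg, Prod.neg_mk]

lemma mulS_smulv (S : Lin d) (m : ZMod d) (u : Vec d) :
    mulS S (smulv m u) = smulv m (mulS S u) := by
  simp only [mulS, dotv_smulv]; rfl

lemma mulS_sub (S : Lin d) (u v : Vec d) : mulS S (u - v) = mulS S u - mulS S v := by
  rw [sub_eq_add_neg, mulS_add, mulS_neg, sub_eq_add_neg]

@[simp] lemma mulS_zero (S : Lin d) : mulS S 0 = 0 := by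
  simp [mulS, dotv]

/-- The inverse of a linear map of determinant one. -/
def invS (S : Lin d) : Lin d := ((S.2.2, -S.1.2), (-S.2.1, S.1.1))

lemma detv_invS (S : Lin d) : detv (invS S).1 (invS S).2 = detv S.1 S.2 := by
  simp only [detv, invS]; ring

lemma mulS_invS {S : Lin d} (hS : detv S.1 S.2 = 1) (u : Vec d) : mulS S (mulS (invS S) u) = u := by
  simp only [detv] at hS
  ext <;> simp only [mulS, dotv, invS]
  · linear_combination u.1 * hS
  · linear_combination u.2 * hS

lemma invS_mulS {S : Lin d} (hS : detv S.1 S.2 = 1) (u : Vec d) : mulS (invS S) (mulS S u) = u := by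
  simp only [detv] at hS
  ext <;> simp only [mulS, dotv, invS]
  · linear_combination u.1 * hS
  · linear_combination u.2 * hS

lemma mulS_eq_zero_iff {S : Lin d} (hS : detv S.1 S.2 = 1) {u : Vec d} : mulS S u = 0 ↔ u = 0 := by
  constructor
  · intro hu
    rw [← invS_mulS hS u, hu, mulS_zero]
  · rintro rfl; simp

lemma detv_mulS (S : Lin d) (u v : Vec d) :
    detv (mulS S u) (mulS S v) = detv S.1 S.2 * detv u v := by
  simp only [detv, mulS, dotv]; ring

lemma dotv_of_additive {f : Vec d → ZMod d} (hf : ∀ u v, f (u + v) = f u + f v) (v : Vec d) :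
    f v = dotv (f (1, 0), f (0, 1)) v := by
  let g : Vec d →+ ZMod d := AddMonoidHom.mk' f hf
  have hg : ∀ (n : ℕ) (u : Vec d), f (n • u) = n • f u := fun n u => map_nsmul g n u
  have e : v = v.1.val • ((1, 0) : Vec d) + v.2.val • ((0, 1) : Vec d) := by
    ext <;> simp
  conv_lhs => rw [e]
  rw [hf, hg, hg]
  simp only [nsmul_eq_mul, ZMod.natCast_zmod_val, dotv]
  ring

lemma exists_realizes_of_mem {h : ZMod d} (hh : 2 * h = 1) {U : QuditOp d}
    (hU : U ∈ cliffordGates d) : ∃ r : Label d, detv r.1.1 r.1.2 = 1 ∧ Realizes h U r := by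
  obtain ⟨hu, hc⟩ := hU
  have hc' : ∀ v : Vec d, ∃ x : ZMod d, ∃ w : Vec d,
      U * weyl h v * Uᴴ = chi x • weyl h w := by
    intro v
    obtain ⟨c, a, b, e⟩ := hc v.1 v.2
    refine ⟨h * (v.1 * v.2) + (c + -(h * (a * b))), (a, b), ?_⟩
    rw [weyl, Matrix.mul_smul, Matrix.smul_mul, e, pauli_eq_weyl h, omega_pow_val, smul_smul,
      smul_smul, AddChar.map_add_eq_mul, AddChar.map_add_eq_mul, mul_assoc]
  choose c σ hσ using hc'
  have key : ∀ v w, σ v + σ w = σ (v + w) ∧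
      c v + c w + -(h * detv (σ v) (σ w)) = -(h * detv v w) + c (v + w) := by
    intro v w
    have e1 : U * weyl h v * Uᴴ * (U * weyl h w * Uᴴ) = U * (weyl h v * weyl h w) * Uᴴ := by
      have := unitary_conj_mul hu
      calc _ = U * weyl h v * (Uᴴ * U) * weyl h w * Uᴴ := by simp only [Matrix.mul_assoc]
        _ = _ := by rw [this, Matrix.mul_one]; simp only [Matrix.mul_assoc]
    rw [hσ, hσ, weyl_mul hh, Matrix.smul_mul, Matrix.mul_smul, weyl_mul hh, Matrix.mul_smul,
      Matrix.smul_mul, hσ, smul_smul, smul_smul, smul_smul, ← AddChar.map_add_eq_mul,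
      ← AddChar.map_add_eq_mul, ← AddChar.map_add_eq_mul] at e1
    have := weyl_smul_inj e1
    exact ⟨this.1, by linear_combination this.2⟩
  have hdet : ∀ v w, detv (σ v) (σ w) = detv v w := by
    intro v w
    have e1 := (key v w).2
    have e2 := (key w v).2
    have a1 : detv w v = -detv v w := by simp only [detv]; ring
    have a2 : detv (σ w) (σ v) = -detv (σ v) (σ w) := by simp only [detv]; ring
    rw [a1, a2, add_comm w v] at e2
    linear_combination (detv v w - detv (σ v) (σ w)) * hh - e1 + e2
  have hadd : ∀ v w, c (v + w) = c v + c w := by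
    intro v w
    have e1 := (key v w).2
    rw [hdet] at e1
    linear_combination -e1
  have h1 := dotv_of_additive (f := fun v => (σ v).1) fun u v => by simp [← (key u v).1]
  have h2 := dotv_of_additive (f := fun v => (σ v).2) fun u v => by simp [← (key u v).1]
  refine ⟨((((σ (1, 0)).1, (σ (0, 1)).1), ((σ (1, 0)).2, (σ (0, 1)).2)), (c (1, 0), c (0, 1))),
    ?_, hu, fun v => ?_⟩
  · have := hdet (1, 0) (0, 1)
    simp only [detv] at this ⊢
    linear_combination this
  · rw [hσ, dotv_of_additive hadd v]
    congr 2
    exact Prod.ext (h1 v) (h2 v)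

lemma Realizes.mem_cliffordGates {h : ZMod d} {U : QuditOp d} {r : Label d}
    (hU : Realizes h U r) : U ∈ cliffordGates d := by
  refine ⟨hU.1, fun a b => ?_⟩
  refine ⟨-(h * (a * b)) + (dotv r.2 (a, b) + h * ((mulS r.1 (a, b)).1 * (mulS r.1 (a, b)).2)),
    (mulS r.1 (a, b)).1, (mulS r.1 (a, b)).2, ?_⟩
  rw [pauli_eq_weyl h, Matrix.mul_smul, Matrix.smul_mul, hU.2, omega_pow_val, weyl, smul_smul,
    smul_smul, AddChar.map_add_eq_mul, AddChar.map_add_eq_mul, mul_assoc]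

/-- Composition of linear maps. -/
def compS (S S' : Lin d) : Lin d :=
  ((S.1.1 * S'.1.1 + S.1.2 * S'.2.1, S.1.1 * S'.1.2 + S.1.2 * S'.2.2),
    (S.2.1 * S'.1.1 + S.2.2 * S'.2.1, S.2.1 * S'.1.2 + S.2.2 * S'.2.2))

lemma mulS_compS (S S' : Lin d) (u : Vec d) : mulS (compS S S') u = mulS S (mulS S' u) := by
  ext <;> simp only [mulS, dotv, compS] <;> ring

/-- The pull-back of a linear phase by a linear map. -/
def pullv (S : Lin d) (l : Vec d) : Vec d :=
  (l.1 * S.1.1 + l.2 * S.2.1, l.1 * S.1.2 + l.2 * S.2.2)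

lemma dotv_pullv (S : Lin d) (l u : Vec d) : dotv (pullv S l) u = dotv l (mulS S u) := by
  simp only [dotv, pullv, mulS]; ring

lemma add_dotv (l l' u : Vec d) : dotv (l + l') u = dotv l u + dotv l' u := by
  simp only [dotv, Prod.fst_add, Prod.snd_add]; ring

lemma neg_dotv (l u : Vec d) : dotv (-l) u = -dotv l u := by
  simp only [dotv, Prod.fst_neg, Prod.snd_neg]; ring

lemma Realizes.mul {h : ZMod d} {U U' : QuditOp d} {r r' : Label d}
    (hU : Realizes h U r) (hU' : Realizes h U' r') :
    Realizes h (U * U') (compS r.1 r'.1, r'.2 + pullv r'.1 r.2) := by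
  refine ⟨mul_mem hU.1 hU'.1, fun v => ?_⟩
  rw [Matrix.conjTranspose_mul]
  calc _ = U * (U' * weyl h v * U'ᴴ) * Uᴴ := by simp only [Matrix.mul_assoc]
    _ = _ := by
      rw [hU'.2, Matrix.mul_smul, Matrix.smul_mul, hU.2, smul_smul, ← AddChar.map_add_eq_mul,
        add_dotv, dotv_pullv, mulS_compS]

lemma Realizes.conjTranspose {h : ZMod d} {U : QuditOp d} {r : Label d}
    (hU : Realizes h U r) (hr : detv r.1.1 r.1.2 = 1) :
    Realizes h Uᴴ (invS r.1, -pullv (invS r.1) r.2) := by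
  refine ⟨Unitary.star_mem hU.1, fun v => ?_⟩
  have e := hU.2 (mulS (invS r.1) v)
  rw [mulS_invS hr] at e
  rw [neg_dotv, dotv_pullv, Matrix.conjTranspose_conjTranspose]
  have h1 := unitary_conj_mul hU.1
  calc Uᴴ * weyl h v * U
      = Uᴴ * (chi (-dotv r.2 (mulS (invS r.1) v)) •
          (chi (dotv r.2 (mulS (invS r.1) v)) • weyl h v)) * U := by
        rw [smul_smul, ← AddChar.map_add_eq_mul, neg_add_cancel, AddChar.map_zero_eq_one, one_smul]
    _ = chi (-dotv r.2 (mulS (invS r.1) v)) •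
          ((Uᴴ * U) * weyl h (mulS (invS r.1) v) * (Uᴴ * U)) := by
        rw [← e, Matrix.mul_smul, Matrix.smul_mul]
        simp only [Matrix.mul_assoc]
    _ = _ := by rw [h1, Matrix.mul_one, Matrix.one_mul]

lemma weyl_map_star {h : ZMod d} (hh : 2 * h = 1) (u : Vec d) :
    (weyl h u).map star = weyl h (flipv u) := by
  have : (weyl h u).map star = ((weyl h u)ᴴ)ᵀ := rfl
  rw [this, weyl_conjTranspose hh, weyl_transpose hh]
  congr 1
  ext <;> simp [flipv]

lemma conj_map_star (U V : QuditOp d) : (U * V).map star = U.map star * V.map star := by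
  ext i j
  simp [Matrix.mul_apply, map_sum]

lemma flipv_flipv (u : Vec d) : flipv (flipv u) = u := by
  ext <;> simp [flipv]

/-- Conjugation of a linear map by the reflection. -/
def flipS (S : Lin d) : Lin d := ((S.1.1, -S.1.2), (-S.2.1, S.2.2))

lemma mulS_flipS (S : Lin d) (u : Vec d) : mulS (flipS S) u = flipv (mulS S (flipv u)) := by
  ext <;> simp only [mulS, flipS, dotv, flipv] <;> ring

lemma Realizes.map_star {h : ZMod d} (hh : 2 * h = 1) {U : QuditOp d} {r : Label d}
    (hU : Realizes h U r) : Realizes h (U.map star) (flipS r.1, -flipv r.2) := by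
  have hs : (U.map star)ᴴ = (Uᴴ).map star := rfl
  refine ⟨?_, fun v => ?_⟩
  · rw [Matrix.mem_unitaryGroup_iff, Matrix.star_eq_conjTranspose, hs, ← conj_map_star,
      unitary_mul_conj hU.1]
    ext i j
    by_cases hij : i = j <;> simp [hij, Matrix.one_apply]
  · have e := congrArg (fun A : QuditOp d => A.map star) (hU.2 (flipv v))
    simp only [conj_map_star, weyl_map_star hh, flipv_flipv] at e
    rw [hs, e]
    have : (chi (dotv r.2 (flipv v)) • weyl h (mulS r.1 (flipv v))).map star =
        star (chi (dotv r.2 (flipv v))) • (weyl h (mulS r.1 (flipv v))).map star := by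
      ext i j; simp
    rw [this, weyl_map_star hh, star_chi, mulS_flipS]
    congr 2
    simp only [dotv, flipv, Prod.neg_mk]
    ring

lemma mul_mem_cliffordGates {h : ZMod d} (hh : 2 * h = 1) {U U' : QuditOp d}
    (hU : U ∈ cliffordGates d) (hU' : U' ∈ cliffordGates d) : U * U' ∈ cliffordGates d := by
  obtain ⟨r, -, hr⟩ := exists_realizes_of_mem hh hU
  obtain ⟨r', -, hr'⟩ := exists_realizes_of_mem hh hU'
  exact (hr.mul hr').mem_cliffordGates

lemma conjTranspose_mem_cliffordGates {h : ZMod d} (hh : 2 * h = 1) {U : QuditOp d}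
    (hU : U ∈ cliffordGates d) : Uᴴ ∈ cliffordGates d := by
  obtain ⟨r, h1, hr⟩ := exists_realizes_of_mem hh hU
  exact (hr.conjTranspose h1).mem_cliffordGates

lemma map_star_mem_cliffordGates {h : ZMod d} (hh : 2 * h = 1) {U : QuditOp d}
    (hU : U ∈ cliffordGates d) : U.map star ∈ cliffordGates d := by
  obtain ⟨r, -, hr⟩ := exists_realizes_of_mem hh hU
  exact (hr.map_star hh).mem_cliffordGates

lemma realizes_weyl {h : ZMod d} (hh : 2 * h = 1) (w : Vec d) :
    Realizes h (weyl h w) (((1, 0), (0, 1)), (w.2, -w.1)) := by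
  have hw : (weyl h w)ᴴ = weyl h (-w) := weyl_conjTranspose hh w
  have d0 : detv w (-w) = 0 := by simp only [detv, Prod.fst_neg, Prod.snd_neg]; ring
  refine ⟨?_, fun v => ?_⟩
  · rw [Matrix.mem_unitaryGroup_iff, Matrix.star_eq_conjTranspose, hw, weyl_mul hh, d0]
    simp
  · rw [hw, weyl_mul hh, Matrix.smul_mul, weyl_mul hh, smul_smul, ← AddChar.map_add_eq_mul]
    congr 2
    · simp only [detv, dotv, Prod.fst_neg, Prod.snd_neg, Prod.fst_add, Prod.snd_add]
      linear_combination (-w.1 * v.2 + w.2 * v.1) * hh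
    · ext <;> simp [mulS, dotv]

/-- The metaplectic gate of a linear map whose upper right entry is invertible. -/
noncomputable def metaplectic (h β : ZMod d) (S : Lin d) : QuditOp d :=
  Matrix.of fun i j => (1 / (Real.sqrt d : ℂ)) *
    chi (h * (β * (S.2.2 * (i * i) - 2 * (i * j) + S.1.1 * (j * j))))

lemma sqrt_mul_sqrt_self : (Real.sqrt d : ℂ) * (Real.sqrt d : ℂ) = d := by
  rw [← Complex.ofReal_mul, Real.mul_self_sqrt (Nat.cast_nonneg d), Complex.ofReal_natCast]

lemma natCast_ne_zero_complex : (d : ℂ) ≠ 0 := Nat.cast_ne_zero.2 (NeZero.ne d)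

lemma realizes_metaplectic {h β : ZMod d} (hh : 2 * h = 1) {S : Lin d} (hS : detv S.1 S.2 = 1)
    (hβ : S.1.2 * β = 1) : Realizes h (metaplectic h β S) (S, 0) := by
  have hd := natCast_ne_zero_complex (d := d)
  have hu : metaplectic h β S ∈ Matrix.unitaryGroup (ZMod d) ℂ := by
    rw [Matrix.mem_unitaryGroup_iff, Matrix.star_eq_conjTranspose]
    ext i i'
    rw [Matrix.mul_apply]
    have e : ∀ j, metaplectic h β S i j * (metaplectic h β S)ᴴ j i' =
        (1 / (d : ℂ)) * chi (h * (β * S.2.2 * (i * i - i' * i'))) * chi (j * (-(β * (i - i')))) := by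
      intro j
      simp only [metaplectic, Matrix.of_apply, Matrix.conjTranspose_apply, star_mul', star_chi]
      have : star (1 / (Real.sqrt d : ℂ)) = 1 / (Real.sqrt d : ℂ) := by simp
      rw [this, mul_mul_mul_comm, ← AddChar.map_add_eq_mul chi, mul_assoc (1 / (d : ℂ)),
        ← AddChar.map_add_eq_mul chi]
      congr 1
      · rw [← sqrt_mul_sqrt_self]
        field_simp
      · congr 1
        linear_combination (-β * j * (i - i')) * hh
    simp only [e, ← Finset.mul_sum, sum_chi_mul, neg_eq_zero]
    by_cases hi : i = i'
    · subst hi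
      simp [hd]
    · have : β * (i - i') ≠ 0 := by
        intro h0
        apply hi
        linear_combination S.1.2 * h0 - (i - i') * hβ
      rw [if_neg this, mul_zero, Matrix.one_apply_ne hi]
  refine ⟨hu, fun v => ?_⟩
  have key : metaplectic h β S * weyl h v = weyl h (mulS S v) * metaplectic h β S := by
    ext i j
    rw [Matrix.mul_apply, Matrix.mul_apply, Finset.sum_eq_single (j + v.1),
      Finset.sum_eq_single (i - (mulS S v).1)]
    · simp only [metaplectic, Matrix.of_apply, weyl_apply, if_true, sub_add_cancel, mulS, dotv]
      rw [mul_assoc, mul_left_comm (chi _), ← AddChar.map_add_eq_mul chi, ← AddChar.map_add_eq_mul chi]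
      congr 2
      simp only [detv] at hS
      have k1 : β * S.2.2 * (S.1.1 * v.1 + S.1.2 * v.2) - (S.2.1 * v.1 + S.2.2 * v.2) -
          β * v.1 = 0 := by
        linear_combination β * v.1 * hS + (S.2.1 * v.1 + S.2.2 * v.2) * hβ
      have k2 : β * (S.1.1 * v.1 + S.1.2 * v.2) - β * S.1.1 * v.1 - v.2 = 0 := by
        linear_combination v.2 * hβ
      generalize S.1.1 * v.1 + S.1.2 * v.2 = P at *
      generalize S.2.1 * v.1 + S.2.2 * v.2 = Q at *
      linear_combination (-β * i * v.1 + β * S.1.1 * j * v.1 + β * S.2.2 * i * P - β * P * j -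
        Q * P) * hh + (i - h * P) * k1 + (-j - h * v.1) * k2
    · intro k _ hk
      rw [weyl_apply, if_neg, zero_mul]
      rintro rfl
      exact hk (by ring)
    · simp
    · intro k _ hk
      rw [weyl_apply, if_neg hk, mul_zero]
    · simp
  rw [key, Matrix.mul_assoc, unitary_mul_conj hu, Matrix.mul_one]
  simp [dotv]

lemma exists_realizes {p : ℕ} [NeZero p] [Fact p.Prime] {h : ZMod p} (hh : 2 * h = 1)
    (r : Label p) (hr : detv r.1.1 r.1.2 = 1) : ∃ U, Realizes h U r := by
  have h0 : ∃ U, Realizes h U (r.1, 0) := by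
    by_cases hb : r.1.1.2 = 0
    · have ha : r.1.1.1 ≠ 0 := by
        intro ha
        simp [detv, ha, hb] at hr
      have h1 := realizes_metaplectic hh (S := ((0, -r.1.1.1), (r.1.2.2, -r.1.2.1)))
        (β := (-r.1.1.1)⁻¹) (by simp only [detv, hb] at hr ⊢; linear_combination hr)
        (mul_inv_cancel₀ (neg_ne_zero.2 ha))
      have h2 := realizes_metaplectic hh (S := ((0, 1), (-1, 0))) (β := 1)
        (by simp [detv]) (by simp)
      have e : (compS ((0, -r.1.1.1), (r.1.2.2, -r.1.2.1)) ((0, 1), (-1, 0)),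
          (0 : Vec p) + pullv ((0, 1), (-1, 0)) 0) = (r.1, 0) := by
        ext <;> simp [compS, pullv, hb]
      exact ⟨_, e ▸ h1.mul h2⟩
    · exact ⟨_, realizes_metaplectic hh hr (mul_inv_cancel₀ hb)⟩
  obtain ⟨U, hU⟩ := h0
  have e : (compS r.1 ((1, 0), (0, 1)),
      ((r.2.1, - -r.2.2) : Vec p) + pullv ((1, 0), (0, 1)) 0) = r := by
    ext <;> simp [compS, pullv]
  exact ⟨_, e ▸ hU.mul (realizes_weyl hh (-r.2.2, r.2.1))⟩

end Gates

section Vertices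

variable {d : ℕ} [NeZero d]

lemma choiKet_apply (U : QuditOp d) (i j : ZMod d) :
    choiKet d U (i, j) = U j i * (1 / (Real.sqrt d : ℂ)) := by
  simp only [choiKet, Matrix.mulVec, dotProduct, Matrix.kroneckerMap_apply]
  rw [Finset.sum_eq_single (i, i)]
  · simp
  · rintro ⟨k, l⟩ _ hk
    by_cases h1 : i = k
    · subst h1
      have : i ≠ l := fun h => hk (by rw [h])
      simp [this]
    · simp [Matrix.one_apply_ne h1]
  · simp

lemma trace_kronecker_mul_choiState (A B U : QuditOp d) :
    ((A ⊗ₖ B) * choiState d U).trace = (1 / (d : ℂ)) * (U * Aᵀ * Uᴴ * B).trace := by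
  have hs : star (1 / (Real.sqrt d : ℂ)) = 1 / (Real.sqrt d : ℂ) := by simp
  have hd : (1 / (Real.sqrt d : ℂ)) * (1 / (Real.sqrt d : ℂ)) = 1 / d := by
    rw [← sqrt_mul_sqrt_self (d := d)]; field_simp
  have e1 : ((A ⊗ₖ B) * choiState d U).trace = ∑ i, ∑ j, ∑ i', ∑ j',
      (1 / (d : ℂ)) * (U j' i' * A i i' * star (U j i) * B j j') := by
    simp only [Matrix.trace, Matrix.diag_apply, Matrix.mul_apply, Fintype.sum_prod_type,
      Matrix.kroneckerMap_apply, choiState, Matrix.vecMulVec_apply, choiKet_apply, Pi.star_apply,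
      star_mul', hs]
    refine Finset.sum_congr rfl fun i _ => Finset.sum_congr rfl fun j _ =>
      Finset.sum_congr rfl fun i' _ => Finset.sum_congr rfl fun j' _ => ?_
    rw [← hd]
    ring
  have e2 : (U * Aᵀ * Uᴴ * B).trace = ∑ j', ∑ j, ∑ i, ∑ i',
      (U j' i' * A i i' * star (U j i) * B j j') := by
    simp only [Matrix.trace, Matrix.diag_apply, Matrix.mul_apply, Matrix.transpose_apply,
      Matrix.conjTranspose_apply, Finset.sum_mul]
  rw [e1, e2]
  simp only [Finset.mul_sum]
  rw [Finset.sum_congr rfl fun i _ => Finset.sum_congr rfl fun j _ => Finset.sum_comm]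
  rw [Finset.sum_congr rfl fun i _ => Finset.sum_comm, Finset.sum_comm]
  refine Finset.sum_congr rfl fun j' _ => ?_
  rw [Finset.sum_comm]

lemma trace_weyl2_mul_choiState {h : ZMod d} (hh : 2 * h = 1) {U : QuditOp d} {r : Label d}
    (hU : Realizes h U r) (u v : Vec d) :
    (weyl2 h u v * choiState d U).trace =
      if v = mulS r.1 (flipv u) then chi (-dotv r.2 (flipv u)) else 0 := by
  have hd := natCast_ne_zero_complex (d := d)
  rw [weyl2, trace_kronecker_mul_choiState, weyl_transpose hh, hU.2, Matrix.smul_mul, weyl_mul hh,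
    smul_smul, Matrix.trace_smul, weyl_trace, dotv_neg, mulS_neg]
  simp only [neg_add_eq_zero, eq_comm (b := v)]
  split_ifs with hv
  · rw [hv]
    have : detv (-mulS r.1 (flipv u)) (mulS r.1 (flipv u)) = 0 := by
      simp only [detv, Prod.fst_neg, Prod.snd_neg]; ring
    rw [this]
    simp
    field_simp
  · simp

/-- The Clifford vertex with a given label. -/
noncomputable def vertex (h : ZMod d) (r : Label d) : TwoQuditOp d :=
  open Classical in if hr : ∃ U, Realizes h U r then choiState d hr.choose else 0

lemma choiState_eq_vertex {h : ZMod d} (hh : 2 * h = 1) {U : QuditOp d} {r : Label d}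
    (hU : Realizes h U r) : choiState d U = vertex h r := by
  have hr : ∃ U, Realizes h U r := ⟨U, hU⟩
  rw [vertex, dif_pos hr, ← sub_eq_zero]
  refine eq_zero_of_trace_weyl2 (h := h) fun u v => ?_
  rw [Matrix.mul_sub, Matrix.trace_sub, trace_weyl2_mul_choiState hh hU,
    trace_weyl2_mul_choiState hh hr.choose_spec, sub_self]

end Vertices

section PrimeVertices

variable {d : ℕ} [NeZero d] [Fact d.Prime]

/-- The labels of Clifford gates: those with determinant one. -/
def IsGate (r : Label d) : Prop := detv r.1.1 r.1.2 = 1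

instance (r : Label d) : Decidable (IsGate r) := inferInstanceAs (Decidable (_ = _))

lemma trace_weyl2_mul_vertex {h : ZMod d} (hh : 2 * h = 1) {r : Label d} (hr : IsGate r)
    (u v : Vec d) : (weyl2 h u v * vertex h r).trace =
      if v = mulS r.1 (flipv u) then chi (-dotv r.2 (flipv u)) else 0 := by
  obtain ⟨U, hU⟩ := exists_realizes hh r hr
  rw [← choiState_eq_vertex hh hU, trace_weyl2_mul_choiState hh hU]

lemma cliffordVertices_eq {h : ZMod d} (hh : 2 * h = 1) :
    cliffordVertices d = vertex h '' {r | IsGate r} := by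
  ext τ
  constructor
  · rintro ⟨U, hU, rfl⟩
    obtain ⟨r, h1, hr⟩ := exists_realizes_of_mem hh hU
    exact ⟨r, h1, (choiState_eq_vertex hh hr).symm⟩
  · rintro ⟨r, hr, rfl⟩
    obtain ⟨U, hU⟩ := exists_realizes hh r hr
    exact ⟨U, hU.mem_cliffordGates, choiState_eq_vertex hh hU⟩

lemma vertex_injOn {h : ZMod d} (hh : 2 * h = 1) : Set.InjOn (vertex h) {r | IsGate r} := by
  intro r hr r' hr' e
  have key : ∀ u : Vec d, mulS r.1 u = mulS r'.1 u ∧ dotv r.2 u = dotv r'.2 u := by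
    intro u
    have e1 := trace_weyl2_mul_vertex hh hr (flipv u) (mulS r.1 u)
    have e2 := trace_weyl2_mul_vertex hh hr' (flipv u) (mulS r.1 u)
    rw [e, e2] at e1
    simp only [flipv_flipv, if_true] at e1
    split_ifs at e1 with h1
    · exact ⟨h1, by simpa [chi_inj] using e1.symm⟩
    · exact absurd e1.symm (chi_ne_zero _)
  have k1 := key (1, 0)
  have k2 := key (0, 1)
  simp only [mulS, dotv, mul_one, mul_zero, add_zero, zero_add, Prod.mk.injEq] at k1 k2
  refine Prod.ext (Prod.ext (Prod.ext ?_ ?_) (Prod.ext ?_ ?_)) (Prod.ext ?_ ?_)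
  exacts [k1.1.1, k2.1.1, k1.1.2, k2.1.2, k1.2, k2.2]

/-- Data of a projector `Π`: a pair of phase-space points and the phase of the eigenvalue. -/
abbrev Tup (d : ℕ) := Vec d × Vec d × ZMod d

/-- The projector given by a tuple. -/
noncomputable def projT (h : ZMod d) (t : Tup d) : TwoQuditOp d :=
  (1 / d : ℂ) • ∑ m : ZMod d, chi (-(m * t.2.2)) • weyl2 h (smulv m t.1) (smulv m t.2.1)

/-- Passage from a tuple `(x₁, x₂, z₁, z₂, k)` to phase-space points. -/
def conv (h : ZMod d) (t : ZMod d × ZMod d × ZMod d × ZMod d × ZMod d) : Tup d :=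
  ((t.1, t.2.2.1), (t.2.1, t.2.2.2.1), t.2.2.2.2 + h * (t.1 * t.2.2.1 + t.2.1 * t.2.2.2.1))

lemma sum_range_eq_sum_zmod {M : Type*} [AddCommMonoid M] (f : ZMod d → M) :
    ∑ m ∈ Finset.range d, f (m : ZMod d) = ∑ x : ZMod d, f x := by
  refine Finset.sum_bij (fun m _ => (m : ZMod d)) (fun _ _ => Finset.mem_univ _) ?_ ?_
    (fun _ _ => rfl)
  · intro a ha b hb e
    rw [Finset.mem_range] at ha hb
    rw [← ZMod.val_natCast_of_lt ha, ← ZMod.val_natCast_of_lt hb, e]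
  · intro x _
    exact ⟨x.val, Finset.mem_range.2 (ZMod.val_lt x), ZMod.natCast_zmod_val x⟩

lemma proj2_eq_projT {h : ZMod d} (hh : 2 * h = 1)
    (t : ZMod d × ZMod d × ZMod d × ZMod d × ZMod d) :
    proj2 d t.1 t.2.1 t.2.2.1 t.2.2.2.1 t.2.2.2.2 = projT h (conv h t) := by
  rw [proj2, projT, ← sum_range_eq_sum_zmod]
  congr 1
  refine Finset.sum_congr rfl fun m _ => ?_
  rw [pauli2_eq_weyl2 h, smul_pow, weyl2_pow hh, smul_smul, inv_pow, omega_pow_eq_chi,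
    ← AddChar.map_neg_eq_inv, ← AddChar.map_nsmul_eq_pow, ← AddChar.map_add_eq_mul]
  congr 2
  simp only [conv, nsmul_eq_mul, Nat.cast_mul, ZMod.natCast_zmod_val]
  ring

/-- The sum of the projectors given by a list of tuples. -/
noncomputable def opT (h : ZMod d) (ts : List (Tup d)) : TwoQuditOp d := (ts.map (projT h)).sum

lemma projSum_eq_opT {h : ZMod d} (hh : 2 * h = 1)
    (l : List (ZMod d × ZMod d × ZMod d × ZMod d × ZMod d)) :
    projSum d l = opT h (l.map (conv h)) := by
  rw [projSum, opT, List.map_map]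
  congr 2
  funext t
  exact proj2_eq_projT hh t

/-- `d` times the expectation value of a projector in a Clifford vertex. -/
def contribution (r : Label d) (t : Tup d) : ℕ :=
  if t.2.1 = mulS r.1 (flipv t.1) then (if t.2.2 + dotv r.2 (flipv t.1) = 0 then d else 0) else 1

/-- `d` times the expectation value of a sum of projectors in a Clifford vertex. -/
def value (r : Label d) (ts : List (Tup d)) : ℕ := (ts.map (contribution r)).sum

lemma flipv_smulv (m : ZMod d) (u : Vec d) : flipv (smulv m u) = smulv m (flipv u) := by
  ext <;> simp [flipv, smulv]

lemma smulv_inj {m : ZMod d} (hm : m ≠ 0) {u v : Vec d} : smulv m u = smulv m v ↔ u = v := by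
  simp [smulv, Prod.ext_iff, hm]

lemma trace_projT_mul_vertex {h : ZMod d} (hh : 2 * h = 1) {r : Label d} (hr : IsGate r)
    (t : Tup d) : (projT h t * vertex h r).trace = contribution r t / d := by
  have hd := natCast_ne_zero_complex (d := d)
  rw [projT, Matrix.smul_mul, Matrix.trace_smul, Finset.sum_mul, Matrix.trace_sum]
  simp only [Matrix.smul_mul, Matrix.trace_smul, trace_weyl2_mul_vertex hh hr, flipv_smulv,
    mulS_smulv, dotv_smulv, smul_eq_mul, contribution]
  split_ifs with h1 h2
  · have e : ∀ m : ZMod d, chi (-(m * t.2.2)) * (if smulv m t.2.1 = smulv m (mulS r.1 (flipv t.1))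
        then chi (-(m * dotv r.2 (flipv t.1))) else 0) = 1 := by
      intro m
      rw [if_pos (by rw [h1]), ← AddChar.map_add_eq_mul, ← AddChar.map_zero_eq_one (chi (d := d))]
      congr 1
      linear_combination -m * h2
    simp [e]
  · have e : ∀ m : ZMod d, chi (-(m * t.2.2)) * (if smulv m t.2.1 = smulv m (mulS r.1 (flipv t.1))
        then chi (-(m * dotv r.2 (flipv t.1))) else 0) =
          chi (m * -(t.2.2 + dotv r.2 (flipv t.1))) := by
      intro m
      rw [if_pos (by rw [h1]), ← AddChar.map_add_eq_mul]
      congr 1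
      ring
    simp only [e, sum_chi_mul, neg_eq_zero, if_neg h2]
    simp
  · rw [Finset.sum_eq_single 0]
    · simp [smulv]
    · intro m _ hm
      rw [if_neg (by rwa [smulv_inj hm]), mul_zero]
    · simp

lemma trace_opT_mul_vertex {h : ZMod d} (hh : 2 * h = 1) {r : Label d} (hr : IsGate r)
    (ts : List (Tup d)) : (opT h ts * vertex h r).trace = value r ts / d := by
  induction ts with
  | nil => simp [opT, value]
  | cons t ts ih =>
    simp only [opT, value, List.map_cons, List.sum_cons, Matrix.add_mul, Matrix.trace_add,
      Nat.cast_add, add_div] at ih ⊢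
    rw [ih, trace_projT_mul_vertex hh hr]

lemma trace_vertex {h : ZMod d} (hh : 2 * h = 1) {r : Label d} (hr : IsGate r) :
    (vertex h r).trace = 1 := by
  have := trace_weyl2_mul_vertex hh hr 0 0
  simpa [flipv, dotv, mulS, Prod.ext_iff] using this

lemma projT_isHermitian {h : ZMod d} (hh : 2 * h = 1) (t : Tup d) : (projT h t).IsHermitian := by
  rw [Matrix.IsHermitian, projT, Matrix.conjTranspose_smul, Matrix.conjTranspose_sum]
  congr 1
  · simp
  · refine Fintype.sum_equiv (Equiv.neg _) _ _ fun m => ?_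
    rw [Matrix.conjTranspose_smul, star_chi, weyl2_conjTranspose hh, Equiv.neg_apply]
    congr 2
    · ring
    · ext <;> simp [smulv]
    · ext <;> simp [smulv]

lemma opT_isHermitian {h : ZMod d} (hh : 2 * h = 1) (ts : List (Tup d)) :
    (opT h ts).IsHermitian := by
  induction ts with
  | nil => simp [opT]
  | cons t ts ih =>
    simp only [opT, List.map_cons, List.sum_cons] at ih ⊢
    exact (projT_isHermitian hh t).add ih

end PrimeVertices

section Contact

variable {d : ℕ} [NeZero d] [Fact d.Prime]

/-- On the Clifford vertices, `W - g` is a positive multiple of `value · ts - n`. -/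
def Represents (h : ZMod d) (W : TwoQuditOp d) (g : ℝ) (ts : List (Tup d)) (n : ℕ) : Prop :=
  W.IsHermitian ∧ ∃ s : ℝ, 0 < s ∧
    ∀ r, IsGate r → (W * vertex h r).trace.re = g + s * ((value r ts : ℝ) - n)

/-- The labels of the vertices on the hyperplane given by `ts` and `n`. -/
def contactLabels (ts : List (Tup d)) (n : ℕ) : Set (Label d) := {r | IsGate r ∧ value r ts = n}

lemma Represents.contactVertices_eq {h : ZMod d} (hh : 2 * h = 1) {W : TwoQuditOp d} {g : ℝ}
    {ts : List (Tup d)} {n : ℕ} (hW : Represents h W g ts n) :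
    contactVertices d W g = vertex h '' contactLabels ts n := by
  obtain ⟨-, s, hs, hW⟩ := hW
  have key : ∀ r, IsGate r → ((W * vertex h r).trace.re = g ↔ value r ts = n) := by
    intro r hr
    rw [hW r hr, add_eq_left, mul_eq_zero, sub_eq_zero, Nat.cast_inj]
    simp [hs.ne']
  ext τ
  rw [contactVertices, cliffordVertices_eq hh]
  constructor
  · rintro ⟨⟨r, hr, rfl⟩, e⟩
    exact ⟨r, ⟨hr, (key r hr).1 e⟩, rfl⟩
  · rintro ⟨r, ⟨hr, e⟩, rfl⟩
    exact ⟨⟨r, hr, rfl⟩, (key r hr).2 e⟩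

lemma Represents.ncard_contactVertices {h : ZMod d} (hh : 2 * h = 1) {W : TwoQuditOp d} {g : ℝ}
    {ts : List (Tup d)} {n : ℕ} (hW : Represents h W g ts n) :
    (contactVertices d W g).ncard = (contactLabels ts n).ncard := by
  rw [hW.contactVertices_eq hh]
  exact Set.InjOn.ncard_image ((vertex_injOn hh).mono fun r hr => hr.1)

lemma Represents.isSupporting {h : ZMod d} (hh : 2 * h = 1) {W : TwoQuditOp d} {g : ℝ}
    {ts : List (Tup d)} {n : ℕ} (hW : Represents h W g ts n)
    (hle : ∀ r : Label d, IsGate r → n ≤ value r ts)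
    (hne : ∃ r : Label d, IsGate r ∧ value r ts ≠ n) : IsSupporting d W g := by
  obtain ⟨h1, s, hs, hW⟩ := hW
  refine ⟨h1, ?_, ?_⟩
  · rw [cliffordVertices_eq hh]
    rintro _ ⟨r, hr, rfl⟩
    rw [hW r hr]
    have : (n : ℝ) ≤ value r ts := by exact_mod_cast hle r hr
    have := mul_nonneg hs.le (sub_nonneg.2 this)
    linarith
  · obtain ⟨r, hr, hrn⟩ := hne
    refine ⟨vertex h r, ?_, ?_⟩
    · rw [cliffordVertices_eq hh]; exact ⟨r, hr, rfl⟩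
    · rw [hW r hr, Ne, add_eq_left, mul_eq_zero, sub_eq_zero, Nat.cast_inj]
      simp [hs.ne', hrn]

end Contact

section Rank

variable {d : ℕ} [NeZero d] [Fact d.Prime]

/-- The phase-space points of a weight-two label. -/
def WeightTwo.node (w : WeightTwo d) : Vec d × Vec d :=
  ((w.1.1, w.1.2.2.1), (w.1.2.1, w.1.2.2.2))

lemma WeightTwo.node_injective : Function.Injective (WeightTwo.node (d := d)) := by
  rintro ⟨⟨a, b, c, e⟩, h1⟩ ⟨⟨a', b', c', e'⟩, h2⟩ hn
  simp only [WeightTwo.node, Prod.mk.injEq] at hn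
  obtain ⟨⟨rfl, rfl⟩, rfl, rfl⟩ := hn
  rfl

lemma WeightTwo.exists_node {n : Vec d × Vec d} (h1 : n.1 ≠ 0) (h2 : n.2 ≠ 0) :
    ∃ w : WeightTwo d, w.node = n :=
  ⟨⟨(n.1.1, n.2.1, n.1.2, n.2.2), fun h => h1 (Prod.ext h.1 h.2), fun h => h2 (Prod.ext h.1 h.2)⟩,
    rfl⟩

lemma WeightTwo.node_ne_zero (w : WeightTwo d) : w.node.1 ≠ 0 ∧ w.node.2 ≠ 0 :=
  ⟨fun h => w.2.1 (Prod.ext_iff.1 h), fun h => w.2.2 (Prod.ext_iff.1 h)⟩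

/-- The phase between a Pauli operator and a Weyl operator. -/
noncomputable def nodePhase (h : ZMod d) (n : Vec d × Vec d) : ZMod d :=
  h * (n.1.1 * n.1.2 + n.2.1 * n.2.2)

lemma coeffVec_eq {h : ZMod d} (hh : 2 * h = 1) (τ : TwoQuditOp d) (w : WeightTwo d) :
    coeffVec d τ w = chi (nodePhase h w.node) * (weyl2 h (-w.node.1) (-w.node.2) * τ).trace := by
  rw [coeffVec, pauli2_eq_weyl2 h, Matrix.conjTranspose_smul, star_chi, weyl2_conjTranspose hh,
    Matrix.smul_mul, Matrix.trace_smul, smul_eq_mul, neg_neg]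
  rfl

lemma flipv_neg (u : Vec d) : flipv (-u) = -flipv u := by
  ext <;> simp [flipv]

lemma coeffVec_vertex {h : ZMod d} (hh : 2 * h = 1) {r : Label d} (hr : IsGate r)
    (w : WeightTwo d) : coeffVec d (vertex h r) w = chi (nodePhase h w.node) *
      if w.node.2 = mulS r.1 (flipv w.node.1) then chi (dotv r.2 (flipv w.node.1)) else 0 := by
  rw [coeffVec_eq hh, trace_weyl2_mul_vertex hh hr, flipv_neg, mulS_neg, dotv_neg, neg_neg]
  simp only [neg_inj]

/-- The linear functional on coefficient vectors with given coefficients. -/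
noncomputable def functional (h : ZMod d) (C : Vec d × Vec d → ℂ) :
    Module.Dual ℂ (WeightTwo d → ℂ) :=
  ∑ w : WeightTwo d, (C w.node * chi (-nodePhase h w.node)) • LinearMap.proj w

lemma functional_single (h : ZMod d) (C : Vec d × Vec d → ℂ) (w : WeightTwo d) :
    functional h C (Pi.single w 1) = C w.node * chi (-nodePhase h w.node) := by
  classical
  simp [functional, LinearMap.sum_apply, Pi.single_apply]

lemma functional_vertex {h : ZMod d} (hh : 2 * h = 1) {C : Vec d × Vec d → ℂ}
    (hC : ∀ v, C (0, v) = 0) {r : Label d} (hr : IsGate r) :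
    functional h C (coeffVec d (vertex h r)) =
      ∑ u, C (u, mulS r.1 (flipv u)) * chi (dotv r.2 (flipv u)) := by
  have e1 : ∀ w : WeightTwo d, C w.node * chi (-nodePhase h w.node) * coeffVec d (vertex h r) w =
      C w.node * if w.node.2 = mulS r.1 (flipv w.node.1) then chi (dotv r.2 (flipv w.node.1))
        else 0 := by
    intro w
    rw [coeffVec_vertex hh hr, mul_assoc, ← mul_assoc (chi (-_)), ← AddChar.map_add_eq_mul,
      neg_add_cancel, AddChar.map_zero_eq_one, one_mul]
  simp only [functional, LinearMap.sum_apply, LinearMap.smul_apply, LinearMap.proj_apply,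
    smul_eq_mul, e1]
  rw [Fintype.sum_of_injective WeightTwo.node WeightTwo.node_injective _
    (fun n : Vec d × Vec d => C n * if n.2 = mulS r.1 (flipv n.1) then chi (dotv r.2 (flipv n.1))
        else 0) _ fun w => rfl, Fintype.sum_prod_type]
  · refine Finset.sum_congr rfl fun u _ => ?_
    simp
  · intro n hn
    by_cases h1 : n.1 = 0
    · rw [show n = (0, n.2) by rw [← h1], hC, zero_mul]
    · by_cases h2 : n.2 = 0
      · rw [if_neg, mul_zero]
        rw [h2]
        intro h0
        rw [eq_comm, mulS_eq_zero_iff hr] at h0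
        apply h1
        rw [← flipv_flipv n.1, h0]
        simp [flipv]
      · exact absurd (WeightTwo.exists_node h1 h2) hn

/-- The coefficients of a linear functional. -/
noncomputable def coeffs (h : ZMod d) (φ : Module.Dual ℂ (WeightTwo d → ℂ)) (n : Vec d × Vec d) :
    ℂ :=
  open Classical in if hn : ∃ w : WeightTwo d, w.node = n then
    φ (Pi.single hn.choose 1) * chi (nodePhase h n) else 0

lemma coeffs_node (h : ZMod d) (φ : Module.Dual ℂ (WeightTwo d → ℂ)) (w : WeightTwo d) :
    coeffs h φ w.node = φ (Pi.single w 1) * chi (nodePhase h w.node) := by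
  have hn : ∃ w' : WeightTwo d, w'.node = w.node := ⟨w, rfl⟩
  rw [coeffs, dif_pos hn, WeightTwo.node_injective hn.choose_spec]

lemma coeffs_zero_left (h : ZMod d) (φ : Module.Dual ℂ (WeightTwo d → ℂ)) (v : Vec d) :
    coeffs h φ (0, v) = 0 := by
  rw [coeffs, dif_neg]
  rintro ⟨w, hw⟩
  exact w.node_ne_zero.1 (by rw [hw])

lemma functional_coeffs (h : ZMod d) (φ : Module.Dual ℂ (WeightTwo d → ℂ)) :
    functional h (coeffs h φ) = φ := by
  refine LinearMap.pi_ext' fun w => LinearMap.ext_ring ?_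
  simp only [LinearMap.comp_apply, LinearMap.single_apply]
  rw [functional_single, coeffs_node, mul_assoc, ← AddChar.map_add_eq_mul, add_neg_cancel,
    AddChar.map_zero_eq_one, mul_one]

lemma eq_zero_of_coeffs {h : ZMod d} {φ : Module.Dual ℂ (WeightTwo d → ℂ)}
    (hφ : ∀ n : Vec d × Vec d, n.1 ≠ 0 → n.2 ≠ 0 → coeffs h φ n = 0) : φ = 0 := by
  rw [← functional_coeffs h φ, functional]
  refine Finset.sum_eq_zero fun w _ => ?_
  rw [hφ _ w.node_ne_zero.1 w.node_ne_zero.2, zero_mul, zero_smul]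

/-- The functionals that vanish on the vertices with given labels. -/
noncomputable def annihilator (h : ZMod d) (R : Set (Label d)) :
    Submodule ℂ (Module.Dual ℂ (WeightTwo d → ℂ)) :=
  (Submodule.span ℂ (coeffVec d '' (vertex h '' R))).dualAnnihilator

lemma mem_annihilator {h : ZMod d} {R : Set (Label d)} {φ : Module.Dual ℂ (WeightTwo d → ℂ)} :
    φ ∈ annihilator h R ↔ ∀ r ∈ R, φ (coeffVec d (vertex h r)) = 0 := by
  rw [annihilator, Submodule.mem_dualAnnihilator]
  constructor
  · intro hφ r hr
    exact hφ _ (Submodule.subset_span ⟨_, ⟨r, hr, rfl⟩, rfl⟩)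
  · intro hφ x hx
    induction hx using Submodule.span_induction with
    | mem x hx =>
      obtain ⟨_, ⟨r, hr, rfl⟩, rfl⟩ := hx
      exact hφ r hr
    | zero => exact map_zero φ
    | add x y _ _ hx hy => rw [map_add, hx, hy, add_zero]
    | smul a x _ hx => rw [map_smul, hx, smul_zero]

/-- The relations between the coefficients of a functional that vanishes on all contact
vertices. -/
structure Relations (moves : List (Tup d)) (C : Vec d × Vec d → ℂ) : Prop where
  edge : ∀ t ∈ moves, ∀ n : Vec d × Vec d, detv t.1 n.1 + detv t.2.1 n.2 = 0 → detv t.1 n.1 ≠ 0 →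
    C (n.1 - t.1, n.2 - t.2.1) = chi (-t.2.2) * C n
  root : ∀ t ∈ moves, C (t.1, t.2.1) = 0

/-- If one of the projectors that are stabilized up to a phase has expectation value zero, then
the vertex is a contact vertex. -/
def Rigid (ts : List (Tup d)) (n : ℕ) : Prop :=
  ∀ r : Label d, IsGate r → ∀ t ∈ ts, t.2.1 = mulS r.1 (flipv t.1) →
    t.2.2 + dotv r.2 (flipv t.1) ≠ 0 → value r ts = n

lemma dotv_flipv (l u : Vec d) : dotv l (flipv u) = dotv (flipv l) u := by
  simp only [dotv, flipv]; ring

lemma flipv_sub (u v : Vec d) : flipv (u - v) = flipv u - flipv v := by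
  ext <;> simp [flipv]; ring

lemma shift_of_hit {h : ZMod d} (hh : 2 * h = 1) {ts : List (Tup d)} {n : ℕ} (hR : Rigid ts n)
    {φ : Module.Dual ℂ (WeightTwo d → ℂ)} (hφ : φ ∈ annihilator h (contactLabels ts n))
    {S : Lin d} (hS : detv S.1 S.2 = 1) {t : Tup d} (ht : t ∈ ts)
    (hit : t.2.1 = mulS S (flipv t.1)) (u : Vec d) :
    coeffs h φ (u - t.1, mulS S (flipv u) - t.2.1) =
      chi (-t.2.2) * coeffs h φ (u, mulS S (flipv u)) := by
  set F : Vec d → ℂ := fun u => coeffs h φ (u, mulS S (flipv u)) with hF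
  have hsum : ∀ l : Vec d, t.2.2 + dotv l (flipv t.1) ≠ 0 →
      ∑ u, F u * chi (dotv l (flipv u)) = 0 := by
    intro l hl
    have hc := hR (S, l) hS t ht hit hl
    have := mem_annihilator.1 hφ (S, l) ⟨hS, hc⟩
    rwa [← functional_coeffs h φ,
      functional_vertex hh (coeffs_zero_left h φ) (r := (S, l)) hS] at this
  have key := eq_zero_of_fourier (f := fun u => F (u - t.1) - chi (-t.2.2) * F u) (fun l => by
    have e1 : ∑ u, F (u - t.1) * chi (dotv l u) =
        chi (dotv l t.1) * ∑ u, F u * chi (dotv l u) := by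
      rw [Finset.mul_sum, ← Equiv.sum_comp (Equiv.addRight t.1)]
      refine Finset.sum_congr rfl fun u _ => ?_
      rw [Equiv.coe_addRight, add_sub_cancel_right, dotv_add, AddChar.map_add_eq_mul]
      ring
    simp only [sub_mul, Finset.sum_sub_distrib, mul_assoc, ← Finset.mul_sum, e1]
    by_cases hl : t.2.2 + dotv l t.1 = 0
    · rw [eq_neg_of_add_eq_zero_right hl, sub_self]
    · have := hsum (flipv l) (by rwa [dotv_flipv, flipv_flipv])
      simp only [dotv_flipv, flipv_flipv] at this
      rw [this, mul_zero, mul_zero, sub_self])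
  have := congrFun key u
  simp only [Pi.zero_apply, sub_eq_zero, hF, flipv_sub, mulS_sub, ← hit] at this
  exact this

lemma exists_lin {u v n m : Vec d} (h1 : detv u n + detv v m = 0) (h2 : detv u n ≠ 0) :
    ∃ S : Lin d, detv S.1 S.2 = 1 ∧ mulS S (flipv u) = v ∧ mulS S (flipv n) = m := by
  have hi := mul_inv_cancel₀ h2
  set e := (detv u n)⁻¹
  simp only [detv] at h1 hi
  refine ⟨((e * (v.1 * n.2 - m.1 * u.2), e * (v.1 * n.1 - m.1 * u.1)),
    (e * (v.2 * n.2 - m.2 * u.2), e * (v.2 * n.1 - m.2 * u.1))), ?_, ?_, ?_⟩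
  · simp only [detv]
    linear_combination (-(u.1 * n.2 - u.2 * n.1) * e ^ 2) * h1 +
      (1 + (u.1 * n.2 - u.2 * n.1) * e) * hi
  · ext <;> simp only [mulS, dotv, flipv]
    · linear_combination v.1 * hi
    · linear_combination v.2 * hi
  · ext <;> simp only [mulS, dotv, flipv]
    · linear_combination m.1 * hi
    · linear_combination m.2 * hi

lemma exists_detv_eq {u : Vec d} (hu : u ≠ 0) (x : ZMod d) : ∃ n, detv u n = x := by
  by_cases h1 : u.1 = 0
  · have h2 : u.2 ≠ 0 := fun h2 => hu (Prod.ext h1 h2)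
    exact ⟨(-(x * u.2⁻¹), 0), by simp [detv]; field_simp⟩
  · exact ⟨(0, x * u.1⁻¹), by simp [detv]; field_simp⟩

/-- The negative of a tuple, which gives the same projector. -/
def negTup (t : Tup d) : Tup d := (-t.1, -t.2.1, -t.2.2)

/-- Validity of a list of tuples: both phase-space points are nonzero. -/
def NonzeroTups (ts : List (Tup d)) : Prop := ∀ t ∈ ts, t.1 ≠ 0 ∧ t.2.1 ≠ 0

lemma relations_of_rigid {h : ZMod d} (hh : 2 * h = 1) {ts : List (Tup d)} {n : ℕ}
    (hR : Rigid ts n) (h0 : NonzeroTups ts)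
    {φ : Module.Dual ℂ (WeightTwo d → ℂ)} (hφ : φ ∈ annihilator h (contactLabels ts n)) :
    Relations (ts ++ ts.map negTup) (coeffs h φ) := by
  have hz : coeffs h φ (0, 0) = 0 := coeffs_zero_left h φ 0
  constructor
  · intro t ht m h1 h2
    rw [List.mem_append, List.mem_map] at ht
    rcases ht with ht | ⟨t, ht, rfl⟩
    · obtain ⟨S, hS, e1, e2⟩ := exists_lin h1 h2
      have := shift_of_hit hh hR hφ hS ht e1.symm m.1
      rwa [e2] at this
    · simp only [negTup, sub_neg_eq_add, neg_neg]
      obtain ⟨S, hS, e1, e2⟩ := exists_lin (u := t.1) (v := t.2.1) (n := m.1 + t.1)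
        (m := m.2 + t.2.1)
        (by simp only [negTup, detv, Prod.fst_neg, Prod.snd_neg, Prod.fst_add, Prod.snd_add] at h1 ⊢
            linear_combination -h1)
        (by simp only [negTup, detv, Prod.fst_neg, Prod.snd_neg, Prod.fst_add, Prod.snd_add] at h2 ⊢
            intro h3
            apply h2
            linear_combination -h3)
      have := shift_of_hit hh hR hφ hS ht e1.symm (m.1 + t.1)
      rw [e2, add_sub_cancel_right, add_sub_cancel_right] at this
      rw [← Prod.mk.eta (p := m), this, ← mul_assoc, ← AddChar.map_add_eq_mul, add_neg_cancel,
        AddChar.map_zero_eq_one, one_mul]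
  · intro t ht
    rw [List.mem_append, List.mem_map] at ht
    have key : ∀ t ∈ ts, ∃ S : Lin d, detv S.1 S.2 = 1 ∧ mulS S (flipv t.1) = t.2.1 := by
      intro t ht
      obtain ⟨a, ha⟩ := exists_detv_eq (h0 t ht).1 1
      obtain ⟨b, hb⟩ := exists_detv_eq (h0 t ht).2 (-1)
      obtain ⟨S, hS, e1, -⟩ := exists_lin (u := t.1) (v := t.2.1) (n := a) (m := b)
        (by rw [ha, hb]; ring) (by rw [ha]; exact one_ne_zero)
      exact ⟨S, hS, e1⟩
    rcases ht with ht | ⟨t, ht, rfl⟩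
    · obtain ⟨S, hS, e1⟩ := key t ht
      have := shift_of_hit hh hR hφ hS ht e1.symm t.1
      rw [e1, sub_self, sub_self, hz] at this
      exact (mul_eq_zero.1 this.symm).resolve_left (chi_ne_zero _)
    · obtain ⟨S, hS, e1⟩ := key t ht
      have := shift_of_hit hh hR hφ hS ht e1.symm 0
      have hf : flipv (0 : Vec d) = 0 := by simp [flipv]
      rw [hf, mulS_zero, zero_sub, zero_sub, hz, mul_zero] at this
      exact this

lemma card_weightTwo : Fintype.card (WeightTwo d) = (d ^ 2 - 1) ^ 2 := by
  classical
  have e : WeightTwo d ≃ {u : Vec d // u ≠ 0} × {v : Vec d // v ≠ 0} :=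
    { toFun := fun w => (⟨w.node.1, w.node_ne_zero.1⟩, ⟨w.node.2, w.node_ne_zero.2⟩)
      invFun := fun p => ⟨(p.1.1.1, p.2.1.1, p.1.1.2, p.2.1.2),
        fun h => p.1.2 (Prod.ext h.1 h.2), fun h => p.2.2 (Prod.ext h.1 h.2)⟩
      left_inv := fun _ => rfl
      right_inv := fun _ => rfl }
  have h1 : Fintype.card {u : Vec d // u ≠ 0} = d ^ 2 - 1 := by
    rw [Fintype.card_subtype_compl, Fintype.card_prod, ZMod.card, Fintype.card_subtype_eq, sq]
  rw [Fintype.card_congr e, Fintype.card_prod, h1, ← sq]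

lemma Represents.contactRank_add {h : ZMod d} (hh : 2 * h = 1) {W : TwoQuditOp d} {g : ℝ}
    {ts : List (Tup d)} {n : ℕ} (hW : Represents h W g ts n) :
    contactRank d W g + Module.finrank ℂ (annihilator h (contactLabels ts n)) =
      (d ^ 2 - 1) ^ 2 := by
  rw [contactRank, hW.contactVertices_eq hh, annihilator,
    Subspace.finrank_add_finrank_dualAnnihilator_eq, Module.finrank_fintype_fun_eq_card,
    card_weightTwo]

end Rank

section Certificates

variable {d : ℕ} [NeZero d] [Fact d.Prime]

/-- All elements of `ZMod d`. -/
def zmodList (d : ℕ) : List (ZMod d) := List.map (fun n : ℕ => (n : ZMod d)) (List.range d)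

lemma mem_zmodList (x : ZMod d) : x ∈ zmodList d :=
  List.mem_map.2 ⟨x.val, List.mem_range.2 (ZMod.val_lt x), ZMod.natCast_zmod_val x⟩

lemma nodup_zmodList : (zmodList d).Nodup := by
  refine List.Nodup.map_on ?_ List.nodup_range
  intro a ha b hb e
  rw [List.mem_range] at ha hb
  rw [← ZMod.val_natCast_of_lt ha, ← ZMod.val_natCast_of_lt hb, e]

/-- All phase-space points. -/
def vecList (d : ℕ) : List (Vec d) := zmodList d ×ˢ zmodList d

lemma mem_vecList (u : Vec d) : u ∈ vecList d :=
  List.mem_product.2 ⟨mem_zmodList _, mem_zmodList _⟩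

lemma nodup_vecList : (vecList d).Nodup := nodup_zmodList.product nodup_zmodList

/-- All linear maps of determinant one. -/
def linList (d : ℕ) : List (Lin d) :=
  (vecList d ×ˢ vecList d).filter fun S => detv S.1 S.2 = 1

lemma mem_linList (S : Lin d) : S ∈ linList d ↔ detv S.1 S.2 = 1 := by
  obtain ⟨a, b⟩ := S
  simp [linList, List.mem_filter, List.mem_product, mem_vecList]

lemma nodup_linList : (linList d).Nodup := (nodup_vecList.product nodup_vecList).filter _

/-- The stabilizer elements of a linear map that occur in a list of tuples. -/
def hits (S : Lin d) (ts : List (Tup d)) : List (Vec d × ZMod d) :=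
  (ts.filter fun t => t.2.1 = mulS S (flipv t.1)).map fun t => (flipv t.1, t.2.2)

/-- The number of stabilizer elements with matching phases. -/
def matched (l : Vec d) (H : List (Vec d × ZMod d)) : ℕ := H.countP fun t => t.2 + dotv l t.1 = 0

lemma value_add_length_hits (S : Lin d) (l : Vec d) (ts : List (Tup d)) :
    value (S, l) ts + (hits S ts).length = ts.length + d * matched l (hits S ts) := by
  induction ts with
  | nil => simp [value, hits, matched]
  | cons t ts ih =>
    simp only [value, hits, matched, contribution, List.map_cons, List.sum_cons,
      List.filter_cons] at ih ⊢
    by_cases h1 : t.2.1 = mulS S (flipv t.1)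
    · by_cases h2 : t.2.2 + dotv l (flipv t.1) = 0
      · simp only [h1, h2, decide_true, if_true, List.map_cons, List.length_cons,
          List.countP_cons] at ih ⊢
        linarith
      · simp only [h1, h2, decide_true, if_true, List.map_cons, List.length_cons,
          List.countP_cons, if_false, decide_false, Bool.false_eq_true] at ih ⊢
        linarith
    · simp only [h1, if_false, decide_false, Bool.false_eq_true, List.length_cons] at ih ⊢
      linarith

/-- The contact condition in terms of the hits. -/
def touches (N n : ℕ) (l : Vec d) (H : List (Vec d × ZMod d)) : Bool :=
  N + d * matched l H == n + H.length

/-- The check that `n` is a lower bound, and that it is attained unless all hits match. -/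
def rigidCheck (ts : List (Tup d)) (n : ℕ) : Bool :=
  (linList d).all fun S => (vecList d).all fun l =>
    touches ts.length n l (hits S ts) ||
      (matched l (hits S ts) == (hits S ts).length &&
        Nat.ble (n + (hits S ts).length) (ts.length + d * matched l (hits S ts)))

lemma value_eq_iff (S : Lin d) (l : Vec d) (ts : List (Tup d)) (n : ℕ) :
    value (S, l) ts = n ↔ touches ts.length n l (hits S ts) := by
  have := value_add_length_hits S l ts
  rw [touches, beq_iff_eq]
  omega

lemma rigidCheck_spec {ts : List (Tup d)} {n : ℕ} (hc : rigidCheck ts n) (r : Label d)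
    (hr : IsGate r) : value r ts = n ∨
      (matched r.2 (hits r.1 ts) = (hits r.1 ts).length ∧ n ≤ value r ts) := by
  have h1 := List.all_eq_true.1 (List.all_eq_true.1 hc r.1 ((mem_linList _).2 hr)) r.2
    (mem_vecList _)
  rw [Bool.or_eq_true, ← value_eq_iff, Bool.and_eq_true, beq_iff_eq, Nat.ble_eq] at h1
  have := value_add_length_hits r.1 r.2 ts
  rcases h1 with h1 | ⟨h1, h2⟩
  · exact Or.inl h1
  · exact Or.inr ⟨h1, by change n ≤ value (r.1, r.2) ts; omega⟩

lemma le_value_of_rigidCheck {ts : List (Tup d)} {n : ℕ} (hc : rigidCheck ts n) (r : Label d)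
    (hr : IsGate r) : n ≤ value r ts := by
  rcases rigidCheck_spec hc r hr with h | h
  · exact h.ge
  · exact h.2

lemma rigid_of_rigidCheck {ts : List (Tup d)} {n : ℕ} (hc : rigidCheck ts n) : Rigid ts n := by
  intro r hr t ht hit hne
  refine (rigidCheck_spec hc r hr).resolve_right fun h => hne ?_
  have h1 := List.countP_eq_length.1 h.1 (flipv t.1, t.2.2)
    (List.mem_map.2 ⟨t, List.mem_filter.2 ⟨ht, by simpa using hit⟩, rfl⟩)
  simpa using h1

/-- The number of contact vertices. -/
def tally (ts : List (Tup d)) (n : ℕ) : ℕ :=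
  ((linList d).map fun S => (vecList d).countP fun l => touches ts.length n l (hits S ts)).sum

lemma countP_product {α β : Type*} (l : List α) (l' : List β) (p : α × β → Bool) :
    (l ×ˢ l').countP p = (l.map fun a => l'.countP fun b => p (a, b)).sum := by
  have : l ×ˢ l' = l.flatMap fun a => l'.map (Prod.mk a) := rfl
  rw [this, List.countP_flatMap]
  congr 1
  refine List.map_congr_left fun a _ => ?_
  rw [Function.comp_apply, List.countP_map]
  rfl

lemma ncard_contactLabels (ts : List (Tup d)) (n : ℕ) :
    (contactLabels ts n).ncard = tally ts n := by
  have e : contactLabels ts n = (((linList d ×ˢ vecList d).filter fun r =>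
      touches ts.length n r.2 (hits r.1 ts)).toFinset : Set (Label d)) := by
    ext ⟨S, l⟩
    simp only [contactLabels, Set.mem_ofPred_eq, List.coe_toFinset, List.mem_filter,
      List.mem_product, mem_linList, mem_vecList, and_true, IsGate, value_eq_iff]
  rw [e, Set.ncard_coe_finset, List.toFinset_card_of_nodup
    ((nodup_linList.product nodup_vecList).filter _), ← List.countP_eq_length_filter,
    countP_product, tally]

/-- The move of a tuple can be applied to a node. -/
def adjacent (t : Tup d) (n : Vec d × Vec d) : Bool :=
  detv t.1 n.1 ≠ 0 && detv t.1 n.1 + detv t.2.1 n.2 = 0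

/-- Apply a move to a node. -/
def step (t : Tup d) (n : Vec d × Vec d) : Vec d × Vec d := (n.1 - t.1, n.2 - t.2.1)

lemma Relations.step_eq {moves : List (Tup d)} {C : Vec d × Vec d → ℂ} (hC : Relations moves C)
    {t : Tup d} (ht : t ∈ moves) {n : Vec d × Vec d} (ha : adjacent t n) :
    C (step t n) = chi (-t.2.2) * C n := by
  simp only [adjacent, Bool.and_eq_true, decide_eq_true_eq] at ha
  exact hC.edge t ht n ha.2 ha.1

/-- Follow a path of moves, and keep track of the phase. -/
def walk (moves : List (Tup d)) : List ℕ → (Vec d × Vec d) × ZMod d →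
    Option ((Vec d × Vec d) × ZMod d)
  | [], s => some s
  | i :: is, s => if adjacent (moves.getD i 0) s.1 then
      walk moves is (step (moves.getD i 0) s.1, s.2 - (moves.getD i 0).2.2) else none

lemma Relations.walk_eq {moves : List (Tup d)} {C : Vec d × Vec d → ℂ} (hC : Relations moves C)
    {path : List ℕ} {s s' : (Vec d × Vec d) × ZMod d} (hs : walk moves path s = some s') :
    C s'.1 = chi (s'.2 - s.2) * C s.1 := by
  induction path generalizing s with
  | nil =>
    simp only [walk, Option.some.injEq] at hs
    simp [hs]
  | cons i is ih =>
    rw [walk] at hs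
    split_ifs at hs with ha
    have hm : moves.getD i 0 ∈ moves := by
      rw [List.getD_eq_getElem?_getD]
      rcases lt_or_ge i moves.length with hi | hi
      · rw [List.getElem?_eq_getElem hi]
        exact List.getElem_mem hi
      · simp [adjacent, detv, List.getElem?_eq_none hi] at ha
    rw [ih hs, hC.step_eq hm ha, ← mul_assoc, ← AddChar.map_add_eq_mul]
    congr 2
    ring

/-- A closed path with a nontrivial phase. -/
def isLoop (moves : List (Tup d)) (n : Vec d × Vec d) (path : List ℕ) : Bool :=
  match walk moves path (n, 0) with
  | some s => s.1 = n && s.2 ≠ 0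
  | none => false

lemma Relations.eq_zero_of_isLoop {moves : List (Tup d)} {C : Vec d × Vec d → ℂ}
    (hC : Relations moves C) {n : Vec d × Vec d} {path : List ℕ} (hl : isLoop moves n path) :
    C n = 0 := by
  rw [isLoop] at hl
  split at hl
  · rename_i s hs
    simp only [Bool.and_eq_true, decide_eq_true_eq] at hl
    have := hC.walk_eq hs
    rw [hl.1, sub_zero] at this
    by_contra h0
    exact hl.2 (chi_eq_one_iff.1 (mul_right_cancel₀ h0 (by rw [one_mul]; exact this.symm)))
  · simp at hl

/-- Numbering of the nodes. -/
def code (n : Vec d × Vec d) : ℕ :=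
  n.1.1.val + d * (n.1.2.val + d * (n.2.1.val + d * n.2.2.val))

/-- The node with a given number. -/
def decode (c : ℕ) : Vec d × Vec d :=
  (((c : ZMod d), ((c / d : ℕ) : ZMod d)), (((c / d / d : ℕ) : ZMod d), ((c / d / d / d : ℕ) : ZMod d)))

lemma decode_code (n : Vec d × Vec d) : decode (code n) = n := by
  have hd : 0 < d := Nat.pos_of_ne_zero (NeZero.ne d)
  have h1 : ∀ (x : ZMod d) (y : ℕ), (x.val + d * y) / d = y := fun x y => by
    rw [Nat.add_mul_div_left _ _ hd, Nat.div_eq_of_lt (ZMod.val_lt x), zero_add]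
  have h2 : ∀ (x : ZMod d) (y : ℕ), ((x.val + d * y : ℕ) : ZMod d) = x := fun x y => by
    simp
  simp only [decode, code, h1, h2, ZMod.natCast_zmod_val]

lemma code_injective : Function.Injective (code (d := d)) :=
  Function.LeftInverse.injective decode_code

/-- Evaluate a number before it is used. -/
def force {α : Type} (n : ℕ) (f : ℕ → α) : α :=
  match n with
  | 0 => f 0
  | k + 1 => f (k + 1)

@[simp] lemma force_eq {α : Type} (n : ℕ) (f : ℕ → α) : force n f = f n := by
  cases n <;> rfl

/-- Push the unvisited neighbours of a node. The visited nodes are kept as a bit mask. -/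
def expand {α : Type} (n : Vec d × Vec d) :
    List (Tup d) → ℕ → List ℕ → (ℕ → List ℕ → α) → α
  | [], m, q, k => k m q
  | t :: ts, m, q, k =>
    if adjacent t n then
      force (code (step t n)) fun c =>
        if m.testBit c then expand n ts m q k
        else force (m ||| 1 <<< c) fun m' => expand n ts m' (c :: q) k
    else expand n ts m q k

/-- The nodes that can be reached from a list of nodes. -/
def reach (moves : List (Tup d)) : ℕ → ℕ → List ℕ → ℕ
  | 0, m, _ => m
  | _ + 1, m, [] => m
  | k + 1, m, c :: q => expand (decode c) moves m q (reach moves k)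

/-- All nodes in the mask have coefficient zero. -/
def MaskZero (C : Vec d × Vec d → ℂ) (m : ℕ) : Prop :=
  ∀ n : Vec d × Vec d, m.testBit (code n) → C n = 0

lemma MaskZero.insert {C : Vec d × Vec d → ℂ} {m : ℕ} (hm : MaskZero C m) {n : Vec d × Vec d}
    (hn : C n = 0) : MaskZero C (m ||| 1 <<< code n) := by
  intro n' h
  rw [Nat.testBit_or, Bool.or_eq_true, Nat.one_shiftLeft, Nat.testBit_two_pow,
    decide_eq_true_eq] at h
  rcases h with h | h
  · exact hm n' h
  · rw [← code_injective h, hn]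

lemma Relations.expand_induction {moves : List (Tup d)} {C : Vec d × Vec d → ℂ}
    (hC : Relations moves C) {α : Type} {P : α → Prop} {n : Vec d × Vec d} (hn : C n = 0)
    {k : ℕ → List ℕ → α}
    (hk : ∀ m q, MaskZero C m → (∀ c ∈ q, C (decode c) = 0) → P (k m q)) :
    ∀ (ts : List (Tup d)), ts ⊆ moves → ∀ m q, MaskZero C m → (∀ c ∈ q, C (decode c) = 0) →
      P (expand n ts m q k) := by
  intro ts
  induction ts with
  | nil => exact fun _ m q hm hq => hk m q hm hq
  | cons t ts ih =>
    intro hts m q hm hq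
    rw [List.cons_subset] at hts
    rw [expand]
    split_ifs with ha
    · have h0 : C (step t n) = 0 := by rw [hC.step_eq hts.1 ha, hn, mul_zero]
      simp only [force_eq]
      split_ifs with hb
      · exact ih hts.2 m q hm hq
      · refine ih hts.2 _ _ (hm.insert h0) ?_
        intro c hc
        rcases List.mem_cons.1 hc with rfl | hc
        · rwa [decode_code]
        · exact hq c hc
    · exact ih hts.2 m q hm hq

lemma Relations.maskZero_reach {moves : List (Tup d)} {C : Vec d × Vec d → ℂ}
    (hC : Relations moves C) (k m : ℕ) (q : List ℕ) (hm : MaskZero C m)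
    (hq : ∀ c ∈ q, C (decode c) = 0) : MaskZero C (reach moves k m q) := by
  induction k generalizing m q with
  | zero => exact hm
  | succ k ih =>
    cases q with
    | nil => exact hm
    | cons c q =>
      rw [reach]
      exact hC.expand_induction (P := MaskZero C) (hq c (List.mem_cons_self ..)) ih moves
        (List.Subset.refl _) m q hm fun c' hc' => hq c' (List.mem_cons_of_mem _ hc')

lemma Relations.mono {moves moves' : List (Tup d)} {C : Vec d × Vec d → ℂ}
    (hC : Relations moves C) (hm : moves' ⊆ moves) : Relations moves' C :=
  ⟨fun t ht => hC.edge t (hm ht), fun t ht => hC.root t (hm ht)⟩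

/-- The check that all nodes are moves or can be reached from the given nodes, with the moves of
given indices. -/
def reachCheck (moves : List (Tup d)) (idx : List ℕ) (base : List (Vec d × Vec d)) : Bool :=
  force (reach (idx.filterMap fun i => moves[i]?) (d ^ 4) 0 (base.map code)) fun m =>
    (vecList d).all fun u => (vecList d).all fun v =>
      u = 0 || v = 0 || m.testBit (code (u, v)) || moves.any fun t => t.1 = u && t.2.1 = v

lemma Relations.eq_zero_of_reachCheck {moves : List (Tup d)} {C : Vec d × Vec d → ℂ}
    (hC : Relations moves C) {idx : List ℕ} {base : List (Vec d × Vec d)}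
    (hb : ∀ n ∈ base, C n = 0) (hr : reachCheck moves idx base) (n : Vec d × Vec d)
    (h1 : n.1 ≠ 0) (h2 : n.2 ≠ 0) : C n = 0 := by
  rw [reachCheck, force_eq] at hr
  have hC' : Relations (idx.filterMap fun i => moves[i]?) C := hC.mono fun t ht => by
    obtain ⟨i, -, hi⟩ := List.mem_filterMap.1 ht
    exact List.mem_of_getElem? hi
  have hm := hC'.maskZero_reach (d ^ 4) 0 (base.map code) (fun n h => by simp at h) (by
    intro c hc
    obtain ⟨n, hn, rfl⟩ := List.mem_map.1 hc
    rw [decode_code]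
    exact hb n hn)
  have := List.all_eq_true.1 (List.all_eq_true.1 hr n.1 (mem_vecList _)) n.2 (mem_vecList _)
  simp only [h1, h2, decide_false, Bool.false_or, Bool.or_eq_true, List.any_eq_true,
    Bool.and_eq_true, decide_eq_true_eq] at this
  rcases this with h | ⟨t, ht, e1, e2⟩
  · exact hm n h
  · have := hC.root t ht
    rwa [e1, e2] at this

end Certificates

section Criteria

variable {d : ℕ} [NeZero d] [Fact d.Prime]

/-- The moves given by a list of tuples. -/
def movesOf (ts : List (Tup d)) : List (Tup d) := ts ++ ts.map negTup

lemma annihilator_eq_bot {h : ZMod d} (hh : 2 * h = 1) {ts : List (Tup d)} {n : ℕ}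
    (h0 : NonzeroTups ts) (hc : rigidCheck ts n) {idx : List ℕ}
    {loops : List ((Vec d × Vec d) × List ℕ)}
    (hl : loops.all fun p => isLoop (movesOf ts) p.1 p.2)
    (hr : reachCheck (movesOf ts) idx (loops.map Prod.fst)) :
    annihilator h (contactLabels ts n) = ⊥ := by
  rw [eq_bot_iff]
  intro φ hφ
  have hC := relations_of_rigid hh (rigid_of_rigidCheck hc) h0 hφ
  refine eq_zero_of_coeffs (h := h) (hC.eq_zero_of_reachCheck (fun n hn => ?_) hr)
  obtain ⟨p, hp, rfl⟩ := List.mem_map.1 hn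
  exact hC.eq_zero_of_isLoop (List.all_eq_true.1 hl p hp)

lemma isTrueFacet_of_checks {h : ZMod d} (hh : 2 * h = 1) {W : TwoQuditOp d} {g : ℝ}
    {ts : List (Tup d)} {n : ℕ} (hW : Represents h W g ts n)
    (h0 : NonzeroTups ts) (hc : rigidCheck ts n) {idx : List ℕ}
    {loops : List ((Vec d × Vec d) × List ℕ)}
    (hl : loops.all fun p => isLoop (movesOf ts) p.1 p.2)
    (hr : reachCheck (movesOf ts) idx (loops.map Prod.fst))
    (hne : ∃ r : Label d, IsGate r ∧ value r ts ≠ n) : IsTrueFacet d W g := by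
  refine ⟨hW.isSupporting hh (le_value_of_rigidCheck hc) hne, ?_⟩
  have := hW.contactRank_add hh
  rwa [annihilator_eq_bot hh h0 hc hl hr, finrank_bot, add_zero] at this

/-- The function on nodes given by a table of phases. -/
noncomputable def tableFun (tb : List (Tup d)) (n : Vec d × Vec d) : ℂ :=
  (tb.map fun t => if (t.1, t.2.1) = n then chi t.2.2 else 0).sum

lemma tableFun_cons (t : Tup d) (tb : List (Tup d)) (n : Vec d × Vec d) :
    tableFun (t :: tb) n = (if (t.1, t.2.1) = n then chi t.2.2 else 0) + tableFun tb n := by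
  simp [tableFun]

/-- The node of a tuple does not occur in a table. -/
def notIn (n : Vec d × Vec d) (tb : List (Tup d)) : Bool := tb.all fun t => (t.1, t.2.1) ≠ n

lemma tableFun_of_notIn {tb : List (Tup d)} {n : Vec d × Vec d} (hn : notIn n tb) :
    tableFun tb n = 0 := by
  induction tb with
  | nil => simp [tableFun]
  | cons t tb ih =>
    rw [notIn, List.all_cons, Bool.and_eq_true, decide_eq_true_eq] at hn
    rw [tableFun_cons, if_neg hn.1, ih hn.2, zero_add]

lemma sum_tableFun (tb : List (Tup d)) (S : Lin d) (l : Vec d) :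
    ∑ u, tableFun tb (u, mulS S (flipv u)) * chi (dotv l (flipv u)) =
      ((hits S tb).map fun t => chi (t.2 + dotv l t.1)).sum := by
  induction tb with
  | nil => simp [tableFun, hits]
  | cons t tb ih =>
    simp only [tableFun_cons, add_mul, Finset.sum_add_distrib, ih]
    have e : ∑ u, (if (t.1, t.2.1) = (u, mulS S (flipv u)) then chi t.2.2 else 0) *
        chi (dotv l (flipv u)) =
        if t.2.1 = mulS S (flipv t.1) then chi (t.2.2 + dotv l (flipv t.1)) else 0 := by
      rw [Finset.sum_eq_single t.1]
      · simp [AddChar.map_add_eq_mul]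
      · intro u _ hu
        rw [if_neg, zero_mul]
        exact fun h => hu (Prod.ext_iff.1 h).1.symm
      · simp
    rw [e]
    by_cases ht : t.2.1 = mulS S (flipv t.1) <;> simp [hits, ht]

/-- All phases occur equally often. -/
def balanced (l : Vec d) (H : List (Vec d × ZMod d)) : Bool :=
  (zmodList d).all fun x => (H.countP fun t => t.2 + dotv l t.1 = x) == matched l H

lemma sum_chi_eq (L : List (ZMod d)) : (L.map chi).sum = ∑ x, (L.count x : ℂ) * chi x := by
  induction L with
  | nil => simp
  | cons y L ih =>
    simp [List.count_cons, ih, add_mul, Finset.sum_add_distrib, add_comm]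

lemma sum_eq_zero_of_balanced {l : Vec d} {H : List (Vec d × ZMod d)} (hb : balanced l H) :
    (H.map fun t => chi (t.2 + dotv l t.1)).sum = 0 := by
  have e : (H.map fun t => chi (t.2 + dotv l t.1)) =
      (H.map fun t => t.2 + dotv l t.1).map chi := by rw [List.map_map]; rfl
  have hc : ∀ x, (H.map fun t => t.2 + dotv l t.1).count x = matched l H := by
    intro x
    have := List.all_eq_true.1 hb x (mem_zmodList x)
    rw [beq_iff_eq] at this
    rw [← this, List.count, List.countP_map]
    congr 1
  have h1 : (1 : ZMod d) ≠ 0 := one_ne_zero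
  have h2 := sum_chi_mul (1 : ZMod d)
  simp only [mul_one, if_neg h1] at h2
  rw [e, sum_chi_eq]
  simp only [hc, ← Finset.mul_sum, h2, mul_zero]

/-- The check that the functional of a table vanishes on all contact vertices. -/
def tableCheck (ts : List (Tup d)) (n : ℕ) (tb : List (Tup d)) : Bool :=
  (linList d).all fun S => (vecList d).all fun l =>
    !touches ts.length n l (hits S ts) || balanced l (hits S tb)

lemma functional_mem_annihilator {h : ZMod d} (hh : 2 * h = 1) {ts : List (Tup d)} {n : ℕ}
    {tb : List (Tup d)} (h0 : NonzeroTups tb) (hc : tableCheck ts n tb) :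
    functional h (tableFun tb) ∈ annihilator h (contactLabels ts n) := by
  rw [mem_annihilator]
  rintro r ⟨hr, hv⟩
  rw [functional_vertex hh _ hr, sum_tableFun]
  · apply sum_eq_zero_of_balanced
    have := List.all_eq_true.1 (List.all_eq_true.1 hc r.1 ((mem_linList _).2 hr)) r.2
      (mem_vecList _)
    rw [(value_eq_iff r.1 r.2 ts n).1 hv] at this
    simpa using this
  · intro v
    apply tableFun_of_notIn
    rw [notIn, List.all_eq_true]
    intro t ht
    simp only [ne_eq, Prod.mk.injEq, decide_eq_true_eq]
    exact fun h => (h0 t ht).1 h.1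

lemma nonzeroTups_map_negTup {tb : List (Tup d)} (h0 : NonzeroTups tb) :
    NonzeroTups (tb.map negTup) := by
  intro t' ht'
  obtain ⟨t, ht, rfl⟩ := List.mem_map.1 ht'
  exact ⟨neg_ne_zero.2 (h0 t ht).1, neg_ne_zero.2 (h0 t ht).2⟩

lemma finrank_annihilator_eq_two {h : ZMod d} (hh : 2 * h = 1) {ts : List (Tup d)} {n : ℕ}
    (h0 : NonzeroTups ts) (hc : rigidCheck ts n) {t : Tup d} {tb : List (Tup d)}
    {idx : List ℕ} (h1 : NonzeroTups (t :: tb))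
    (hr : reachCheck (movesOf ts) idx [(t.1, t.2.1), (-t.1, -t.2.1)])
    (hn : notIn (t.1, t.2.1) tb && notIn (-t.1, -t.2.1) (t :: tb))
    (hn' : notIn (-t.1, -t.2.1) (tb.map negTup) && notIn (t.1, t.2.1) ((t :: tb).map negTup))
    (ht : tableCheck ts n (t :: tb) && tableCheck ts n ((t :: tb).map negTup)) :
    Module.finrank ℂ (annihilator h (contactLabels ts n)) = 2 := by
  rw [Bool.and_eq_true] at hn hn' ht
  have hz := h1 t (List.mem_cons_self ..)
  obtain ⟨w, hw⟩ := WeightTwo.exists_node (n := (t.1, t.2.1)) hz.1 hz.2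
  obtain ⟨w', hw'⟩ := WeightTwo.exists_node (n := (-t.1, -t.2.1)) (neg_ne_zero.2 hz.1)
    (neg_ne_zero.2 hz.2)
  apply le_antisymm
  · let f : annihilator h (contactLabels ts n) →ₗ[ℂ] ℂ × ℂ :=
      ((LinearMap.applyₗ (Pi.single w 1)).prod (LinearMap.applyₗ (Pi.single w' 1))).comp
        (annihilator h (contactLabels ts n)).subtype
    have hf : Function.Injective f := by
      rw [← LinearMap.ker_eq_bot, LinearMap.ker_eq_bot']
      rintro ⟨φ, hφ⟩ he
      have e1 : φ (Pi.single w 1) = 0 := congrArg Prod.fst he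
      have e2 : φ (Pi.single w' 1) = 0 := congrArg Prod.snd he
      have hC := relations_of_rigid hh (rigid_of_rigidCheck hc) h0 hφ
      refine Subtype.ext (eq_zero_of_coeffs (h := h) (hC.eq_zero_of_reachCheck ?_ hr))
      intro n hn
      simp only [List.mem_cons, List.not_mem_nil, or_false] at hn
      rcases hn with rfl | rfl
      · rw [← hw, coeffs_node, e1, zero_mul]
      · rw [← hw', coeffs_node, e2, zero_mul]
    have := LinearMap.finrank_le_finrank_of_injective hf
    rwa [Module.finrank_prod, Module.finrank_self] at this
  · have m1 := functional_mem_annihilator hh h1 ht.1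
    have m2 := functional_mem_annihilator hh (nonzeroTups_map_negTup h1) ht.2
    have a1 : functional h (tableFun (t :: tb)) (Pi.single w 1) ≠ 0 := by
      rw [functional_single, hw, tableFun_cons, tableFun_of_notIn hn.1, if_pos rfl, add_zero]
      exact mul_ne_zero (chi_ne_zero _) (chi_ne_zero _)
    have a2 : functional h (tableFun (t :: tb)) (Pi.single w' 1) = 0 := by
      rw [functional_single, hw', tableFun_of_notIn hn.2, zero_mul]
    have b1 : functional h (tableFun ((t :: tb).map negTup)) (Pi.single w 1) = 0 := by
      rw [functional_single, hw, tableFun_of_notIn hn'.2, zero_mul]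
    have b2 : functional h (tableFun ((t :: tb).map negTup)) (Pi.single w' 1) ≠ 0 := by
      rw [functional_single, hw', List.map_cons, tableFun_cons, tableFun_of_notIn hn'.1,
        negTup, if_pos rfl, add_zero]
      exact mul_ne_zero (chi_ne_zero _) (chi_ne_zero _)
    have hli : LinearIndependent ℂ
        ![(⟨_, m1⟩ : annihilator h (contactLabels ts n)), ⟨_, m2⟩] := by
      rw [LinearIndependent.pair_iff]
      intro x y hxy
      have hxy' := congrArg Subtype.val hxy
      have c1 := LinearMap.congr_fun hxy' (Pi.single w 1)
      have c2 := LinearMap.congr_fun hxy' (Pi.single w' 1)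
      simp only [Submodule.coe_add, Submodule.coe_smul, LinearMap.add_apply, LinearMap.smul_apply,
        smul_eq_mul, b1, a2, mul_zero, add_zero, zero_add, ZeroMemClass.coe_zero,
        LinearMap.zero_apply, mul_eq_zero, a1, b2, or_false] at c1 c2
      exact ⟨c1, c2⟩
    simpa using hli.fintype_card_le_finrank

end Criteria

open scoped Pointwise

section Covariance

variable {d : ℕ} [NeZero d] [Fact d.Prime]

lemma transpose_mem_cliffordGates {h : ZMod d} (hh : 2 * h = 1) {U : QuditOp d}
    (hU : U ∈ cliffordGates d) : Uᵀ ∈ cliffordGates d := by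
  have : Uᵀ = (U.map star)ᴴ := by
    ext i j
    simp
  rw [this]
  exact conjTranspose_mem_cliffordGates hh (map_star_mem_cliffordGates hh hU)

lemma choiState_conj (A B U : QuditOp d) :
    choiState d (B * U * Aᵀ) = (A ⊗ₖ B) * choiState d U * (A ⊗ₖ B)ᴴ := by
  have e : choiKet d (B * U * Aᵀ) = (A ⊗ₖ B) *ᵥ choiKet d U := by
    funext p
    obtain ⟨i, j⟩ := p
    simp only [choiKet_apply, Matrix.mulVec, dotProduct, Fintype.sum_prod_type,
      Matrix.kroneckerMap_apply, Matrix.mul_apply, Matrix.transpose_apply, Finset.sum_mul]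
    refine Finset.sum_congr rfl fun k _ => Finset.sum_congr rfl fun l _ => ?_
    ring
  rw [choiState, e, choiState, Matrix.mul_vecMulVec, Matrix.vecMulVec_mul, Matrix.star_mulVec]

lemma conj_mem_cliffordVertices {h : ZMod d} (hh : 2 * h = 1) {A B : QuditOp d}
    (hA : A ∈ cliffordGates d) (hB : B ∈ cliffordGates d) {τ : TwoQuditOp d}
    (hτ : τ ∈ cliffordVertices d) : (A ⊗ₖ B) * τ * (A ⊗ₖ B)ᴴ ∈ cliffordVertices d := by
  obtain ⟨U, hU, rfl⟩ := hτ
  exact ⟨B * U * Aᵀ, mul_mem_cliffordGates hh (mul_mem_cliffordGates hh hB hU)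
    (transpose_mem_cliffordGates hh hA), choiState_conj A B U⟩

lemma kronecker_conj_mul {A B : QuditOp d} (hA : A ∈ cliffordGates d) (hB : B ∈ cliffordGates d) :
    (A ⊗ₖ B)ᴴ * (A ⊗ₖ B) = 1 := by
  rw [Matrix.conjTranspose_kronecker, ← Matrix.mul_kronecker_mul, unitary_conj_mul hA.1,
    unitary_conj_mul hB.1, Matrix.one_kronecker_one]

lemma kronecker_mul_conj {A B : QuditOp d} (hA : A ∈ cliffordGates d) (hB : B ∈ cliffordGates d) :
    (A ⊗ₖ B) * (A ⊗ₖ B)ᴴ = 1 := by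
  rw [Matrix.conjTranspose_kronecker, ← Matrix.mul_kronecker_mul, unitary_mul_conj hA.1,
    unitary_mul_conj hB.1, Matrix.one_kronecker_one]

lemma conj_conj_cancel {n : Type*} [Fintype n] [DecidableEq n] {K : Matrix n n ℂ}
    (hK : Kᴴ * K = 1) (W : Matrix n n ℂ) : Kᴴ * (K * W * Kᴴ) * K = W := by
  calc Kᴴ * (K * W * Kᴴ) * K = (Kᴴ * K) * W * (Kᴴ * K) := by simp only [Matrix.mul_assoc]
    _ = W := by rw [hK, Matrix.one_mul, Matrix.mul_one]

lemma trace_conj_mul {n : Type*} [Fintype n] (K W τ : Matrix n n ℂ) :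
    ((K * W * Kᴴ) * τ).trace = (W * (Kᴴ * τ * K)).trace := by
  rw [Matrix.mul_assoc, Matrix.mul_assoc, Matrix.trace_mul_comm]
  simp only [Matrix.mul_assoc]

lemma contactVertices_conj {h : ZMod d} (hh : 2 * h = 1) {A B : QuditOp d}
    (hA : A ∈ cliffordGates d) (hB : B ∈ cliffordGates d) (W : TwoQuditOp d) (g : ℝ) :
    contactVertices d ((A ⊗ₖ B) * W * (A ⊗ₖ B)ᴴ) g =
      (fun τ => (A ⊗ₖ B) * τ * (A ⊗ₖ B)ᴴ) '' contactVertices d W g := by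
  have hA' := conjTranspose_mem_cliffordGates hh hA
  have hB' := conjTranspose_mem_cliffordGates hh hB
  ext τ
  constructor
  · rintro ⟨h1, h2⟩
    refine ⟨(A ⊗ₖ B)ᴴ * τ * (A ⊗ₖ B), ⟨?_, ?_⟩, ?_⟩
    · have := conj_mem_cliffordVertices hh hA' hB' h1
      rwa [← Matrix.conjTranspose_kronecker, Matrix.conjTranspose_conjTranspose] at this
    · rwa [← trace_conj_mul]
    · have := conj_conj_cancel (K := (A ⊗ₖ B)ᴴ)
        (by rw [Matrix.conjTranspose_conjTranspose]; exact kronecker_mul_conj hA hB) τ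
      rwa [Matrix.conjTranspose_conjTranspose] at this
  · rintro ⟨τ, ⟨h1, h2⟩, rfl⟩
    refine ⟨conj_mem_cliffordVertices hh hA hB h1, ?_⟩
    rwa [trace_conj_mul, conj_conj_cancel (kronecker_conj_mul hA hB)]

lemma Realizes.kronecker_conj {h : ZMod d} {A B : QuditOp d} {r r' : Label d}
    (hA : Realizes h A r) (hB : Realizes h B r') (u v : Vec d) :
    (A ⊗ₖ B) * weyl2 h u v * (A ⊗ₖ B)ᴴ =
      chi (dotv r.2 u + dotv r'.2 v) • weyl2 h (mulS r.1 u) (mulS r'.1 v) := by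
  rw [weyl2, Matrix.conjTranspose_kronecker, ← Matrix.mul_kronecker_mul,
    ← Matrix.mul_kronecker_mul, hA.2, hB.2, Matrix.smul_kronecker, Matrix.kronecker_smul, smul_smul,
    ← AddChar.map_add_eq_mul, weyl2]

lemma exists_coeffVec_conj {h : ZMod d} (hh : 2 * h = 1) {A B : QuditOp d}
    (hA : A ∈ cliffordGates d) (hB : B ∈ cliffordGates d) (w : WeightTwo d) :
    ∃ (c : ℂ) (w' : WeightTwo d), ∀ τ : TwoQuditOp d,
      coeffVec d ((A ⊗ₖ B) * τ * (A ⊗ₖ B)ᴴ) w = c * coeffVec d τ w' := by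
  obtain ⟨r, h1, hr⟩ := exists_realizes_of_mem hh (conjTranspose_mem_cliffordGates hh hA)
  obtain ⟨r', h1', hr'⟩ := exists_realizes_of_mem hh (conjTranspose_mem_cliffordGates hh hB)
  have hw := w.node_ne_zero
  obtain ⟨w', hw'⟩ := WeightTwo.exists_node (n := (mulS r.1 w.node.1, mulS r'.1 w.node.2))
    (by rw [Ne, mulS_eq_zero_iff h1]; exact hw.1) (by rw [Ne, mulS_eq_zero_iff h1']; exact hw.2)
  refine ⟨chi (nodePhase h w.node) * chi (dotv r.2 (-w.node.1) + dotv r'.2 (-w.node.2)) *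
    chi (-nodePhase h w'.node), w', fun τ => ?_⟩
  have e := hr.kronecker_conj hr' (-w.node.1) (-w.node.2)
  rw [← Matrix.conjTranspose_kronecker, Matrix.conjTranspose_conjTranspose, mulS_neg, mulS_neg] at e
  have e2 : (weyl2 h (-w.node.1) (-w.node.2) * ((A ⊗ₖ B) * τ * (A ⊗ₖ B)ᴴ)).trace =
      ((A ⊗ₖ B)ᴴ * weyl2 h (-w.node.1) (-w.node.2) * (A ⊗ₖ B) * τ).trace := by
    rw [← Matrix.mul_assoc, ← Matrix.mul_assoc, Matrix.trace_mul_comm]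
    simp only [Matrix.mul_assoc]
  rw [coeffVec_eq hh, coeffVec_eq hh, e2, e, hw', Matrix.smul_mul, Matrix.trace_smul, smul_eq_mul]
  have : chi (-nodePhase h (mulS r.1 w.node.1, mulS r'.1 w.node.2)) *
      chi (nodePhase h (mulS r.1 w.node.1, mulS r'.1 w.node.2)) = 1 := by
    rw [← AddChar.map_add_eq_mul, neg_add_cancel, AddChar.map_zero_eq_one]
  linear_combination (-(chi (nodePhase h w.node) *
    chi (dotv r.2 (-w.node.1) + dotv r'.2 (-w.node.2)) *
    (weyl2 h (-mulS r.1 w.node.1) (-mulS r'.1 w.node.2) * τ).trace)) * this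

lemma contactRank_conj_le {h : ZMod d} (hh : 2 * h = 1) {A B : QuditOp d}
    (hA : A ∈ cliffordGates d) (hB : B ∈ cliffordGates d) (W : TwoQuditOp d) (g : ℝ) :
    contactRank d ((A ⊗ₖ B) * W * (A ⊗ₖ B)ᴴ) g ≤ contactRank d W g := by
  choose c w' hw using exists_coeffVec_conj hh hA hB
  let L : (WeightTwo d → ℂ) →ₗ[ℂ] (WeightTwo d → ℂ) :=
    LinearMap.pi fun w => c w • LinearMap.proj (w' w)
  have e : coeffVec d '' contactVertices d ((A ⊗ₖ B) * W * (A ⊗ₖ B)ᴴ) g =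
      L '' (coeffVec d '' contactVertices d W g) := by
    rw [contactVertices_conj hh hA hB, Set.image_image, Set.image_image]
    refine Set.image_congr fun τ _ => ?_
    funext w
    rw [hw]
    rfl
  rw [contactRank, contactRank, e, Submodule.span_image]
  exact Submodule.finrank_map_le L _

lemma contactRank_conj {h : ZMod d} (hh : 2 * h = 1) {A B : QuditOp d}
    (hA : A ∈ cliffordGates d) (hB : B ∈ cliffordGates d) (W : TwoQuditOp d) (g : ℝ) :
    contactRank d ((A ⊗ₖ B) * W * (A ⊗ₖ B)ᴴ) g = contactRank d W g := by
  refine le_antisymm (contactRank_conj_le hh hA hB W g) ?_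
  have := contactRank_conj_le hh (conjTranspose_mem_cliffordGates hh hA)
    (conjTranspose_mem_cliffordGates hh hB) ((A ⊗ₖ B) * W * (A ⊗ₖ B)ᴴ) g
  rwa [← Matrix.conjTranspose_kronecker, Matrix.conjTranspose_conjTranspose,
    conj_conj_cancel (kronecker_conj_mul hA hB)] at this

lemma IsSupporting.conj {h : ZMod d} (hh : 2 * h = 1) {A B : QuditOp d}
    (hA : A ∈ cliffordGates d) (hB : B ∈ cliffordGates d) {W : TwoQuditOp d} {g : ℝ}
    (hW : IsSupporting d W g) : IsSupporting d ((A ⊗ₖ B) * W * (A ⊗ₖ B)ᴴ) g := by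
  obtain ⟨h1, h2, τ, hτ, h3⟩ := hW
  refine ⟨?_, fun τ hτ => ?_, (A ⊗ₖ B) * τ * (A ⊗ₖ B)ᴴ, conj_mem_cliffordVertices hh hA hB hτ, ?_⟩
  · exact Matrix.isHermitian_mul_mul_conjTranspose _ h1
  · rw [trace_conj_mul]
    have := conj_mem_cliffordVertices hh (conjTranspose_mem_cliffordGates hh hA)
      (conjTranspose_mem_cliffordGates hh hB) hτ
    rw [← Matrix.conjTranspose_kronecker, Matrix.conjTranspose_conjTranspose] at this
    exact h2 _ this
  · rwa [trace_conj_mul, conj_conj_cancel (kronecker_conj_mul hA hB)]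

lemma IsTrueFacet.of_mem_localOrbit {h : ZMod d} (hh : 2 * h = 1) {W W' : TwoQuditOp d} {g : ℝ}
    (hW : IsTrueFacet d W g) (hW' : W' ∈ localOrbit d W) : IsTrueFacet d W' g := by
  obtain ⟨A, hA, B, hB, rfl⟩ := hW'
  exact ⟨hW.1.conj hh hA hB, by rw [contactRank_conj hh hA hB, hW.2]⟩

lemma IsPeak.of_mem_localOrbit {h : ZMod d} (hh : 2 * h = 1) {W W' : TwoQuditOp d} {g : ℝ}
    (hW : IsPeak d W g) (hW' : W' ∈ localOrbit d W) : IsPeak d W' g := by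
  obtain ⟨A, hA, B, hB, rfl⟩ := hW'
  refine ⟨hW.1.conj hh hA hB, ?_, by rw [contactRank_conj hh hA hB]; exact hW.2.2⟩
  rw [contactVertices_conj hh hA hB]
  exact hW.2.1.image _

end Covariance

section GateGroup

variable {d : ℕ} [NeZero d] [Fact d.Prime]

/-- The group of Clifford gates modulo phases. -/
abbrev Gate (d : ℕ) [NeZero d] [Fact d.Prime] := {r : Label d // IsGate r}

instance : Mul (Gate d) :=
  ⟨fun r r' => ⟨(compS r.1.1 r'.1.1, r'.1.2 + pullv r'.1.1 r.1.2), by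
    have h1 := r.2
    have h2 := r'.2
    simp only [IsGate, detv, compS] at h1 h2 ⊢
    linear_combination (r'.1.1.1.1 * r'.1.1.2.2 - r'.1.1.1.2 * r'.1.1.2.1) * h1 + h2⟩⟩

instance : One (Gate d) := ⟨⟨(((1, 0), (0, 1)), 0), by simp [IsGate, detv]⟩⟩

instance : Inv (Gate d) :=
  ⟨fun r => ⟨(invS r.1.1, -pullv (invS r.1.1) r.1.2), by
    rw [IsGate, detv_invS]; exact r.2⟩⟩

lemma gate_mul_val (r r' : Gate d) :
    (r * r').1 = (compS r.1.1 r'.1.1, r'.1.2 + pullv r'.1.1 r.1.2) := rfl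

lemma gate_one_val : (1 : Gate d).1 = (((1, 0), (0, 1)), 0) := rfl

lemma gate_inv_val (r : Gate d) : (r⁻¹).1 = (invS r.1.1, -pullv (invS r.1.1) r.1.2) := rfl

instance : Group (Gate d) :=
  Group.ofLeftAxioms
    (fun a b c => by
      apply Subtype.ext
      simp only [gate_mul_val]
      ext <;> simp only [compS, pullv, Prod.fst_add, Prod.snd_add] <;> ring)
    (fun a => by
      apply Subtype.ext
      simp only [gate_mul_val, gate_one_val]
      ext <;> simp [compS, pullv])
    (fun a => by
      have ha := a.2
      simp only [IsGate, detv] at ha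
      apply Subtype.ext
      simp only [gate_mul_val, gate_one_val, gate_inv_val]
      ext <;> simp only [compS, pullv, invS, Prod.fst_add, Prod.snd_add, Prod.fst_neg, Prod.snd_neg,
        Prod.fst_zero, Prod.snd_zero]
      · linear_combination ha
      · ring
      · ring
      · linear_combination ha
      · linear_combination -a.1.2.1 * ha
      · linear_combination -a.1.2.2 * ha)

/-- The action of a pair of gate labels on a tuple. -/
def actTup (r r' : Label d) (t : Tup d) : Tup d :=
  (mulS r.1 t.1, mulS r'.1 t.2.1, t.2.2 - dotv r.2 t.1 - dotv r'.2 t.2.1)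

instance : MulAction (Gate d × Gate d) (Tup d) where
  smul g t := actTup g.1.1 g.2.1 t
  one_smul t := by
    change actTup (1 : Gate d).1 (1 : Gate d).1 t = t
    rw [gate_one_val]
    ext <;> simp [actTup, mulS, dotv]
  mul_smul g g' t := by
    change actTup (g.1 * g'.1).1 (g.2 * g'.2).1 t = actTup g.1.1 g.2.1 (actTup g'.1.1 g'.2.1 t)
    simp only [gate_mul_val, actTup, mulS_compS, add_dotv, dotv_pullv]
    refine Prod.ext rfl (Prod.ext rfl ?_)
    simp only
    ring

lemma smul_tup (g : Gate d × Gate d) (t : Tup d) : g • t = actTup g.1.1 g.2.1 t := rfl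

/-- The operator of a set of tuples. -/
noncomputable def opF (h : ZMod d) (F : Finset (Tup d)) : TwoQuditOp d :=
  ∑ t ∈ F, chi (-t.2.2) • weyl2 h t.1 t.2.1

lemma conj_opF {h : ZMod d} {A B : QuditOp d} {g : Gate d × Gate d} (hA : Realizes h A g.1.1)
    (hB : Realizes h B g.2.1) (F : Finset (Tup d)) :
    (A ⊗ₖ B) * opF h F * (A ⊗ₖ B)ᴴ = opF h (g • F) := by
  rw [opF, opF, Finset.mul_sum, Finset.sum_mul, ← Finset.image_smul,
    Finset.sum_image fun x _ y _ e => MulAction.injective g e]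
  refine Finset.sum_congr rfl fun t _ => ?_
  rw [Matrix.mul_smul, Matrix.smul_mul, hA.kronecker_conj hB, smul_smul, ← AddChar.map_add_eq_mul]
  simp only [smul_tup, actTup]
  congr 2
  ring

lemma localOrbit_eq {h : ZMod d} (hh : 2 * h = 1) (a b : ℂ) (F : Finset (Tup d)) :
    localOrbit d (a • 1 + b • opF h F) =
      (fun F' => a • (1 : TwoQuditOp d) + b • opF h F') '' MulAction.orbit (Gate d × Gate d) F := by
  have key : ∀ {A B : QuditOp d} {g : Gate d × Gate d}, Realizes h A g.1.1 → Realizes h B g.2.1 →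
      (A ⊗ₖ B) * (a • 1 + b • opF h F) * (A ⊗ₖ B)ᴴ = a • 1 + b • opF h (g • F) := by
    intro A B g hA hB
    rw [Matrix.mul_add, Matrix.add_mul, Matrix.mul_smul, Matrix.smul_mul, Matrix.mul_smul,
      Matrix.smul_mul, conj_opF hA hB, Matrix.mul_one,
      kronecker_mul_conj hA.mem_cliffordGates hB.mem_cliffordGates]
  ext W
  constructor
  · rintro ⟨A, hA, B, hB, rfl⟩
    obtain ⟨r, h1, hr⟩ := exists_realizes_of_mem hh hA
    obtain ⟨r', h1', hr'⟩ := exists_realizes_of_mem hh hB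
    let g : Gate d × Gate d := (⟨r, h1⟩, ⟨r', h1'⟩)
    exact ⟨g • F, MulAction.mem_orbit F g, (key (g := g) hr hr').symm⟩
  · rintro ⟨_, ⟨g, rfl⟩, rfl⟩
    obtain ⟨A, hA⟩ := exists_realizes hh g.1.1 g.1.2
    obtain ⟨B, hB⟩ := exists_realizes hh g.2.1 g.2.2
    exact ⟨A, hA.mem_cliffordGates, B, hB.mem_cliffordGates, (key (g := g) hA hB).symm⟩

/-- Every node occurs with at most one phase, and all nodes have weight two. -/
def Functional (F : Finset (Tup d)) : Prop :=
  (∀ t ∈ F, ∀ t' ∈ F, t.1 = t'.1 → t.2.1 = t'.2.1 → t.2.2 = t'.2.2) ∧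
    ∀ t ∈ F, t.1 ≠ 0 ∧ t.2.1 ≠ 0

lemma Functional.smul {F : Finset (Tup d)} (hF : Functional F) (g : Gate d × Gate d) :
    Functional (g • F) := by
  constructor
  · intro t ht t' ht' e1 e2
    rw [Finset.mem_smul_finset] at ht ht'
    obtain ⟨s, hs, rfl⟩ := ht
    obtain ⟨s', hs', rfl⟩ := ht'
    simp only [smul_tup, actTup] at e1 e2 ⊢
    have f1 : s.1 = s'.1 := by rw [← invS_mulS g.1.2 s.1, e1, invS_mulS g.1.2]
    have f2 : s.2.1 = s'.2.1 := by rw [← invS_mulS g.2.2 s.2.1, e2, invS_mulS g.2.2]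
    rw [f1, f2, hF.1 s hs s' hs' f1 f2]
  · intro t ht
    rw [Finset.mem_smul_finset] at ht
    obtain ⟨s, hs, rfl⟩ := ht
    simp only [smul_tup, actTup, Ne, mulS_eq_zero_iff g.1.2, mulS_eq_zero_iff g.2.2]
    exact hF.2 s hs

/-- The coefficients of the operator of a set of tuples. -/
noncomputable def setFun (F : Finset (Tup d)) (n : Vec d × Vec d) : ℂ :=
  ∑ t ∈ F, if (t.1, t.2.1) = n then chi (-t.2.2) else 0

lemma Functional.setFun_eq {F : Finset (Tup d)} (hF : Functional F) {t : Tup d} (ht : t ∈ F) :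
    setFun F (t.1, t.2.1) = chi (-t.2.2) := by
  rw [setFun, Finset.sum_eq_single t]
  · simp
  · intro s hs hst
    rw [if_neg]
    intro e
    rw [Prod.mk.injEq] at e
    exact hst (Prod.ext e.1 (Prod.ext e.2 (hF.1 s hs t ht e.1 e.2)))
  · exact fun h => absurd ht h

lemma Functional.subset_of_setFun {F F' : Finset (Tup d)} (hF : Functional F)
    (hF' : Functional F') (e : ∀ n : Vec d × Vec d, n.1 ≠ 0 → n.2 ≠ 0 → setFun F n = setFun F' n) :
    F ⊆ F' := by
  intro t ht
  have h1 := hF.setFun_eq ht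
  rw [e _ (hF.2 t ht).1 (hF.2 t ht).2] at h1
  have : ∃ s ∈ F', (s.1, s.2.1) = (t.1, t.2.1) := by
    by_contra! h0
    rw [setFun, Finset.sum_eq_zero fun s hs => if_neg (h0 s hs)] at h1
    exact chi_ne_zero _ h1.symm
  obtain ⟨s, hs, e1⟩ := this
  have h2 := hF'.setFun_eq hs
  rw [e1, h1, chi_inj, neg_inj] at h2
  rw [Prod.mk.injEq] at e1
  rwa [show t = s from Prod.ext e1.1.symm (Prod.ext e1.2.symm h2)]

lemma Functional.eq_of_setFun {F F' : Finset (Tup d)} (hF : Functional F)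
    (hF' : Functional F') (e : ∀ n : Vec d × Vec d, n.1 ≠ 0 → n.2 ≠ 0 → setFun F n = setFun F' n) :
    F = F' :=
  (hF.subset_of_setFun hF' e).antisymm (hF'.subset_of_setFun hF fun n h1 h2 => (e n h1 h2).symm)

lemma trace_weyl2_mul_opF {h : ZMod d} (hh : 2 * h = 1) (F : Finset (Tup d)) (n : Vec d × Vec d) :
    (weyl2 h (-n.1) (-n.2) * opF h F).trace = (d : ℂ) ^ 2 * setFun F n := by
  rw [opF, setFun, Finset.mul_sum, Matrix.trace_sum, Finset.mul_sum]
  refine Finset.sum_congr rfl fun t _ => ?_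
  rw [Matrix.mul_smul, Matrix.trace_smul, weyl2_trace_mul hh]
  simp only [neg_add_eq_zero, eq_comm (b := t.1), eq_comm (b := t.2.1), Prod.ext_iff, smul_eq_mul]
  split_ifs <;> ring

lemma opF_inj {h : ZMod d} (hh : 2 * h = 1) {F F' : Finset (Tup d)} (hF : Functional F)
    (hF' : Functional F') (e : opF h F = opF h F') : F = F' := by
  refine hF.eq_of_setFun hF' fun n _ _ => ?_
  have h1 := trace_weyl2_mul_opF hh F n
  rw [e, trace_weyl2_mul_opF hh] at h1
  exact (mul_left_cancel₀ (pow_ne_zero 2 natCast_ne_zero_complex) h1).symm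

lemma affine_opF_injOn {h : ZMod d} (hh : 2 * h = 1) (a : ℂ) {b : ℂ} (hb : b ≠ 0) :
    Set.InjOn (fun F => a • (1 : TwoQuditOp d) + b • opF h F) {F | Functional F} := by
  intro F hF F' hF' e
  exact opF_inj hh hF hF' (smul_right_injective _ hb (add_left_cancel e))

lemma trace_opF_mul_vertex {h : ZMod d} (hh : 2 * h = 1) {r : Label d} (hr : IsGate r)
    {F : Finset (Tup d)} (hF : Functional F) : (opF h F * vertex h r).trace =
      functional h (fun n => setFun F (-n.1, -n.2)) (coeffVec d (vertex h r)) := by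
  rw [functional_vertex hh _ hr, opF, Finset.sum_mul, Matrix.trace_sum]
  · simp only [setFun, Finset.sum_mul]
    rw [Finset.sum_comm]
    refine Finset.sum_congr rfl fun t _ => ?_
    rw [Matrix.smul_mul, Matrix.trace_smul, trace_weyl2_mul_vertex hh hr, Finset.sum_eq_single (-t.1)]
    · rw [flipv_neg, mulS_neg, dotv_neg, neg_neg, neg_neg]
      by_cases ht : t.2.1 = mulS r.1 (flipv t.1) <;> simp [ht]
    · intro u _ hu
      rw [if_neg, zero_mul]
      intro e
      rw [Prod.mk.injEq] at e
      exact hu (by rw [e.1, neg_neg])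
    · simp
  · intro v
    refine Finset.sum_eq_zero fun t ht => if_neg fun e => ?_
    rw [Prod.mk.injEq] at e
    exact (hF.2 t ht).1 (by simpa using e.1)

lemma trace_mul_eq_re {n : Type*} [Fintype n] {W τ : Matrix n n ℂ} (hW : W.IsHermitian)
    (hτ : τ.IsHermitian) : (W * τ).trace = ((W * τ).trace.re : ℂ) := by
  have : star (W * τ).trace = (W * τ).trace := by
    rw [← Matrix.trace_conjTranspose, Matrix.conjTranspose_mul, hW.eq, hτ.eq, Matrix.trace_mul_comm]
  exact (Complex.conj_eq_iff_re.1 this).symm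

lemma isHermitian_of_mem_cliffordVertices {τ : TwoQuditOp d} (hτ : τ ∈ cliffordVertices d) :
    τ.IsHermitian := by
  obtain ⟨U, -, rfl⟩ := hτ
  rw [Matrix.IsHermitian, choiState, Matrix.conjTranspose_vecMulVec, star_star]

/-- True facets with the same normalization and the same contact vertices coincide. -/
lemma eq_of_contactVertices_eq {h : ZMod d} (hh : 2 * h = 1) {a b : ℂ} (hb : b ≠ 0)
    {F F' : Finset (Tup d)} (hF : Functional F) (hF' : Functional F') {g : ℝ}
    (h1 : IsTrueFacet d (a • 1 + b • opF h F) g) (h2 : IsTrueFacet d (a • 1 + b • opF h F') g)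
    (e : contactVertices d (a • 1 + b • opF h F) g = contactVertices d (a • 1 + b • opF h F') g) :
    F = F' := by
  set V := contactVertices d (a • 1 + b • opF h F) g with hV
  have hspan : Submodule.span ℂ (coeffVec d '' V) = ⊤ := by
    apply Submodule.eq_top_of_finrank_eq
    rw [Module.finrank_fintype_fun_eq_card, card_weightTwo]
    exact h1.2
  set φ := functional h (fun n => setFun F (-n.1, -n.2)) with hφ
  set φ' := functional h (fun n => setFun F' (-n.1, -n.2)) with hφ'
  have key : φ = φ' := by
    refine LinearMap.ext_on hspan ?_
    rintro _ ⟨τ, hτ, rfl⟩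
    have hτ' : τ ∈ contactVertices d (a • 1 + b • opF h F') g := e ▸ hτ
    have hτh := isHermitian_of_mem_cliffordVertices hτ.1
    have e1 := trace_mul_eq_re h1.1.1 hτh
    have e2 := trace_mul_eq_re h2.1.1 hτh
    rw [hτ.2, Matrix.add_mul, Matrix.trace_add] at e1
    rw [hτ'.2, Matrix.add_mul, Matrix.trace_add, ← e1, add_right_inj, Matrix.smul_mul,
      Matrix.smul_mul, Matrix.trace_smul, Matrix.trace_smul] at e2
    have e3 := smul_right_injective ℂ hb e2
    have hv := hτ.1
    rw [cliffordVertices_eq hh] at hv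
    obtain ⟨r, hr, rfl⟩ := hv
    rw [trace_opF_mul_vertex hh hr hF, trace_opF_mul_vertex hh hr hF'] at e3
    exact e3.symm
  refine hF.eq_of_setFun hF' fun n n1 n2 => ?_
  obtain ⟨w, hw⟩ := WeightTwo.exists_node (n := (-n.1, -n.2)) (neg_ne_zero.2 n1) (neg_ne_zero.2 n2)
  have := LinearMap.congr_fun key (Pi.single w 1)
  rw [hφ, hφ', functional_single, functional_single, hw, neg_neg, neg_neg] at this
  exact mul_right_cancel₀ (chi_ne_zero _) this

end GateGroup

section Stabilizer

variable {d : ℕ} [NeZero d] [Fact d.Prime]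

/-- Equality of vectors, in a form that evaluates fast. -/
def eqVec (u v : Vec d) : Bool := (u.1.val.beq v.1.val).and (u.2.val.beq v.2.val)

lemma eqVec_iff {u v : Vec d} : eqVec u v = true ↔ u = v := by
  change (_ && _) = true ↔ _
  rw [Bool.and_eq_true, Nat.beq_eq, Nat.beq_eq, Prod.ext_iff, (ZMod.val_injective d).eq_iff,
    (ZMod.val_injective d).eq_iff]

/-- The phase of a node in a list of tuples. -/
def look (mv : List (Tup d)) (u v : Vec d) : Option (ZMod d) :=
  (mv.find? fun t => (eqVec t.1 u).and (eqVec t.2.1 v)).map fun t => t.2.2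

/-- A linear map preserves the nodes of a list of tuples. -/
def preservesNodes (mv : List (Tup d)) (S S' : Lin d) : Bool :=
  mv.all fun t => (look mv (mulS S t.1) (mulS S' t.2.1)).isSome

/-- A pair of gate labels preserves a list of tuples. -/
def preserves (mv : List (Tup d)) (S S' : Lin d) (l l' : Vec d) : Bool :=
  mv.all fun t => look mv (mulS S t.1) (mulS S' t.2.1) == some (t.2.2 - dotv l t.1 - dotv l' t.2.1)

/-- The number of pairs of gate labels that preserve a list of tuples. -/
def stabCount (mv : List (Tup d)) : ℕ :=
  ((linList d ×ˢ linList d).map fun p =>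
    if preservesNodes mv p.1 p.2 then
      (vecList d ×ˢ vecList d).countP fun q => preserves mv p.1 p.2 q.1 q.2
    else 0).sum

lemma mem_of_look {mv : List (Tup d)} {u v : Vec d} {q : ZMod d} (hl : look mv u v = some q) :
    (u, v, q) ∈ mv := by
  rw [look, Option.map_eq_some_iff] at hl
  obtain ⟨t, ht, rfl⟩ := hl
  have h1 := List.find?_some ht
  simp only [Bool.and_eq_true, eqVec_iff] at h1
  rw [← h1.1, ← h1.2]
  exact List.mem_of_find?_eq_some ht

lemma look_eq_some_iff {mv : List (Tup d)} (hF : Functional mv.toFinset) {u v : Vec d}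
    {q : ZMod d} : look mv u v = some q ↔ (u, v, q) ∈ mv := by
  refine ⟨mem_of_look, fun hm => ?_⟩
  have h1 : (look mv u v).isSome := by
    rw [look, Option.isSome_map, List.find?_isSome]
    exact ⟨_, hm, by simp [eqVec_iff]⟩
  obtain ⟨q', hq'⟩ := Option.isSome_iff_exists.1 h1
  rw [hq', Option.some_inj]
  exact hF.1 _ (List.mem_toFinset.2 (mem_of_look hq')) _ (List.mem_toFinset.2 hm) rfl rfl

lemma preserves_iff {mv : List (Tup d)} (hF : Functional mv.toFinset) (g : Gate d × Gate d) :
    preserves mv g.1.1.1 g.2.1.1 g.1.1.2 g.2.1.2 ↔ g • mv.toFinset = mv.toFinset := by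
  have h1 : g • mv.toFinset = mv.toFinset ↔ g • mv.toFinset ⊆ mv.toFinset :=
    ⟨fun h => h.subset, fun h => Finset.eq_of_subset_of_card_le h (by simp)⟩
  rw [h1, preserves, List.all_eq_true, ← Finset.image_smul, Finset.image_subset_iff]
  simp only [beq_iff_eq, look_eq_some_iff hF, List.mem_toFinset]
  rfl

lemma preservesNodes_of_preserves {mv : List (Tup d)} {S S' : Lin d} {l l' : Vec d}
    (hp : preserves mv S S' l l') : preservesNodes mv S S' := by
  rw [preserves, List.all_eq_true] at hp
  rw [preservesNodes, List.all_eq_true]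
  intro t ht
  rw [beq_iff_eq.1 (hp t ht)]
  rfl

lemma card_stabilizer {mv : List (Tup d)} (hF : Functional mv.toFinset) :
    Nat.card (MulAction.stabilizer (Gate d × Gate d) mv.toFinset) = stabCount mv := by
  let j : Gate d × Gate d → (Lin d × Lin d) × (Vec d × Vec d) :=
    fun g => ((g.1.1.1, g.2.1.1), (g.1.1.2, g.2.1.2))
  have hj : Function.Injective j := by
    rintro ⟨⟨⟨S, l⟩, h1⟩, ⟨⟨S', l'⟩, h1'⟩⟩ ⟨⟨⟨T, m⟩, h2⟩, ⟨⟨T', m'⟩, h2'⟩⟩ e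
    simp only [j, Prod.mk.injEq] at e
    obtain ⟨⟨rfl, rfl⟩, rfl, rfl⟩ := e
    rfl
  have e : j '' (MulAction.stabilizer (Gate d × Gate d) mv.toFinset : Set (Gate d × Gate d)) =
      ((((linList d ×ˢ linList d) ×ˢ (vecList d ×ˢ vecList d)).filter fun x =>
        preserves mv x.1.1 x.1.2 x.2.1 x.2.2).toFinset : Set _) := by
    ext ⟨⟨S, S'⟩, ⟨l, l'⟩⟩
    simp only [Set.mem_image, SetLike.mem_coe, MulAction.mem_stabilizer_iff, ← preserves_iff hF,
      List.coe_toFinset, Set.mem_ofPred_eq, List.mem_filter, List.mem_product, mem_linList,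
      mem_vecList, and_true]
    constructor
    · rintro ⟨g, hg, he⟩
      simp only [j, Prod.mk.injEq] at he
      obtain ⟨⟨rfl, rfl⟩, rfl, rfl⟩ := he
      exact ⟨⟨g.1.2, g.2.2⟩, hg⟩
    · rintro ⟨⟨h1, h2⟩, h3⟩
      exact ⟨(⟨(S, l), h1⟩, ⟨(S', l'), h2⟩), h3, rfl⟩
  have hc : Nat.card (MulAction.stabilizer (Gate d × Gate d) mv.toFinset) =
      (MulAction.stabilizer (Gate d × Gate d) mv.toFinset : Set (Gate d × Gate d)).ncard := rfl
  rw [hc, ← Set.ncard_image_of_injective _ hj, e, Set.ncard_coe_finset,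
    List.toFinset_card_of_nodup (((nodup_linList.product nodup_linList).product
      (nodup_vecList.product nodup_vecList)).filter _), ← List.countP_eq_length_filter,
    countP_product, stabCount]
  congr 1
  refine List.map_congr_left fun p _ => ?_
  split_ifs with hp
  · rfl
  · rw [List.countP_eq_zero]
    exact fun q _ hq => hp (preservesNodes_of_preserves hq)

lemma ncard_orbit_mul {mv : List (Tup d)} (hF : Functional mv.toFinset) :
    (MulAction.orbit (Gate d × Gate d) mv.toFinset).ncard * stabCount mv =
      tally ([] : List (Tup d)) 0 ^ 2 := by
  have h1 : Nat.card (Gate d) = tally ([] : List (Tup d)) 0 := by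
    rw [← ncard_contactLabels]
    change (({r | IsGate r} : Set (Label d))).ncard = _
    congr 1
    ext r
    simp [contactLabels, value]
  rw [← card_stabilizer hF, ← MulAction.index_stabilizer, Subgroup.index_mul_card, Nat.card_prod, h1,
    sq]

end Stabilizer

section Qutrit

lemma two_mul_two : (2 : ZMod 3) * 2 = 1 := rfl

/-- No node occurs with two phases. -/
def uniqueCheck (mv : List (Tup 3)) : Bool :=
  mv.all fun t => mv.all fun t' => t.1 ≠ t'.1 || t.2.1 ≠ t'.2.1 || t.2.2 = t'.2.2

/-- The set of tuples of a qutrit witness. -/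
def tupleSet (ts : List (Tup 3)) : Finset (Tup 3) := (movesOf ts).toFinset

/-- The qutrit operators `(1 + ∑ ω ^ (-q) T) / 9` given by a set of tuples. -/
noncomputable def qutritOp (F : Finset (Tup 3)) : TwoQuditOp 3 :=
  (1 / 9 : ℂ) • (1 : TwoQuditOp 3) + (1 / 9 : ℂ) • opF 2 F

/-- A qutrit witness that is given by a list of tuples. -/
structure IsQutritWitness (W : TwoQuditOp 3) (ts : List (Tup 3)) (n : ℕ) : Prop where
  represents : Represents 2 W 0 ts n
  eq_opF : W = qutritOp (tupleSet ts)
  nonzero : NonzeroTups ts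
  rigid : rigidCheck ts n
  unique : uniqueCheck (movesOf ts)
  ne : ∃ r : Label 3, IsGate r ∧ value r ts ≠ n

lemma represents_qutrit {W : TwoQuditOp 3} {l : List (ZMod 3 × ZMod 3 × ZMod 3 × ZMod 3 × ZMod 3)}
    {n : ℕ} (hW : W = (1 / 3 : ℂ) • (projSum 3 l - ((n : ℂ) / 3) • (1 : TwoQuditOp 3))) :
    Represents 2 W 0 (l.map (conv 2)) n := by
  subst hW
  rw [projSum_eq_opT two_mul_two]
  refine ⟨?_, 1 / 9, by norm_num, fun r hr => ?_⟩
  · have h1 : ((1 / 3 : ℝ) • (opT 2 (l.map (conv 2)) - ((n : ℝ) / 3) • (1 : TwoQuditOp 3))) =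
        (1 / 3 : ℂ) • (opT 2 (l.map (conv 2)) - ((n : ℂ) / 3) • (1 : TwoQuditOp 3)) := by
      ext i j
      simp
    rw [← h1]
    exact ((opT_isHermitian two_mul_two _).sub
      (Matrix.isHermitian_one.smul (IsSelfAdjoint.all _))).smul (IsSelfAdjoint.all _)
  · rw [Matrix.smul_mul, Matrix.trace_smul, Matrix.sub_mul, Matrix.trace_sub, Matrix.smul_mul,
      Matrix.trace_smul, Matrix.one_mul, trace_vertex two_mul_two hr,
      trace_opT_mul_vertex two_mul_two hr]
    have : (1 / 3 : ℂ) • ((value r (l.map (conv 2)) : ℂ) / ((3 : ℕ) : ℂ) - ((n : ℂ) / 3) • (1 : ℂ)) =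
        ((0 + 1 / 9 * ((value r (l.map (conv 2)) : ℝ) - n) : ℝ) : ℂ) := by
      push_cast
      simp only [smul_eq_mul]
      ring
    rw [this, Complex.ofReal_re]

lemma sum_zmod_three {M : Type*} [AddCommMonoid M] (f : ZMod 3 → M) :
    ∑ m, f m = f 0 + f 1 + f 2 := Fin.sum_univ_three f

lemma projT_three (t : Tup 3) : projT 2 t = (1 / 3 : ℂ) • ((1 : TwoQuditOp 3) +
    chi (-t.2.2) • weyl2 2 t.1 t.2.1 +
      chi (-(negTup t).2.2) • weyl2 2 (negTup t).1 (negTup t).2.1) := by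
  have h1 : ∀ u : Vec 3, smulv 0 u = 0 := fun u => by simp [smulv]
  have h2 : ∀ u : Vec 3, smulv 1 u = u := fun u => by simp [smulv]
  have h3 : ∀ u : Vec 3, smulv 2 u = -u := fun u => by
    have : (2 : ZMod 3) = -1 := rfl
    rw [this]
    ext <;> simp [smulv]
  have h4 : ∀ x : ZMod 3, -(2 * x) = -(-x) := fun x => by
    have : (2 : ZMod 3) = -1 := rfl
    rw [this]
    ring
  rw [projT, sum_zmod_three]
  simp [h1, h2, h3, h4, negTup]

lemma opT_three (ts : List (Tup 3)) : opT 2 ts = (ts.length / 3 : ℂ) • (1 : TwoQuditOp 3) +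
    (1 / 3 : ℂ) • ((movesOf ts).map fun t => chi (-t.2.2) • weyl2 2 t.1 t.2.1).sum := by
  rw [movesOf, List.map_append, List.sum_append]
  induction ts with
  | nil => simp [opT]
  | cons t ts ih =>
    simp only [opT, List.map_cons, List.sum_cons, List.length_cons] at ih ⊢
    rw [ih, projT_three]
    push_cast
    module

lemma qutrit_eq_opF {W : TwoQuditOp 3} {l : List (ZMod 3 × ZMod 3 × ZMod 3 × ZMod 3 × ZMod 3)}
    {n : ℕ} (hW : W = (1 / 3 : ℂ) • (projSum 3 l - ((n : ℂ) / 3) • (1 : TwoQuditOp 3)))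
    (hl : l.length = n + 1) (hn : (movesOf (l.map (conv 2))).Nodup) :
    W = qutritOp (tupleSet (l.map (conv 2))) := by
  rw [hW, projSum_eq_opT two_mul_two, opT_three, List.length_map, hl, qutritOp, opF, tupleSet,
    List.sum_toFinset _ hn]
  push_cast
  module

lemma functional_tupleSet {ts : List (Tup 3)} (h0 : NonzeroTups ts)
    (hu : uniqueCheck (movesOf ts)) : Functional (tupleSet ts) := by
  constructor
  · intro t ht t' ht' e1 e2
    rw [tupleSet, List.mem_toFinset] at ht ht'
    have := List.all_eq_true.1 (List.all_eq_true.1 hu t ht) t' ht'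
    simpa [e1, e2] using this
  · intro t ht
    rw [tupleSet, List.mem_toFinset, movesOf, List.mem_append] at ht
    rcases ht with ht | ht
    · exact h0 t ht
    · exact nonzeroTups_map_negTup h0 t ht

/-- The set of tuples of the elements of an orbit. -/
def tupleOrbit (ts : List (Tup 3)) : Set (Finset (Tup 3)) :=
  MulAction.orbit (Gate 3 × Gate 3) (tupleSet ts)

namespace IsQutritWitness

variable {W : TwoQuditOp 3} {ts : List (Tup 3)} {n : ℕ}

lemma functional_of_mem (hW : IsQutritWitness W ts n) {F : Finset (Tup 3)}
    (hF : F ∈ tupleOrbit ts) : Functional F := by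
  obtain ⟨g, rfl⟩ := hF
  exact (functional_tupleSet hW.nonzero hW.unique).smul g

lemma localOrbit_eq (hW : IsQutritWitness W ts n) : localOrbit 3 W = qutritOp '' tupleOrbit ts := by
  rw [hW.eq_opF, qutritOp, QuditClifford.localOrbit_eq two_mul_two]
  rfl

lemma ncard_tupleOrbit (hW : IsQutritWitness W ts n) {k m : ℕ}
    (hk : stabCount (movesOf ts) = k) (hm : 46656 = m * k) (h0 : 0 < k) :
    (tupleOrbit ts).ncard = m := by
  have h1 := ncard_orbit_mul (functional_tupleSet hW.nonzero hW.unique)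
  have h2 : tally ([] : List (Tup 3)) 0 = 216 := by decide +kernel
  rw [hk, h2, show 216 ^ 2 = 46656 from rfl, hm] at h1
  exact Nat.eq_of_mul_eq_mul_right h0 h1

lemma ncard_contactVertices (hW : IsQutritWitness W ts n) {k : ℕ} (hk : tally ts n = k) :
    (contactVertices 3 W 0).ncard = k := by
  rw [hW.represents.ncard_contactVertices two_mul_two, ncard_contactLabels, hk]

lemma isTrueFacet (hW : IsQutritWitness W ts n) {idx : List ℕ}
    {loops : List ((Vec 3 × Vec 3) × List ℕ)}
    (hl : loops.all fun p => isLoop (movesOf ts) p.1 p.2)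
    (hr : reachCheck (movesOf ts) idx (loops.map Prod.fst)) : IsTrueFacet 3 W 0 :=
  isTrueFacet_of_checks two_mul_two hW.represents hW.nonzero hW.rigid hl hr hW.ne

lemma contactRank_eq (hW : IsQutritWitness W ts n) {t : Tup 3} {tb : List (Tup 3)} {idx : List ℕ}
    (h1 : NonzeroTups (t :: tb))
    (hr : reachCheck (movesOf ts) idx [(t.1, t.2.1), (-t.1, -t.2.1)])
    (hn : notIn (t.1, t.2.1) tb && notIn (-t.1, -t.2.1) (t :: tb))
    (hn' : notIn (-t.1, -t.2.1) (tb.map negTup) && notIn (t.1, t.2.1) ((t :: tb).map negTup))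
    (ht : tableCheck ts n (t :: tb) && tableCheck ts n ((t :: tb).map negTup)) :
    contactRank 3 W 0 = 62 := by
  have := hW.represents.contactRank_add two_mul_two
  rw [finrank_annihilator_eq_two two_mul_two hW.nonzero hW.rigid h1 hr hn hn' ht] at this
  norm_num at this
  omega

lemma isPeak (hW : IsQutritWitness W ts n) (hr : contactRank 3 W 0 = 62) {k : ℕ}
    (hk : (contactVertices 3 W 0).ncard = k) (h0 : k ≠ 0) : IsPeak 3 W 0 :=
  ⟨hW.represents.isSupporting two_mul_two (le_value_of_rigidCheck hW.rigid) hW.ne,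
    Set.nonempty_of_ncard_ne_zero (hk ▸ h0), by rw [hr]; norm_num⟩

end IsQutritWitness

lemma disjoint_tupleOrbit_of_ncard_ne {ts ts' : List (Tup 3)}
    (h : (tupleOrbit ts).ncard ≠ (tupleOrbit ts').ncard) :
    Disjoint (tupleOrbit ts) (tupleOrbit ts') := by
  rw [Set.disjoint_left]
  intro F h1 h2
  apply h
  rw [tupleOrbit, tupleOrbit, ← MulAction.orbit_eq_iff.2 h1, ← MulAction.orbit_eq_iff.2 h2]

/-- The second components of all tuples are parallel. -/
def SecondParallel (ts : List (Tup 3)) : Prop := ∀ t ∈ ts, ∀ t' ∈ ts, detv t.2.1 t'.2.1 = 0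

lemma disjoint_tupleOrbit_of_secondParallel {ts ts' : List (Tup 3)}
    (h : SecondParallel (movesOf ts)) (h' : ¬ SecondParallel (movesOf ts')) :
    Disjoint (tupleOrbit ts) (tupleOrbit ts') := by
  rw [Set.disjoint_left]
  intro F h1 h2
  apply h'
  have h3 : tupleSet ts' ∈ MulAction.orbit (Gate 3 × Gate 3) (tupleSet ts) := by
    rw [← MulAction.orbit_eq_iff, ← MulAction.orbit_eq_iff.2 h1, ← MulAction.orbit_eq_iff.2 h2]
  obtain ⟨g, hg⟩ := h3
  have key : ∀ t ∈ movesOf ts', ∃ s ∈ movesOf ts, t.2.1 = mulS g.2.1.1 s.2.1 := by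
    intro t ht
    have : t ∈ g • tupleSet ts := by
      change t ∈ (fun m : Gate 3 × Gate 3 => m • tupleSet ts) g
      rw [hg, tupleSet, List.mem_toFinset]
      exact ht
    rw [Finset.mem_smul_finset] at this
    obtain ⟨s, hs, rfl⟩ := this
    rw [tupleSet, List.mem_toFinset] at hs
    exact ⟨s, hs, rfl⟩
  intro t ht t' ht'
  obtain ⟨s, hs, e⟩ := key t ht
  obtain ⟨s', hs', e'⟩ := key t' ht'
  rw [e, e', detv_mulS, h s hs s' hs', mul_zero]

lemma qutritOp_injOn {X : Set (Finset (Tup 3))} (hX : ∀ F ∈ X, Functional F) :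
    Set.InjOn qutritOp X :=
  (affine_opF_injOn two_mul_two (1 / 9) (by norm_num)).mono hX

lemma contactVertices_injOn {X : Set (Finset (Tup 3))} (hX : ∀ F ∈ X, Functional F)
    (hf : ∀ W ∈ qutritOp '' X, IsTrueFacet 3 W 0) :
    Set.InjOn (fun W => contactVertices 3 W 0) (qutritOp '' X) := by
  rintro _ ⟨F, hF, rfl⟩ _ ⟨F', hF', rfl⟩ e
  rw [eq_of_contactVertices_eq two_mul_two (by norm_num) (hX F hF) (hX F' hF')
    (hf _ ⟨F, hF, rfl⟩) (hf _ ⟨F', hF', rfl⟩) e]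

/-- The tuples of `W_A^{(1)}`. -/
def listA1 : List (ZMod 3 × ZMod 3 × ZMod 3 × ZMod 3 × ZMod 3) :=
  [(0, 0, 1, 1, 0), (0, 0, 1, 2, 0), (1, 0, 0, 1, 0), (1, 0, 0, 2, 0), (1, 0, 1, 1, 0),
   (1, 0, 1, 2, 0), (1, 0, 2, 1, 0), (1, 0, 2, 2, 0)]

lemma qutrit_WA1 : IsQutritWitness WA1 (listA1.map (conv 2)) 7 where
  represents := represents_qutrit (by simp only [WA1, listA1, Nat.cast_ofNat])
  eq_opF := qutrit_eq_opF (n := 7) (by simp only [WA1, listA1, Nat.cast_ofNat]) rfl (by decide +kernel)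
  nonzero := by unfold NonzeroTups; decide +kernel
  rigid := by decide +kernel
  unique := by decide +kernel
  ne := ⟨(((0, 2), (1, 0)), (0, 0)), by decide +kernel⟩

lemma ncard_contactVertices_WA1 : (contactVertices 3 WA1 0).ncard = 144 :=
  qutrit_WA1.ncard_contactVertices (by decide +kernel)

lemma ncard_tupleOrbit_WA1 : (tupleOrbit (listA1.map (conv 2))).ncard = 864 :=
  qutrit_WA1.ncard_tupleOrbit (k := 54) (by decide +kernel) rfl (by decide)

lemma isTrueFacet_WA1 : IsTrueFacet 3 WA1 0 :=
  qutrit_WA1.isTrueFacet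
    (loops := [(((0, 1), (1, 0)), [10, 9, 11, 14]), (((0, 1), (2, 0)), [11, 8, 10, 15])])
    (idx := [4, 9, 11, 13]) (by decide +kernel) (by decide +kernel)

/-- The tuples of `W_A^{(2)}`. -/
def listA2 : List (ZMod 3 × ZMod 3 × ZMod 3 × ZMod 3 × ZMod 3) :=
  [(0, 0, 1, 1, 0), (0, 0, 1, 2, 0), (1, 0, 0, 1, 0), (1, 0, 0, 2, 0), (1, 0, 1, 1, 1),
   (1, 0, 1, 2, 1), (1, 0, 2, 1, 2), (1, 0, 2, 2, 2)]

lemma qutrit_WA2 : IsQutritWitness WA2 (listA2.map (conv 2)) 7 where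
  represents := represents_qutrit (by simp only [WA2, listA2, Nat.cast_ofNat])
  eq_opF := qutrit_eq_opF (n := 7) (by simp only [WA2, listA2, Nat.cast_ofNat]) rfl (by decide +kernel)
  nonzero := by unfold NonzeroTups; decide +kernel
  rigid := by decide +kernel
  unique := by decide +kernel
  ne := ⟨(((0, 2), (1, 0)), (0, 0)), by decide +kernel⟩

lemma ncard_contactVertices_WA2 : (contactVertices 3 WA2 0).ncard = 144 :=
  qutrit_WA2.ncard_contactVertices (by decide +kernel)

lemma ncard_tupleOrbit_WA2 : (tupleOrbit (listA2.map (conv 2))).ncard = 108 :=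
  qutrit_WA2.ncard_tupleOrbit (k := 432) (by decide +kernel) rfl (by decide)

/-- The phases of a functional that vanishes on the contact vertices of `W_A^{(2)}`. -/
def tableA2 : List (Tup 3) :=
  [((2, 1), (1, 2), 0), ((2, 0), (1, 2), 0), ((2, 2), (1, 2), 0), ((1, 1), (1, 1), 0),
   ((1, 2), (1, 1), 0), ((1, 0), (1, 1), 0), ((2, 0), (1, 1), 0), ((1, 0), (1, 0), 0),
   ((2, 2), (1, 0), 0), ((0, 2), (1, 1), 0), ((2, 2), (1, 1), 0), ((1, 1), (1, 0), 0),
   ((2, 1), (1, 0), 0), ((2, 1), (1, 1), 0), ((1, 2), (1, 0), 0), ((2, 0), (1, 0), 0),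
   ((1, 0), (1, 2), 0), ((0, 2), (1, 2), 0), ((1, 1), (1, 2), 0), ((1, 2), (1, 2), 0),
   ((0, 1), (1, 2), 0), ((0, 2), (1, 0), 0), ((0, 1), (1, 1), 0)]

lemma contactRank_WA2 : contactRank 3 WA2 0 = 62 :=
  qutrit_WA2.contactRank_eq (t := ((0, 1), (1, 0), 0)) (tb := tableA2)
    (idx := [4, 9, 11, 13]) (by unfold NonzeroTups; decide +kernel) (by decide +kernel)
    (by decide +kernel) (by decide +kernel) (by decide +kernel)

/-- The tuples of `W_{A^T}^{(1)}`. -/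
def listAT1 : List (ZMod 3 × ZMod 3 × ZMod 3 × ZMod 3 × ZMod 3) :=
  [(0, 0, 1, 1, 0), (0, 0, 1, 2, 0), (0, 1, 1, 0, 0), (0, 1, 1, 1, 0), (0, 1, 1, 2, 0),
   (0, 1, 2, 0, 0), (0, 1, 2, 1, 0), (0, 1, 2, 2, 0)]

lemma qutrit_WAT1 : IsQutritWitness WAT1 (listAT1.map (conv 2)) 7 where
  represents := represents_qutrit (by simp only [WAT1, listAT1, Nat.cast_ofNat])
  eq_opF := qutrit_eq_opF (n := 7) (by simp only [WAT1, listAT1, Nat.cast_ofNat]) rfl (by decide +kernel)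
  nonzero := by unfold NonzeroTups; decide +kernel
  rigid := by decide +kernel
  unique := by decide +kernel
  ne := ⟨(((0, 2), (1, 0)), (0, 0)), by decide +kernel⟩

lemma ncard_contactVertices_WAT1 : (contactVertices 3 WAT1 0).ncard = 144 :=
  qutrit_WAT1.ncard_contactVertices (by decide +kernel)

lemma ncard_tupleOrbit_WAT1 : (tupleOrbit (listAT1.map (conv 2))).ncard = 864 :=
  qutrit_WAT1.ncard_tupleOrbit (k := 54) (by decide +kernel) rfl (by decide)

lemma isTrueFacet_WAT1 : IsTrueFacet 3 WAT1 0 :=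
  qutrit_WAT1.isTrueFacet
    (loops := [(((1, 0), (0, 1)), [10, 1, 13, 12]), (((2, 0), (0, 1)), [13, 8, 10, 15])])
    (idx := [4, 8, 9, 13]) (by decide +kernel) (by decide +kernel)

/-- The tuples of `W_{A^T}^{(2)}`. -/
def listAT2 : List (ZMod 3 × ZMod 3 × ZMod 3 × ZMod 3 × ZMod 3) :=
  [(0, 0, 1, 1, 0), (0, 0, 1, 2, 0), (0, 1, 1, 0, 0), (0, 1, 1, 1, 1), (0, 1, 1, 2, 2),
   (0, 1, 2, 0, 0), (0, 1, 2, 1, 1), (0, 1, 2, 2, 2)]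

lemma qutrit_WAT2 : IsQutritWitness WAT2 (listAT2.map (conv 2)) 7 where
  represents := represents_qutrit (by simp only [WAT2, listAT2, Nat.cast_ofNat])
  eq_opF := qutrit_eq_opF (n := 7) (by simp only [WAT2, listAT2, Nat.cast_ofNat]) rfl (by decide +kernel)
  nonzero := by unfold NonzeroTups; decide +kernel
  rigid := by decide +kernel
  unique := by decide +kernel
  ne := ⟨(((0, 2), (1, 0)), (0, 0)), by decide +kernel⟩

lemma ncard_contactVertices_WAT2 : (contactVertices 3 WAT2 0).ncard = 144 :=
  qutrit_WAT2.ncard_contactVertices (by decide +kernel)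

lemma ncard_tupleOrbit_WAT2 : (tupleOrbit (listAT2.map (conv 2))).ncard = 108 :=
  qutrit_WAT2.ncard_tupleOrbit (k := 432) (by decide +kernel) rfl (by decide)

/-- The phases of a functional that vanishes on the contact vertices of `W_{A^T}^{(2)}`. -/
def tableAT2 : List (Tup 3) :=
  [((1, 2), (2, 1), 0), ((1, 2), (2, 0), 0), ((1, 2), (2, 2), 0), ((1, 1), (1, 1), 0),
   ((1, 1), (1, 2), 0), ((1, 1), (1, 0), 0), ((1, 1), (2, 0), 0), ((1, 0), (1, 0), 0),
   ((1, 0), (2, 2), 0), ((1, 1), (0, 2), 0), ((1, 1), (2, 2), 0), ((1, 0), (1, 1), 0),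
   ((1, 0), (2, 1), 0), ((1, 1), (2, 1), 0), ((1, 0), (1, 2), 0), ((1, 0), (2, 0), 0),
   ((1, 2), (0, 2), 0), ((1, 2), (1, 0), 0), ((1, 2), (1, 1), 0), ((1, 2), (1, 2), 0),
   ((1, 2), (0, 1), 0), ((1, 0), (0, 2), 0), ((1, 1), (0, 1), 0)]

lemma contactRank_WAT2 : contactRank 3 WAT2 0 = 62 :=
  qutrit_WAT2.contactRank_eq (t := ((1, 0), (0, 1), 0)) (tb := tableAT2)
    (idx := [4, 8, 9, 13]) (by unfold NonzeroTups; decide +kernel) (by decide +kernel)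
    (by decide +kernel) (by decide +kernel) (by decide +kernel)

/-- The tuples of `W_B^{(1)}`. -/
def listB1 : List (ZMod 3 × ZMod 3 × ZMod 3 × ZMod 3 × ZMod 3) :=
  [(0, 0, 1, 1, 0), (0, 0, 1, 2, 0), (1, 2, 0, 0, 0), (1, 2, 0, 1, 0), (1, 2, 0, 2, 0),
   (1, 2, 1, 0, 0), (1, 2, 1, 1, 0), (1, 2, 1, 2, 0), (1, 2, 2, 0, 0), (1, 2, 2, 1, 0),
   (1, 2, 2, 2, 0)]

lemma qutrit_WB1 : IsQutritWitness WB1 (listB1.map (conv 2)) 10 where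
  represents := represents_qutrit (by simp only [WB1, listB1, Nat.cast_ofNat])
  eq_opF := qutrit_eq_opF (n := 10) (by simp only [WB1, listB1, Nat.cast_ofNat]) rfl (by decide +kernel)
  nonzero := by unfold NonzeroTups; decide +kernel
  rigid := by decide +kernel
  unique := by decide +kernel
  ne := ⟨(((0, 2), (1, 0)), (0, 1)), by decide +kernel⟩

lemma ncard_contactVertices_WB1 : (contactVertices 3 WB1 0).ncard = 150 :=
  qutrit_WB1.ncard_contactVertices (by decide +kernel)

lemma ncard_tupleOrbit_WB1 : (tupleOrbit (listB1.map (conv 2))).ncard = 1728 :=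
  qutrit_WB1.ncard_tupleOrbit (k := 27) (by decide +kernel) rfl (by decide)

lemma isTrueFacet_WB1 : IsTrueFacet 3 WB1 0 :=
  qutrit_WB1.isTrueFacet
    (loops := [(((0, 1), (1, 0)), [14, 13, 1, 17]), (((0, 1), (2, 0)), [15, 1, 20, 21])])
    (idx := [1, 7, 13, 14, 21]) (by decide +kernel) (by decide +kernel)

/-- The tuples of `W_B^{(2)}`. -/
def listB2 : List (ZMod 3 × ZMod 3 × ZMod 3 × ZMod 3 × ZMod 3) :=
  [(0, 0, 1, 1, 0), (0, 0, 1, 2, 0), (1, 2, 0, 0, 0), (1, 2, 0, 1, 2), (1, 2, 0, 2, 1),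
   (1, 2, 1, 0, 1), (1, 2, 1, 1, 0), (1, 2, 1, 2, 2), (1, 2, 2, 0, 2), (1, 2, 2, 1, 1),
   (1, 2, 2, 2, 0)]

lemma qutrit_WB2 : IsQutritWitness WB2 (listB2.map (conv 2)) 10 where
  represents := represents_qutrit (by simp only [WB2, listB2, Nat.cast_ofNat])
  eq_opF := qutrit_eq_opF (n := 10) (by simp only [WB2, listB2, Nat.cast_ofNat]) rfl (by decide +kernel)
  nonzero := by unfold NonzeroTups; decide +kernel
  rigid := by decide +kernel
  unique := by decide +kernel
  ne := ⟨(((0, 2), (1, 0)), (0, 0)), by decide +kernel⟩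

lemma ncard_contactVertices_WB2 : (contactVertices 3 WB2 0).ncard = 150 :=
  qutrit_WB2.ncard_contactVertices (by decide +kernel)

lemma ncard_tupleOrbit_WB2 : (tupleOrbit (listB2.map (conv 2))).ncard = 864 :=
  qutrit_WB2.ncard_tupleOrbit (k := 54) (by decide +kernel) rfl (by decide)

/-- The phases of a functional that vanishes on the contact vertices of `W_B^{(2)}`. -/
def tableB2 : List (Tup 3) :=
  [((2, 1), (2, 2), 0), ((2, 0), (2, 2), 0), ((2, 2), (2, 2), 0), ((1, 1), (0, 1), 0),
   ((1, 2), (0, 1), 0), ((1, 0), (0, 1), 0), ((2, 0), (2, 0), 0), ((1, 0), (0, 2), 0),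
   ((2, 2), (2, 1), 0), ((0, 2), (1, 2), 0), ((2, 2), (2, 0), 0), ((1, 1), (0, 2), 0),
   ((2, 1), (2, 1), 0), ((2, 1), (2, 0), 0), ((1, 2), (0, 2), 0), ((2, 0), (2, 1), 0),
   ((0, 1), (1, 1), 0), ((0, 1), (1, 2), 0), ((0, 2), (1, 1), 0), ((0, 2), (1, 0), 0)]

lemma contactRank_WB2 : contactRank 3 WB2 0 = 62 :=
  qutrit_WB2.contactRank_eq (t := ((0, 1), (1, 0), 0)) (tb := tableB2)
    (idx := [1, 7, 13, 14, 21]) (by unfold NonzeroTups; decide +kernel) (by decide +kernel)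
    (by decide +kernel) (by decide +kernel) (by decide +kernel)

/-- The tuples of `W_B^{(3)}`. -/
def listB3 : List (ZMod 3 × ZMod 3 × ZMod 3 × ZMod 3 × ZMod 3) :=
  [(0, 0, 1, 1, 0), (0, 0, 1, 2, 0), (1, 2, 0, 0, 2), (1, 2, 0, 1, 0), (1, 2, 0, 2, 2),
   (1, 2, 1, 0, 2), (1, 2, 1, 1, 2), (1, 2, 1, 2, 0), (1, 2, 2, 0, 0), (1, 2, 2, 1, 2),
   (1, 2, 2, 2, 2)]

lemma qutrit_WB3 : IsQutritWitness WB3 (listB3.map (conv 2)) 10 where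
  represents := represents_qutrit (by simp only [WB3, listB3, Nat.cast_ofNat])
  eq_opF := qutrit_eq_opF (n := 10) (by simp only [WB3, listB3, Nat.cast_ofNat]) rfl (by decide +kernel)
  nonzero := by unfold NonzeroTups; decide +kernel
  rigid := by decide +kernel
  unique := by decide +kernel
  ne := ⟨(((0, 2), (1, 0)), (0, 2)), by decide +kernel⟩

lemma ncard_contactVertices_WB3 : (contactVertices 3 WB3 0).ncard = 150 :=
  qutrit_WB3.ncard_contactVertices (by decide +kernel)

lemma ncard_tupleOrbit_WB3 : (tupleOrbit (listB3.map (conv 2))).ncard = 5184 :=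
  qutrit_WB3.ncard_tupleOrbit (k := 9) (by decide +kernel) rfl (by decide)

lemma isTrueFacet_WB3 : IsTrueFacet 3 WB3 0 :=
  qutrit_WB3.isTrueFacet
    (loops := [(((0, 1), (1, 0)), [6, 19, 5, 14]), (((0, 1), (2, 0)), [7, 16, 2, 15])])
    (idx := [1, 7, 13, 14, 21]) (by decide +kernel) (by decide +kernel)

end Qutrit

section Ququint

instance : Fact (Nat.Prime 5) := ⟨Nat.prime_five⟩

lemma two_mul_three : (2 : ZMod 5) * 3 = 1 := rfl

lemma represents_WB5 : Represents 3 WB5 (56 / 5) (listB5.map (conv 3)) 56 := by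
  rw [WB5, projSum_eq_opT two_mul_three]
  refine ⟨opT_isHermitian two_mul_three _, 1 / 5, by norm_num, fun r hr => ?_⟩
  rw [trace_opT_mul_vertex two_mul_three hr]
  have : ((value r (listB5.map (conv 3)) : ℂ) / ((5 : ℕ) : ℂ)) =
      ((56 / 5 + 1 / 5 * ((value r (listB5.map (conv 3)) : ℝ) - (56 : ℕ)) : ℝ) : ℂ) := by
    push_cast
    ring
  rw [this, Complex.ofReal_re]

lemma rigid_WB5 : rigidCheck (listB5.map (conv 3)) 56 := by decide +kernel

lemma ncard_contactVertices_WB5 : (contactVertices 5 WB5 (56 / 5)).ncard = 2420 := by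
  rw [represents_WB5.ncard_contactVertices two_mul_three, ncard_contactLabels]
  decide +kernel

lemma isTrueFacet_WB5 : IsTrueFacet 5 WB5 (56 / 5) :=
  isTrueFacet_of_checks two_mul_three represents_WB5 (by unfold NonzeroTups; decide +kernel)
    rigid_WB5
    (loops := [(((0, 1), (1, 0)), [14, 80, 17, 67]),
      (((0, 1), (2, 0)), [16, 76, 13, 69]),
      (((0, 1), (3, 0)), [15, 77, 14, 68]),
      (((0, 1), (4, 0)), [17, 71, 8, 70])])
    (idx := [4, 6, 7, 16, 38, 94, 95, 108, 113]) (by decide +kernel) (by decide +kernel)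
    ⟨(((0, 4), (1, 0)), (0, 3)), by decide +kernel⟩

end Ququint

section Orbits

lemma IsQutritWitness.ncard_localOrbit {W : TwoQuditOp 3} {ts : List (Tup 3)} {n : ℕ}
    (hW : IsQutritWitness W ts n) : (localOrbit 3 W).ncard = (tupleOrbit ts).ncard := by
  rw [hW.localOrbit_eq]
  exact (qutritOp_injOn fun _ => hW.functional_of_mem).ncard_image

lemma disjoint_tupleOrbit_listA1_listAT1 :
    Disjoint (tupleOrbit (listA1.map (conv 2))) (tupleOrbit (listAT1.map (conv 2))) :=
  disjoint_tupleOrbit_of_secondParallel (by unfold SecondParallel; decide +kernel)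
    (by unfold SecondParallel; decide +kernel)

lemma disjoint_tupleOrbit_listA2_listAT2 :
    Disjoint (tupleOrbit (listA2.map (conv 2))) (tupleOrbit (listAT2.map (conv 2))) :=
  disjoint_tupleOrbit_of_secondParallel (by unfold SecondParallel; decide +kernel)
    (by unfold SecondParallel; decide +kernel)

/-- The tuples of the operators in the orbits of the four facets. -/
def facetTuples : Set (Finset (Tup 3)) :=
  tupleOrbit (listA1.map (conv 2)) ∪ tupleOrbit (listAT1.map (conv 2)) ∪
    tupleOrbit (listB1.map (conv 2)) ∪ tupleOrbit (listB3.map (conv 2))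

/-- The tuples of the operators in the orbits of the three peaks. -/
def peakTuples : Set (Finset (Tup 3)) :=
  tupleOrbit (listA2.map (conv 2)) ∪ tupleOrbit (listAT2.map (conv 2)) ∪
    tupleOrbit (listB2.map (conv 2))

lemma facetOrbits_eq : localOrbit 3 WA1 ∪ localOrbit 3 WAT1 ∪ localOrbit 3 WB1 ∪
    localOrbit 3 WB3 = qutritOp '' facetTuples := by
  rw [facetTuples, Set.image_union, Set.image_union, Set.image_union, qutrit_WA1.localOrbit_eq,
    qutrit_WAT1.localOrbit_eq, qutrit_WB1.localOrbit_eq, qutrit_WB3.localOrbit_eq]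

lemma peakOrbits_eq : localOrbit 3 WA2 ∪ localOrbit 3 WAT2 ∪ localOrbit 3 WB2 =
    qutritOp '' peakTuples := by
  rw [peakTuples, Set.image_union, Set.image_union, qutrit_WA2.localOrbit_eq,
    qutrit_WAT2.localOrbit_eq, qutrit_WB2.localOrbit_eq]

lemma functional_of_mem_facetTuples {F : Finset (Tup 3)} (hF : F ∈ facetTuples) :
    Functional F := by
  rcases hF with ((hF | hF) | hF) | hF
  · exact qutrit_WA1.functional_of_mem hF
  · exact qutrit_WAT1.functional_of_mem hF
  · exact qutrit_WB1.functional_of_mem hF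
  · exact qutrit_WB3.functional_of_mem hF

lemma functional_of_mem_peakTuples {F : Finset (Tup 3)} (hF : F ∈ peakTuples) :
    Functional F := by
  rcases hF with (hF | hF) | hF
  · exact qutrit_WA2.functional_of_mem hF
  · exact qutrit_WAT2.functional_of_mem hF
  · exact qutrit_WB2.functional_of_mem hF

lemma ncard_facetTuples : facetTuples.ncard = 8640 := by
  rw [facetTuples, Set.ncard_union_eq _ (Set.toFinite _) (Set.toFinite _),
    Set.ncard_union_eq _ (Set.toFinite _) (Set.toFinite _),
    Set.ncard_union_eq disjoint_tupleOrbit_listA1_listAT1 (Set.toFinite _) (Set.toFinite _),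
    ncard_tupleOrbit_WA1, ncard_tupleOrbit_WAT1, ncard_tupleOrbit_WB1, ncard_tupleOrbit_WB3]
  · refine Set.disjoint_union_left.2 ⟨?_, ?_⟩ <;> refine disjoint_tupleOrbit_of_ncard_ne ?_
    · rw [ncard_tupleOrbit_WA1, ncard_tupleOrbit_WB1]; norm_num
    · rw [ncard_tupleOrbit_WAT1, ncard_tupleOrbit_WB1]; norm_num
  · refine Set.disjoint_union_left.2 ⟨Set.disjoint_union_left.2 ⟨?_, ?_⟩, ?_⟩ <;>
      refine disjoint_tupleOrbit_of_ncard_ne ?_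
    · rw [ncard_tupleOrbit_WA1, ncard_tupleOrbit_WB3]; norm_num
    · rw [ncard_tupleOrbit_WAT1, ncard_tupleOrbit_WB3]; norm_num
    · rw [ncard_tupleOrbit_WB1, ncard_tupleOrbit_WB3]; norm_num

lemma ncard_peakTuples : peakTuples.ncard = 1080 := by
  rw [peakTuples, Set.ncard_union_eq _ (Set.toFinite _) (Set.toFinite _),
    Set.ncard_union_eq disjoint_tupleOrbit_listA2_listAT2 (Set.toFinite _) (Set.toFinite _),
    ncard_tupleOrbit_WA2, ncard_tupleOrbit_WAT2, ncard_tupleOrbit_WB2]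
  refine Set.disjoint_union_left.2 ⟨?_, ?_⟩ <;> refine disjoint_tupleOrbit_of_ncard_ne ?_
  · rw [ncard_tupleOrbit_WA2, ncard_tupleOrbit_WB2]; norm_num
  · rw [ncard_tupleOrbit_WAT2, ncard_tupleOrbit_WB2]; norm_num

lemma isTrueFacet_of_mem_orbits {W : TwoQuditOp 3} (hW : W ∈ localOrbit 3 WA1 ∪
    localOrbit 3 WAT1 ∪ localOrbit 3 WB1 ∪ localOrbit 3 WB3) : IsTrueFacet 3 W 0 := by
  rcases hW with ((hW | hW) | hW) | hW
  · exact isTrueFacet_WA1.of_mem_localOrbit two_mul_two hW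
  · exact isTrueFacet_WAT1.of_mem_localOrbit two_mul_two hW
  · exact isTrueFacet_WB1.of_mem_localOrbit two_mul_two hW
  · exact isTrueFacet_WB3.of_mem_localOrbit two_mul_two hW

lemma isPeak_WA2 : IsPeak 3 WA2 0 :=
  qutrit_WA2.isPeak contactRank_WA2 ncard_contactVertices_WA2 (by decide)

lemma isPeak_WAT2 : IsPeak 3 WAT2 0 :=
  qutrit_WAT2.isPeak contactRank_WAT2 ncard_contactVertices_WAT2 (by decide)

lemma isPeak_WB2 : IsPeak 3 WB2 0 :=
  qutrit_WB2.isPeak contactRank_WB2 ncard_contactVertices_WB2 (by decide)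

lemma isPeak_of_mem_orbits {W : TwoQuditOp 3} (hW : W ∈ localOrbit 3 WA2 ∪
    localOrbit 3 WAT2 ∪ localOrbit 3 WB2) : IsPeak 3 W 0 := by
  rcases hW with (hW | hW) | hW
  · exact isPeak_WA2.of_mem_localOrbit two_mul_two hW
  · exact isPeak_WAT2.of_mem_localOrbit two_mul_two hW
  · exact isPeak_WB2.of_mem_localOrbit two_mul_two hW

end Orbits

end QuditClifford

theorem mainTheorem5 :
    -- qutrits: the four true facets
    (QuditClifford.IsTrueFacet 3 QuditClifford.WA1 0 ∧
      (QuditClifford.contactVertices 3 QuditClifford.WA1 0).ncard = 144 ∧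
      QuditClifford.contactRank 3 QuditClifford.WA1 0 = 64) ∧
    (QuditClifford.IsTrueFacet 3 QuditClifford.WAT1 0 ∧
      (QuditClifford.contactVertices 3 QuditClifford.WAT1 0).ncard = 144 ∧
      QuditClifford.contactRank 3 QuditClifford.WAT1 0 = 64) ∧
    (QuditClifford.IsTrueFacet 3 QuditClifford.WB1 0 ∧
      (QuditClifford.contactVertices 3 QuditClifford.WB1 0).ncard = 150 ∧
      QuditClifford.contactRank 3 QuditClifford.WB1 0 = 64) ∧
    (QuditClifford.IsTrueFacet 3 QuditClifford.WB3 0 ∧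
      (QuditClifford.contactVertices 3 QuditClifford.WB3 0).ncard = 150 ∧
      QuditClifford.contactRank 3 QuditClifford.WB3 0 = 64) ∧
    -- qutrits: the three peaks
    (QuditClifford.IsPeak 3 QuditClifford.WA2 0 ∧
      (QuditClifford.contactVertices 3 QuditClifford.WA2 0).ncard = 144 ∧
      QuditClifford.contactRank 3 QuditClifford.WA2 0 = 62) ∧
    (QuditClifford.IsPeak 3 QuditClifford.WAT2 0 ∧
      (QuditClifford.contactVertices 3 QuditClifford.WAT2 0).ncard = 144 ∧
      QuditClifford.contactRank 3 QuditClifford.WAT2 0 = 62) ∧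
    (QuditClifford.IsPeak 3 QuditClifford.WB2 0 ∧
      (QuditClifford.contactVertices 3 QuditClifford.WB2 0).ncard = 150 ∧
      QuditClifford.contactRank 3 QuditClifford.WB2 0 = 62) ∧
    -- qutrits: the orbits under local Clifford conjugation
    (QuditClifford.localOrbit 3 QuditClifford.WA1).ncard = 864 ∧
    (QuditClifford.localOrbit 3 QuditClifford.WA2).ncard = 108 ∧
    (QuditClifford.localOrbit 3 QuditClifford.WAT1).ncard = 864 ∧
    (QuditClifford.localOrbit 3 QuditClifford.WAT2).ncard = 108 ∧
    (QuditClifford.localOrbit 3 QuditClifford.WB1).ncard = 1728 ∧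
    (QuditClifford.localOrbit 3 QuditClifford.WB2).ncard = 864 ∧
    (QuditClifford.localOrbit 3 QuditClifford.WB3).ncard = 5184 ∧
    ((∀ W ∈ QuditClifford.localOrbit 3 QuditClifford.WA1 ∪
          QuditClifford.localOrbit 3 QuditClifford.WAT1 ∪
          QuditClifford.localOrbit 3 QuditClifford.WB1 ∪
          QuditClifford.localOrbit 3 QuditClifford.WB3, QuditClifford.IsTrueFacet 3 W 0) ∧
      (QuditClifford.localOrbit 3 QuditClifford.WA1 ∪
          QuditClifford.localOrbit 3 QuditClifford.WAT1 ∪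
          QuditClifford.localOrbit 3 QuditClifford.WB1 ∪
          QuditClifford.localOrbit 3 QuditClifford.WB3).ncard = 8640 ∧
      -- different facet operators also cut out different sets of vertices
      Set.InjOn (fun W => QuditClifford.contactVertices 3 W 0)
        (QuditClifford.localOrbit 3 QuditClifford.WA1 ∪
          QuditClifford.localOrbit 3 QuditClifford.WAT1 ∪
          QuditClifford.localOrbit 3 QuditClifford.WB1 ∪
          QuditClifford.localOrbit 3 QuditClifford.WB3)) ∧
    ((∀ W ∈ QuditClifford.localOrbit 3 QuditClifford.WA2 ∪
          QuditClifford.localOrbit 3 QuditClifford.WAT2 ∪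
          QuditClifford.localOrbit 3 QuditClifford.WB2, QuditClifford.IsPeak 3 W 0) ∧
      (QuditClifford.localOrbit 3 QuditClifford.WA2 ∪
          QuditClifford.localOrbit 3 QuditClifford.WAT2 ∪
          QuditClifford.localOrbit 3 QuditClifford.WB2).ncard = 1080) ∧
    -- ququints: the facet given by 58 projectors
    (QuditClifford.IsTrueFacet 5 QuditClifford.WB5 (56 / 5) ∧
      (QuditClifford.contactVertices 5 QuditClifford.WB5 (56 / 5)).ncard = 2420 ∧
      QuditClifford.contactRank 5 QuditClifford.WB5 (56 / 5) = 576) := by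
  open QuditClifford in
  refine ⟨⟨isTrueFacet_WA1, ncard_contactVertices_WA1, isTrueFacet_WA1.2⟩,
    ⟨isTrueFacet_WAT1, ncard_contactVertices_WAT1, isTrueFacet_WAT1.2⟩,
    ⟨isTrueFacet_WB1, ncard_contactVertices_WB1, isTrueFacet_WB1.2⟩,
    ⟨isTrueFacet_WB3, ncard_contactVertices_WB3, isTrueFacet_WB3.2⟩,
    ⟨isPeak_WA2, ncard_contactVertices_WA2, contactRank_WA2⟩,
    ⟨isPeak_WAT2, ncard_contactVertices_WAT2, contactRank_WAT2⟩,
    ⟨isPeak_WB2, ncard_contactVertices_WB2, contactRank_WB2⟩,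
    qutrit_WA1.ncard_localOrbit.trans ncard_tupleOrbit_WA1,
    qutrit_WA2.ncard_localOrbit.trans ncard_tupleOrbit_WA2,
    qutrit_WAT1.ncard_localOrbit.trans ncard_tupleOrbit_WAT1,
    qutrit_WAT2.ncard_localOrbit.trans ncard_tupleOrbit_WAT2,
    qutrit_WB1.ncard_localOrbit.trans ncard_tupleOrbit_WB1,
    qutrit_WB2.ncard_localOrbit.trans ncard_tupleOrbit_WB2,
    qutrit_WB3.ncard_localOrbit.trans ncard_tupleOrbit_WB3,
    ⟨fun _ => isTrueFacet_of_mem_orbits, ?_, ?_⟩, ⟨fun _ => isPeak_of_mem_orbits, ?_⟩,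
    isTrueFacet_WB5, ncard_contactVertices_WB5, isTrueFacet_WB5.2⟩
  · rw [facetOrbits_eq, (qutritOp_injOn fun _ => functional_of_mem_facetTuples).ncard_image,
      ncard_facetTuples]
  · rw [facetOrbits_eq]
    refine contactVertices_injOn (fun _ => functional_of_mem_facetTuples) fun W hW => ?_
    rw [← facetOrbits_eq] at hW
    exact isTrueFacet_of_mem_orbits hW
  · rw [peakOrbits_eq, (qutritOp_injOn fun _ => functional_of_mem_peakTuples).ncard_image,
      ncard_peakTuples]
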